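/- All graphs are finite and simple, $n$ and $m$ denote the numbers of vertices and edges, $N(v)$ is the set of neighbours of $v$, and "contains" means "contains as an induced subgraph". A *building* is a cycle on at least five vertices together with exactly one chord, which joins two vertices at distance two on the cycle; a graph is *building-free* if it contains no building. For $k\ge 3$, a *$k$-sun* consists of a clique $c_1,\dots,c_k$ and a stable set $d_1,\dots,d_k$ (the tips), where $d_i$ is adjacent to exactly $c_i$ and $c_{i+1}$ (indices modulo $k$). A *sun* is a $k$-sun for some $k\ge3$. **Algorithm find-sun** (input: a graph $G'$). For each vertex $x$ and each edge $yz$ with $y,z\in N(x)$: let $G$ be obtained from $G'$ by deleting all neighbours of $x$ except $y,z$; if tip-of-sunflower$(G,x)$ is true, return true. If no call returned true, return false. **Algorithm tip-of-sunflower** (input: a graph $G$ and a vertex $x$). Let $M(x)=V(G)\setminus(N(x)\cup\{x\})$ and order $M(x)$ as $y_1,\dots,y_k$ so that $|N(y_i)\cap N(x)|\le|N(y_j)\cap N(x)|$ for $i<j$, breaking ties arbitrarily. Put $G_0=G[M(x)]$. For $i=1,\dots,k$ let $A=N_{G_{i-1}}(y_i)\cap\{y_{i+1},\dots,y_k\}$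 and obtain $G_i$ from $G_{i-1}$ by making $A$ a clique and by adding every edge $y_ry_s$ ($r\neq s$, $r>i$, $y_s\in A$, $y_ry_s\notin E(G_{i-1})$) such that some $y_j\in A$ with $j<s$ is adjacent to $y_r$ in $G_{i-1}$. Let $H$ be $G$ together with the edges of $G_k$. Return in-3-sun$(H,x)$. **Algorithm in-3-sun** (input: $H$, $x$ and $y_1,\dots,y_k$ as above). Let $H'$ be obtained from $H$ by adding every edge $y_iy_p$, $i<p$, such that for some $q>p$ the vertices $y_i,y_q,y_p$ form an induced path of $H$ in this order. Let $x_1,\dots,x_r$ be an arbitrary ordering of $N(x)$. Return false if $y_1,\dots,y_k,x_1,\dots,x_r,x$ is a perfect elimination scheme of $H'$ (for every vertex, its neighbours later in the list are pairwise adjacent), and true otherwise. **Theorem.** 1. (Correctness.) On every building-free graph, find-sun returns true if the graph contains a sun and false otherwise, whatever the arbitrary choices are. 2. (Running time.) Find-sun can be implemented on a unit-cost random access machine with words of $O(\log n)$ bits, with the graph given by its adjacency matrix, so as to run in time $O(\min\{mn^3,\,m^{1.5}n^2\})$ on every graph with $m\ge1$: the implementation returns on every input graph an answer that find-sun can return on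 it. If $m=0$ it runs in time $O((n+1)^2)$. 3. (Finding a sun.) On the same machine and within the same time bounds there is an algorithm that, given a building-free graph, outputs $k\ge 3$, $d_1,\dots,d_k$ and $c_1,\dots,c_k$ that form an induced $k$-sun of the graph if the graph contains a sun, and reports that there is none otherwise. -/

import Mathlib

/-! ### Buildings and suns -/

/-- The building on `k + 5` vertices: the cycle `0, 1, …, k + 4` together with the single chord
joining `0` and `2`, which forms a triangle with the two cycle edges at the vertex `1`. -/
def building (k : ℕ) : SimpleGraph (Fin (k + 5)) :=
  SimpleGraph.cycleGraph (k + 5) ⊔ SimpleGraph.edge 0 2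

/-- No induced subgraph of `G` is a building. -/
def BuildingFree {V : Type*} (G : SimpleGraph V) : Prop :=
  ∀ k : ℕ, ¬ (building k).IsIndContained G

/-- The `k`-sun (meant for `3 ≤ k`): `Sum.inl i` is the tip `d i`, `Sum.inr i` is the clique vertex
`c i`, the tips form a stable set, and `d i` is adjacent to exactly `c i` and `c (i + 1)`, indices
modulo `k`. -/
def sun (k : ℕ) : SimpleGraph (Fin k ⊕ Fin k) :=
  SimpleGraph.fromRel fun u v =>
    match u, v with
    | Sum.inr _, Sum.inr _ => True
    | Sum.inl i, Sum.inr j => j = i ∨ j.val = (i.val + 1) % k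
    | _, _ => False

/-- Some induced subgraph of `G` is a sun. -/
def ContainsSun {V : Type*} (G : SimpleGraph V) : Prop :=
  ∃ k : ℕ, 3 ≤ k ∧ (sun k).IsIndContained G

/-! ### The algorithm find-sun and its subroutines

A subroutine that leaves choices open (how ties are broken in a sort, in which order the
neighbours of a vertex are listed) is modelled by the relation "this value can be returned". -/

/-- One round of strongly chordal completion of a graph whose vertices are the positions
`0, …, k - 1` of an ordering.  Let `A` be the set of the later neighbours of `i`.  The round makes
`A` a clique and adds every edge `r s` with `i < r`, `s ∈ A`, such that some `j ∈ A` with `j < s`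
sees `r`.  Adjacency on the right always refers to the graph before the round. -/
def sccRound {k : ℕ} (G : SimpleGraph (Fin k)) (i : Fin k) : SimpleGraph (Fin k) :=
  G ⊔ SimpleGraph.fromRel (fun a b => (i < a ∧ G.Adj i a) ∧ (i < b ∧ G.Adj i b))
    ⊔ SimpleGraph.fromRel (fun r s => i < r ∧ (i < s ∧ G.Adj i s) ∧
        ∃ j, (i < j ∧ G.Adj i j) ∧ j < s ∧ G.Adj j r ∧ ¬ G.Adj s r)

/-- Algorithm SCC: the strongly chordal completion, obtained by the rounds `0, …, k - 1`. -/
def scc {k : ℕ} (G : SimpleGraph (Fin k)) : SimpleGraph (Fin k) :=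
  (List.finRange k).foldl sccRound G

/-- The list `l` is a perfect elimination scheme for `H` (on the vertices of `l`): the neighbours
of every vertex that come later in `l` are pairwise adjacent. -/
def IsPerfectElimination {V : Type*} (H : SimpleGraph V) (l : List V) : Prop :=
  ∀ i j k : Fin l.length, i < j → j < k →
    H.Adj (l.get i) (l.get j) → H.Adj (l.get i) (l.get k) → H.Adj (l.get j) (l.get k)

/-- The red edges of algorithm in-3-sun: `y i` and `y p` are joined if, for some `q` with
`i < p < q`, the vertices `y i, y q, y p` form an induced path of `H` in this order. -/
def redEdges {V : Type*} (H : SimpleGraph V) {k : ℕ} (y : Fin k ↪ V) : SimpleGraph V :=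
  SimpleGraph.fromRel fun u v => ∃ i p q : Fin k, i < p ∧ p < q ∧ u = y i ∧ v = y p ∧
    H.Adj (y i) (y q) ∧ H.Adj (y q) (y p) ∧ ¬ H.Adj (y i) (y p)

/-- Algorithm in-3-sun on `H` and `x`, with the ordering `y` of the nonneighbours of `x` and the
ordering `z` of the neighbours of `x`, answers true. -/
def InThreeSun {V : Type*} (H : SimpleGraph V) (x : V) {k r : ℕ} (y : Fin k ↪ V) (z : Fin r ↪ V) :
    Prop :=
  ¬ IsPerfectElimination (H ⊔ redEdges H y) (List.ofFn y ++ List.ofFn z ++ [x])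

/-- The graph `H` of algorithm tip-of-sunflower: the strongly chordal completion is carried out on
the subgraph of `G` induced by the image of `y`, in the order given by `y`, and the edges that it
adds are added to `G`. -/
def completionAlong {V : Type*} (G : SimpleGraph V) {k : ℕ} (y : Fin k ↪ V) : SimpleGraph V :=
  G ⊔ (scc (G.comap y)).map y

/-- Algorithm tip-of-sunflower on `G` and `x` can return `b`: `y` is any ordering of the
nonneighbours `v` of `x` in which the numbers `|N(v) ∩ N(x)|` do not decrease, and `z` is any
ordering of the neighbours of `x`. -/
def TipOfSunflowerReturns {V : Type*} (G : SimpleGraph V) (x : V) (b : Bool) : Prop :=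
  ∃ (k r : ℕ) (y : Fin k ↪ V) (z : Fin r ↪ V),
    Set.range y = {v | v ≠ x ∧ ¬ G.Adj x v} ∧
    Set.range z = G.neighborSet x ∧
    (∀ i j, i < j → (G.neighborSet (y i) ∩ G.neighborSet x).ncard ≤
      (G.neighborSet (y j) ∩ G.neighborSet x).ncard) ∧
    (b = true ↔ InThreeSun (completionAlong G y) x y z)

/-- What remains when all the neighbours of `x` are deleted except the ends of `e`. -/
def keptVertices {V : Type*} (G : SimpleGraph V) (x : V) (e : Sym2 V) : Set V :=
  {v | G.Adj x v → v ∈ e}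

/-- Algorithm find-sun on `G` can return `b`.  For every vertex `x` and every edge `e` of `G` with
both ends in `N(x)`, the call of tip-of-sunflower on `x` and the graph that remains returns
`t x e`; the answer is true if and only if one of these calls returns true. -/
def FindSunReturns {V : Type*} (G : SimpleGraph V) (b : Bool) : Prop :=
  ∃ t : V → Sym2 V → Bool,
    (∀ (x : V) (e : Sym2 V), e ∈ G.edgeSet → (∀ v ∈ e, G.Adj x v) →
      TipOfSunflowerReturns (G.induce (keptVertices G x e))
        ⟨x, fun h => absurd h (G.loopless.irrefl x)⟩ (t x e)) ∧
    (b = true ↔ ∃ (x : V) (e : Sym2 V), e ∈ G.edgeSet ∧ (∀ v ∈ e, G.Adj x v) ∧ t x e = true)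

/-! ### Programs for a random access machine with a step count

Values are natural numbers below the word bound `W`; a program in which a larger value occurs gets
stuck.  Every operation on words, every access to memory and every test costs one step. -/

/-- Memory: scalar registers and arrays, each kind numbered by natural numbers.  A program mentions
only finitely many of them. -/
structure Mem where
  var : ℕ → ℕ
  arr : ℕ → ℕ → ℕ

inductive Expr where
  | const (c : ℕ)
  | var (x : ℕ)
  | get (a : ℕ) (e : Expr)
  | add (e f : Expr)
  | sub (e f : Expr)
  | mul (e f : Expr)
  | lt (e f : Expr)
  | eq (e f : Expr)

/-- A value that fits into a word; anything larger has no result. -/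
def fits (W v : ℕ) : Option ℕ := if v < W then some v else none

/-- The value of an expression; subtraction is truncated, comparisons give `1` or `0`. -/
def Expr.eval (W : ℕ) (s : Mem) : Expr → Option ℕ
  | .const c => fits W c
  | .var x => fits W (s.var x)
  | .get a e => (e.eval W s).bind fun i => fits W (s.arr a i)
  | .add e f => (e.eval W s).bind fun u => (f.eval W s).bind fun v => fits W (u + v)
  | .sub e f => (e.eval W s).bind fun u => (f.eval W s).bind fun v => fits W (u - v)
  | .mul e f => (e.eval W s).bind fun u => (f.eval W s).bind fun v => fits W (u * v)
  | .lt e f => (e.eval W s).bind fun u => (f.eval W s).bind fun v =>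
      fits W (if u < v then 1 else 0)
  | .eq e f => (e.eval W s).bind fun u => (f.eval W s).bind fun v =>
      fits W (if u = v then 1 else 0)

/-- The number of steps needed to evaluate an expression: one for each node. -/
def Expr.cost : Expr → ℕ
  | .const _ => 1
  | .var _ => 1
  | .get _ e => e.cost + 1
  | .add e f => e.cost + f.cost + 1
  | .sub e f => e.cost + f.cost + 1
  | .mul e f => e.cost + f.cost + 1
  | .lt e f => e.cost + f.cost + 1
  | .eq e f => e.cost + f.cost + 1

inductive Prog where
  | skip
  /-- register `x` := value of `e` -/
  | assign (x : ℕ) (e : Expr)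
  /-- array `a` at position `i` := value of `e` -/
  | store (a : ℕ) (i e : Expr)
  | seq (p q : Prog)
  /-- run `p` if `e` is nonzero and `q` otherwise -/
  | cond (e : Expr) (p q : Prog)
  /-- repeat `p` as long as `e` is nonzero -/
  | loop (e : Expr) (p : Prog)

/-- `Exec W p s s' t`: with word bound `W`, the program `p` started in `s` halts in `s'` after
exactly `t` steps. -/
inductive Exec (W : ℕ) : Prog → Mem → Mem → ℕ → Prop where
  | skip (s : Mem) : Exec W .skip s s 1
  | assign (s : Mem) (x : ℕ) (e : Expr) (v : ℕ) (hv : e.eval W s = some v) :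
      Exec W (.assign x e) s { s with var := Function.update s.var x v } (e.cost + 1)
  | store (s : Mem) (a : ℕ) (i e : Expr) (u v : ℕ)
      (hu : i.eval W s = some u) (hv : e.eval W s = some v) :
      Exec W (.store a i e) s
        { s with arr := Function.update s.arr a (Function.update (s.arr a) u v) }
        (i.cost + e.cost + 1)
  | seq (p q : Prog) (s s' s'' : Mem) (t t' : ℕ)
      (hp : Exec W p s s' t) (hq : Exec W q s' s'' t') :
      Exec W (.seq p q) s s'' (t + t')
  | condTrue (e : Expr) (p q : Prog) (s s' : Mem) (v t : ℕ)
      (hv : e.eval W s = some v) (h0 : v ≠ 0) (hp : Exec W p s s' t) :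
      Exec W (.cond e p q) s s' (e.cost + 1 + t)
  | condFalse (e : Expr) (p q : Prog) (s s' : Mem) (t : ℕ)
      (hv : e.eval W s = some 0) (hq : Exec W q s s' t) :
      Exec W (.cond e p q) s s' (e.cost + 1 + t)
  | loopTrue (e : Expr) (p : Prog) (s s' s'' : Mem) (v t t' : ℕ)
      (hv : e.eval W s = some v) (h0 : v ≠ 0) (hp : Exec W p s s' t)
      (hl : Exec W (.loop e p) s' s'' t') :
      Exec W (.loop e p) s s'' (e.cost + 1 + t + t')
  | loopFalse (e : Expr) (p : Prog) (s : Mem) (hv : e.eval W s = some 0) :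
      Exec W (.loop e p) s s (e.cost + 1)

open Classical in
/-- The initial memory: register `0` holds `n`, array `0` holds the adjacency matrix of `G`, row by
row, and everything else is `0`. -/
noncomputable def inputMem {n : ℕ} (G : SimpleGraph (Fin n)) : Mem where
  var := fun x => if x = 0 then n else 0
  arr := fun a p =>
    if a = 0 ∧ ∃ i j : Fin n, G.Adj i j ∧ p = i.val * n + j.val then 1 else 0

/-- The program `p` solves, in the time claimed for find-sun, the task that asks on an input graph
satisfying `dom` for a final memory satisfying `post`.  Words have `O(log n)` bits.  With `m` edges
and `n` vertices, the number of steps is at most `C · min (m n³) (m^{3/2} n²)`; for an edgeless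
graph, where this expression is `0`, it is at most `C (n + 1)²`, the cost of reading the matrix. -/
def RunsInTime (p : Prog)
    (dom : ∀ {n : ℕ}, SimpleGraph (Fin n) → Prop)
    (post : ∀ {n : ℕ}, SimpleGraph (Fin n) → Mem → Prop) : Prop :=
  ∃ (c : ℕ) (C : ℝ), ∀ (n : ℕ) (G : SimpleGraph (Fin n)), dom G →
    ∃ (s : Mem) (t : ℕ), Exec ((n + 2) ^ c) p (inputMem G) s t ∧ post G s ∧
      ∀ m : ℕ, m = G.edgeSet.ncard →
        (m ≠ 0 → (t : ℝ) ≤ C * min ((m : ℝ) * (n : ℝ) ^ 3)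
          ((m : ℝ) ^ (3 / 2 : ℝ) * (n : ℝ) ^ 2)) ∧
        (m = 0 → (t : ℝ) ≤ C * ((n : ℝ) + 1) ^ 2)

/-- The final memory holds the answer of some execution of find-sun on `G` in register `0`. -/
def HoldsFindSunAnswer {n : ℕ} (G : SimpleGraph (Fin n)) (s : Mem) : Prop :=
  ∃ b : Bool, FindSunReturns G b ∧ s.var 0 = if b then 1 else 0

/-- The final memory holds an induced sun of `G`, if there is one: register `0` holds its `k`, and
arrays `1` and `2` hold its tips `d i` and its clique vertices `c i`.  If `G` contains no sun,
register `0` holds `0`. -/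
def HoldsSun {n : ℕ} (G : SimpleGraph (Fin n)) (s : Mem) : Prop :=
  (ContainsSun G → ∃ k : ℕ, 3 ≤ k ∧ s.var 0 = k ∧ ∃ f : sun k ↪g G, ∀ i : Fin k,
    s.arr 1 i = (f (Sum.inl i)).val ∧ s.arr 2 i = (f (Sum.inr i)).val) ∧
  (¬ ContainsSun G → s.var 0 = 0)

/-!
Let `x`, `a`, `b` be a triangle. Delete `x` and all its neighbours except `a` and `b`, and call the
vertices `a`, `b` and their common neighbours *hubs*. An edge of the rest *links* its ends unless
both are hubs (`Link`). Everything rests on the question whether linking edges join `a` to `b` for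
some triangle (`HasLinkedTriangle`).

*In a building-free graph this happens if and only if there is a sun*
(`containsSun_iff_hasLinkedTriangle`). In a sun with tip `x`, the path around the sun through the
other tips is a linking path. Conversely, take a linking path that is shortest over all triangles
(`exists_sun_of_shortest`). Its chords join hubs, so two consecutive hubs that were nonadjacent, or
not at distance two on the path, would give a hole with a triangle attached to one edge, which is a
building (`not_buildingFree_of_hole`). If two hubs were nonadjacent, a later hub could take the
role of `x` for a proper part of the path, contrary to its choice. So the hubs are the vertices at
even positions and form a clique, and together with the other vertices and `x` they form a sun.

*Find-sun decides this on every graph* (`findSunReturns_iff`). Tip-of-sunflower is called with a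
vertex `x` that has just two neighbours `a`, `b`, and sorting by the number of common neighbours
with `x` puts the common neighbours of `a` and `b` last. The completion is a strong elimination
order (`isStrongElimination_scc`), in which the red edges create no violation among the `y i`
(`IsStrongElimination.adjOrLater`). Hence the list can fail to be a perfect elimination scheme only
if a vertex that sees `a` but not `b` becomes adjacent to one that sees `b` but not `a`. The
completion respects the components of the linking edges (`scc_connected`), so that such an edge
yields a linking path. Conversely, in a strong elimination order the first vertex of a shortest
path in the order allows a shortcut unless the path passes through at most one vertex, which is a
hub (`IsStrongElimination.exists_adjOrLater`), and then a red edge joins the two vertices.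

*The program* therefore runs a breadth-first search along linking edges for each ordered triangle,
in time `O(n²)`, and keeps a path that is shortest over all triangles (`findPath_runs`). Whether
one exists is the answer of find-sun (`emitAnswer_runs`), and in a building-free graph the path is
a sun (`emitSun_runs`). The number of triangles is at most `O(m n)` and, by the Cauchy–Schwarz
inequality, at most `O(m^{3/2})` (`sq_sum_triangles_le`), which gives the bound on the time
(`time_bound`). Programs are verified with a total-correctness judgement that bounds the number of
steps (`Runs`).
-/

/-! ### Walks of a given length along a relation -/

/-- `Steps E n u v`: there is a walk with `n` steps from `u` to `v` along the relation `E`. -/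
inductive Steps {V : Type*} (E : V → V → Prop) : ℕ → V → V → Prop
  | refl (v : V) : Steps E 0 v v
  | tail {n : ℕ} {u v w : V} : Steps E n u v → E v w → Steps E (n + 1) u w

namespace Steps

variable {V W : Type*} {E : V → V → Prop} {F : W → W → Prop}

theorem single {u v : V} (h : E u v) : Steps E 1 u v := (Steps.refl u).tail h

theorem trans {m n : ℕ} {u v w : V} (h : Steps E m u v) (h' : Steps E n v w) :
    Steps E (m + n) u w := by
  induction h' with
  | refl _ => exact h
  | tail _ e ih => exact (ih h).tail e

theorem symm (hE : ∀ u v, E u v → E v u) {n : ℕ} {u v : V} (h : Steps E n u v) :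
    Steps E n v u := by
  induction h with
  | refl _ => exact .refl _
  | tail _ e ih => rw [Nat.add_comm]; exact (single (hE _ _ e)).trans ih

theorem map (f : V → W) (hf : ∀ u v, E u v → F (f u) (f v)) {n : ℕ} {u v : V}
    (h : Steps E n u v) : Steps F n (f u) (f v) := by
  induction h with
  | refl _ => exact .refl _
  | tail _ e ih => exact ih.tail (hf _ _ e)

theorem exists_path {n : ℕ} {u v : V} (h : Steps E n u v) :
    ∃ p : ℕ → V, p 0 = u ∧ p n = v ∧ ∀ t < n, E (p t) (p (t + 1)) := by
  induction h with
  | refl v => exact ⟨fun _ => v, rfl, rfl, fun t ht => absurd ht (Nat.not_lt_zero t)⟩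
  | @tail n u v w _ e ih =>
    obtain ⟨p, h0, hn, hp⟩ := ih
    refine ⟨fun t => if t ≤ n then p t else w, by simp [h0], by simp, fun t ht => ?_⟩
    rcases Nat.lt_succ_iff_lt_or_eq.1 ht with h | rfl
    · simpa [h.le, Nat.succ_le_of_lt h] using hp t h
    · simpa [hn] using e

theorem of_path {p : ℕ → V} {s t : ℕ} (hst : s ≤ t)
    (h : ∀ i, s ≤ i → i < t → E (p i) (p (i + 1))) : Steps E (t - s) (p s) (p t) := by
  induction t, hst using Nat.le_induction with
  | base => rw [Nat.sub_self]; exact .refl _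
  | succ t hst ih =>
    rw [Nat.succ_sub hst]
    exact (ih fun i hi hit => h i hi (hit.trans (Nat.lt_succ_self t))).tail
      (h t hst (Nat.lt_succ_self t))

/-- A shortest walk between two sets of vertices, as a sequence: it cannot be shortened. -/
theorem exists_shortest (S T : V → Prop) (h : ∃ n u v, S u ∧ T v ∧ Steps E n u v) :
    ∃ (n : ℕ) (p : ℕ → V), S (p 0) ∧ T (p n) ∧ (∀ t < n, E (p t) (p (t + 1))) ∧
      ∀ m u v, S u → T v → Steps E m u v → n ≤ m := by
  classical
  obtain ⟨u, v, hu, hv, hs⟩ := Nat.find_spec h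
  obtain ⟨p, h0, hn, hp⟩ := hs.exists_path
  exact ⟨Nat.find h, p, h0 ▸ hu, hn ▸ hv, hp,
    fun m u v hu hv hs => Nat.find_min' h ⟨u, v, hu, hv, hs⟩⟩

end Steps

/-! ### Recognizing buildings and suns -/

/-- Adjacency in a building, read off from the cycle and the chord. -/
theorem building_adj_of_lt {k : ℕ} {u v : Fin (k + 5)} (h : u < v) :
    (building k).Adj u v ↔
      v.val = u.val + 1 ∨ (u.val = 0 ∧ v.val = k + 4) ∨ (u.val = 0 ∧ v.val = 2) := by
  have h' : u.val < v.val := h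
  have hv := v.isLt
  have e1 : (u - v).val = k + 5 - v.val + u.val := by
    rw [Fin.sub_def]; simp only; rw [Nat.mod_eq_of_lt]; omega
  have e2 : (v - u).val = v.val - u.val := Fin.sub_val_of_le h.le
  have e3 : ((2 : Fin (k + 5)) : ℕ) = 2 := rfl
  rw [building, SimpleGraph.sup_adj, SimpleGraph.cycleGraph_adj', SimpleGraph.edge_adj, e1, e2]
  simp only [Fin.ext_iff, e3, Fin.val_zero, ne_eq]
  omega

/-- A hole `r 0, …, r m` and a vertex `w` whose neighbours on the hole are the two ends of the edge
between `r m` and `r 0` form a building. -/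
theorem not_buildingFree_of_hole {V : Type*} {G : SimpleGraph V} {m : ℕ} (hm : 3 ≤ m)
    (r : ℕ → V) (w : V) (hr : ∀ s t, s < t → t ≤ m → r s ≠ r t)
    (hadj : ∀ s t, s < t → t ≤ m → (G.Adj (r s) (r t) ↔ t = s + 1 ∨ s = 0 ∧ t = m))
    (hw : ∀ t ≤ m, w ≠ r t) (hwadj : ∀ t ≤ m, (G.Adj w (r t) ↔ t = 0 ∨ t = m)) :
    ¬ BuildingFree G := by
  obtain ⟨k, rfl⟩ : ∃ k, m = k + 3 := ⟨m - 3, by omega⟩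
  intro hG
  let f : Fin (k + 5) → V := fun v =>
    if v.val = 0 then r (k + 3) else if v.val = 1 then w else r (v.val - 2)
  have key : ∀ u v : Fin (k + 5), u < v → f u ≠ f v ∧ (G.Adj (f u) (f v) ↔
      (building k).Adj u v) := by
    intro u v h
    have h' : u.val < v.val := h
    have hv := v.isLt
    rw [building_adj_of_lt h]
    simp only [f]
    by_cases hu0 : u.val = 0
    · by_cases hv1 : v.val = 1
      · have := hwadj (k + 3) le_rfl
        simp [hu0, hv1, G.adj_comm, this, (hw (k + 3) le_rfl).symm]
      · have := hadj (v.val - 2) (k + 3) (by omega) le_rfl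
        have h2 := hr (v.val - 2) (k + 3) (by omega) le_rfl
        rw [if_pos hu0, if_neg (by omega), if_neg hv1, G.adj_comm, this]
        exact ⟨h2.symm, by omega⟩
    · by_cases hu1 : u.val = 1
      · have := hwadj (v.val - 2) (by omega)
        rw [if_neg hu0, if_pos hu1, if_neg (by omega), if_neg (by omega), this]
        exact ⟨hw _ (by omega), by omega⟩
      · have := hadj (u.val - 2) (v.val - 2) (by omega) (by omega)
        rw [if_neg hu0, if_neg hu1, if_neg (by omega), if_neg (by omega), this]
        exact ⟨hr _ _ (by omega) (by omega), by omega⟩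
  refine hG k ⟨⟨⟨f, fun u v huv => ?_⟩, fun {u v} => ?_⟩⟩
  · rcases lt_trichotomy u v with h | h | h
    · exact absurd huv (key u v h).1
    · exact h
    · exact absurd huv.symm (key v u h).1
  · change G.Adj (f u) (f v) ↔ _
    rcases lt_trichotomy u v with h | h | h
    · exact (key u v h).2
    · simp [h]
    · rw [G.adj_comm, (building k).adj_comm]; exact (key v u h).2

theorem sun_adj_inl_inr {k : ℕ} {i j : Fin k} : (sun k).Adj (Sum.inl i) (Sum.inr j) ↔
    j = i ∨ j.val = (i.val + 1) % k := by
  simp [sun]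

theorem sun_adj_inr_inr {k : ℕ} {i j : Fin k} : (sun k).Adj (Sum.inr i) (Sum.inr j) ↔ i ≠ j := by
  simp [sun]

theorem sun_adj_inl_inl {k : ℕ} {i j : Fin k} : ¬ (sun k).Adj (Sum.inl i) (Sum.inl j) := by
  simp [sun]

/-- An induced sun, from sequences of tips and of clique vertices. -/
theorem exists_sun_embedding {V : Type*} {G : SimpleGraph V} {k : ℕ} (d c : ℕ → V)
    (hdd : ∀ i j, i < j → j < k → d i ≠ d j ∧ ¬ G.Adj (d i) (d j))
    (hcc : ∀ i j, i < j → j < k → G.Adj (c i) (c j))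
    (hdc : ∀ i j, i < k → j < k → d i ≠ c j ∧ (G.Adj (d i) (c j) ↔ j = i ∨ j = (i + 1) % k)) :
    ∃ f : sun k ↪g G, ∀ i : Fin k, f (Sum.inl i) = d i ∧ f (Sum.inr i) = c i := by
  let f : Fin k ⊕ Fin k → V := Sum.elim (fun i => d i) (fun i => c i)
  have hcc' : ∀ i j : Fin k, i ≠ j → G.Adj (c i) (c j) := fun i j h => by
    rcases lt_or_gt_of_ne h with h | h
    · exact hcc i j h j.isLt
    · exact (hcc j i h i.isLt).symm
  have hdd' : ∀ i j : Fin k, i ≠ j → d i ≠ d j ∧ ¬ G.Adj (d i) (d j) := fun i j h => by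
    rcases lt_or_gt_of_ne h with h | h
    · exact hdd i j h j.isLt
    · exact ⟨(hdd j i h i.isLt).1.symm, fun h' => (hdd j i h i.isLt).2 h'.symm⟩
  have hdc' : ∀ i j : Fin k, d i ≠ c j ∧ (G.Adj (d i) (c j) ↔
      (sun k).Adj (Sum.inl i) (Sum.inr j)) := fun i j => by
    rw [sun_adj_inl_inr, Fin.ext_iff]
    exact hdc i j i.isLt j.isLt
  refine ⟨⟨⟨f, ?_⟩, ?_⟩, fun i => ⟨rfl, rfl⟩⟩
  · rintro (i | i) (j | j) h
    · by_contra hne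
      exact (hdd' i j fun h => hne (h ▸ rfl)).1 h
    · exact absurd h (hdc' i j).1
    · exact absurd h.symm (hdc' j i).1
    · by_contra hne
      exact (hcc' i j fun h => hne (h ▸ rfl)).ne h
  · rintro (i | i) (j | j)
    · change G.Adj (d i) (d j) ↔ _
      have : ¬ G.Adj (d i) (d j) := fun h' =>
        (hdd' i j fun h => h'.ne (by rw [h])).2 h'
      simp [this, sun_adj_inl_inl]
    · exact (hdc' i j).2
    · change G.Adj (c i) (d j) ↔ _
      rw [G.adj_comm, (sun k).adj_comm]
      exact (hdc' j i).2
    · change G.Adj (c i) (c j) ↔ _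
      rw [sun_adj_inr_inr]
      exact ⟨fun h h' => h.ne (by rw [h']), hcc' i j⟩

/-! ### Linking paths -/

/-- `v` is `a`, `b` or a common neighbour of `a` and `b` (used for adjacent `a` and `b`). -/
def IsHub {V : Type*} (G : SimpleGraph V) (a b v : V) : Prop :=
  (v = a ∨ G.Adj a v) ∧ (v = b ∨ G.Adj b v)

/-- `v` survives when `x` and all its neighbours except `a` and `b` are deleted. -/
def IsAllowed {V : Type*} (G : SimpleGraph V) (x a b v : V) : Prop :=
  v ≠ x ∧ (G.Adj x v → v = a ∨ v = b)

/-- The edges along which the search from `a` for `b` proceeds: edges of `G` that avoid `x` and its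
neighbours other than `a` and `b`, and that do not join two hubs. -/
def Link {V : Type*} (G : SimpleGraph V) (x a b u v : V) : Prop :=
  G.Adj u v ∧ IsAllowed G x a b u ∧ IsAllowed G x a b v ∧ ¬ (IsHub G a b u ∧ IsHub G a b v)

theorem Link.symm {V : Type*} {G : SimpleGraph V} {x a b u v : V} (h : Link G x a b u v) :
    Link G x a b v u :=
  ⟨h.1.symm, h.2.2.1, h.2.1, fun h' => h.2.2.2 ⟨h'.2, h'.1⟩⟩

/-- The vertices `x, a, b` are pairwise adjacent, and `a` and `b` are joined by linking edges. -/
def HasLinkedTriangle {V : Type*} (G : SimpleGraph V) : Prop :=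
  ∃ x a b, G.Adj x a ∧ G.Adj x b ∧ G.Adj a b ∧ ∃ L, Steps (Link G x a b) L a b

section Core

variable {V : Type*} {G : SimpleGraph V} {x a b : V} {L : ℕ} {p : ℕ → V}

theorem isHub_left (hab : G.Adj a b) : IsHub G a b a := ⟨.inl rfl, .inr hab.symm⟩

theorem isHub_right (hab : G.Adj a b) : IsHub G a b b := ⟨.inr hab, .inl rfl⟩

/-- In a building-free graph, a linking path that is shortest over all triangles `x, a, b` spans a
sun with tip `x`: its hubs are the vertices at even positions and they are pairwise adjacent. -/
theorem exists_sun_of_shortest (hG : BuildingFree G)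
    (hxa : G.Adj x a) (hxb : G.Adj x b) (hab : G.Adj a b) (h0 : p 0 = a) (hL : p L = b)
    (hp : ∀ t < L, Link G x a b (p t) (p (t + 1)))
    (hmin : ∀ x' a' b' L', G.Adj x' a' → G.Adj x' b' → G.Adj a' b' →
      Steps (Link G x' a' b') L' a' b' → L ≤ L') :
    ∃ s, 2 ≤ s ∧ L = 2 * s ∧ ∃ f : sun (s + 1) ↪g G, ∀ i : Fin (s + 1),
      f (Sum.inr i) = p (2 * i) ∧ f (Sum.inl i) = if i.val < s then p (2 * i + 1) else x := by
  classical
  have hLpos : 0 < L := by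
    rcases Nat.eq_zero_or_pos L with rfl | h
    · exact absurd (h0.symm.trans hL) hab.ne
    · exact h
  have hall : ∀ t ≤ L, IsAllowed G x a b (p t) := fun t ht => by
    rcases ht.lt_or_eq with h | rfl
    · exact (hp t h).2.1
    · obtain ⟨t, rfl⟩ : ∃ t', t = t' + 1 := ⟨t - 1, by omega⟩
      exact (hp t (Nat.lt_succ_self t)).2.2.1
  have hinj : ∀ s t, s < t → t ≤ L → p s ≠ p t := fun s t hst ht h => by
    have h1 := Steps.of_path (E := Link G x a b) (p := p) (Nat.zero_le s)
      fun i _ hi => hp i (by omega)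
    have h2 := Steps.of_path (E := Link G x a b) (p := p) ht fun i _ hi => hp i hi
    rw [← h] at h2
    have := hmin x a b _ hxa hxb hab (h0 ▸ hL ▸ h1.trans h2)
    omega
  have hadj : ∀ t < L, G.Adj (p t) (p (t + 1)) := fun t ht => (hp t ht).1
  have hnot : ∀ t < L, IsHub G a b (p t) → ¬ IsHub G a b (p (t + 1)) := fun t ht h h' =>
    (hp t ht).2.2.2 ⟨h, h'⟩
  have hub0 : IsHub G a b (p 0) := by rw [h0]; exact isHub_left hab
  have hubL : IsHub G a b (p L) := by rw [hL]; exact isHub_right hab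
  -- a chord between two vertices that are not both hubs would be a shortcut
  have hch : ∀ s t, s + 2 ≤ t → t ≤ L → G.Adj (p s) (p t) →
      IsHub G a b (p s) ∧ IsHub G a b (p t) := fun s t hst ht h => by
    by_contra hc
    have h1 := Steps.of_path (E := Link G x a b) (p := p) (Nat.zero_le s)
      fun i _ hi => hp i (by omega)
    have h2 := Steps.of_path (E := Link G x a b) (p := p) ht fun i _ hi => hp i hi
    have h3 : Link G x a b (p s) (p t) := ⟨h, hall s (by omega), hall t ht, hc⟩
    have := hmin x a b _ hxa hxb hab (h0 ▸ hL ▸ (h1.tail h3).trans h2)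
    omega
  have hx : ∀ t ≤ L, (G.Adj x (p t) ↔ t = 0 ∨ t = L) := fun t ht => by
    constructor
    · intro h
      rcases (hall t ht).2 h with h | h
      · left
        by_contra hne
        exact hinj 0 t (by omega) ht (h0.trans h.symm)
      · right
        by_contra hne
        exact hinj t L (by omega) le_rfl (h.trans hL.symm)
    · rintro (rfl | rfl)
      · exact h0 ▸ hxa
      · exact hL ▸ hxb
  have ha : ∀ t ≤ L, 0 < t → IsHub G a b (p t) → G.Adj (p 0) (p t) := fun t ht ht0 h => by
    rcases h.1 with h | h
    · exact absurd (h0.trans h.symm) (hinj 0 t ht0 ht)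
    · exact h0 ▸ h
  have hb : ∀ t < L, IsHub G a b (p t) → G.Adj (p L) (p t) := fun t ht h => by
    rcases h.2 with h | h
    · exact absurd (h.trans hL.symm) (hinj t L ht le_rfl)
    · exact hL ▸ h
  -- a segment without inner hubs is an induced path, up to an edge between its ends
  have hseg : ∀ i j, j ≤ L → (∀ t, i < t → t < j → ¬ IsHub G a b (p t)) →
      ∀ s t, i ≤ s → s < t → t ≤ j → (s ≠ i ∨ t ≠ j) →
        (G.Adj (p s) (p t) ↔ t = s + 1) := fun i j hj hb s t hs hst ht hne => by
    constructor
    · intro h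
      by_contra hc
      obtain ⟨h1, h2⟩ := hch s t (by omega) (by omega) h
      rcases hne with hne | hne
      · exact hb s (by omega) (by omega) h1
      · exact hb t (by omega) (by omega) h2
    · rintro rfl
      exact hadj s (by omega)
  -- a segment between two adjacent hubs closes to a hole, and a further common neighbour `w` of
  -- the two hubs makes it a building
  have hole1 : ∀ i j w, i + 3 ≤ j → j ≤ L → (∀ t, i < t → t < j → ¬ IsHub G a b (p t)) →
      G.Adj (p i) (p j) → G.Adj w (p i) → G.Adj w (p j) →
      (∀ t, i < t → t < j → w ≠ p t ∧ ¬ G.Adj w (p t)) → False := by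
    intro i j w hij hj hb hA hwi hwj hw
    refine not_buildingFree_of_hole (m := j - i) (by omega) (fun t => p (i + t)) w
      (fun s t hst ht => hinj _ _ (by omega) (by omega)) (fun s t hst ht => ?_)
      (fun t ht => ?_) (fun t ht => ?_) hG
    · by_cases hc : s = 0 ∧ t = j - i
      · obtain ⟨rfl, rfl⟩ := hc
        have : i + (j - i) = j := by omega
        simp [this, hA]
      · rw [hseg i j hj hb (i + s) (i + t) (by omega) (by omega) (by omega) (by omega)]
        omega
    · rcases Nat.eq_zero_or_pos t with rfl | h
      · exact hwi.ne
      · by_cases h' : i + t = j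
        · simp only [h']; exact hwj.ne
        · exact (hw _ (by omega) (by omega)).1
    · rcases Nat.eq_zero_or_pos t with rfl | h
      · simpa using hwi
      · by_cases h' : i + t = j
        · simp only [h', hwj, true_iff]; omega
        · simp only [(hw _ (by omega : i < i + t) (by omega)).2, false_iff]; omega
  -- a segment from a hub `p i` to a nonadjacent one and a common neighbour `z` of the two form a
  -- hole, and a common neighbour `w` of `z` and `p i` makes it a building
  have hole2 : ∀ i j z w, i + 2 ≤ j → j ≤ L → (∀ t, i < t → t < j → ¬ IsHub G a b (p t)) →
      ¬ G.Adj (p i) (p j) → G.Adj z (p i) → G.Adj z (p j) →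
      (∀ t, i < t → t < j → z ≠ p t ∧ ¬ G.Adj z (p t)) →
      G.Adj w (p i) → G.Adj w z →
      (∀ t, i < t → t ≤ j → w ≠ p t ∧ ¬ G.Adj w (p t)) → False := by
    intro i j z w hij hj hb hA hzi hzj hz hwi hwz hw
    have hz' : ∀ t, i ≤ t → t ≤ j → z ≠ p t ∧ (G.Adj (p t) z ↔ t = i ∨ t = j) := by
      intro t h1 h2
      by_cases h3 : t = i
      · rw [h3]; exact ⟨hzi.ne, by simp [hzi.symm]⟩
      · by_cases h4 : t = j
        · rw [h4]; exact ⟨hzj.ne, by simp [hzj.symm]⟩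
        · have := hz t (by omega) (by omega)
          exact ⟨this.1, by rw [G.adj_comm]; simp [this.2, h3, h4]⟩
    refine not_buildingFree_of_hole (m := j - i + 1) (by omega)
      (fun t => if t ≤ j - i then p (i + t) else z) w
      (fun s t hst ht => ?_) (fun s t hst ht => ?_) (fun t ht => ?_) (fun t ht => ?_) hG
    · have hs : s ≤ j - i := by omega
      by_cases h : t ≤ j - i
      · simp only [h, hs, if_true]; exact hinj _ _ (by omega) (by omega)
      · simp only [h, hs, if_true, if_false]; exact (hz' _ (by omega) (by omega)).1.symm
    · have hs : s ≤ j - i := by omega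
      by_cases h : t ≤ j - i
      · simp only [h, hs, if_true]
        by_cases hc : s = 0 ∧ t = j - i
        · obtain ⟨rfl, rfl⟩ := hc
          have : i + (j - i) = j := by omega
          simp only [this, Nat.add_zero, hA, false_iff]; omega
        · rw [hseg i j hj hb (i + s) (i + t) (by omega) (by omega) (by omega) (by omega)]
          omega
      · simp only [h, hs, if_true, if_false]
        rw [(hz' _ (by omega : i ≤ i + s) (by omega)).2]; omega
    · by_cases h : t ≤ j - i
      · simp only [h, if_true]
        rcases Nat.eq_zero_or_pos t with rfl | h0
        · exact hwi.ne
        · exact (hw _ (by omega) (by omega)).1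
      · simp only [h, if_false]; exact hwz.ne
    · by_cases h : t ≤ j - i
      · simp only [h, if_true]
        rcases Nat.eq_zero_or_pos t with rfl | h0
        · simpa using hwi
        · simp only [(hw _ (by omega : i < i + t) (by omega)).2, false_iff]; omega
      · simp only [h, if_false, hwz, true_iff]; omega
  -- by induction along the hubs: up to each hub, the hubs are the vertices at even positions, and
  -- they are adjacent to it
  have main : ∀ j, j ≤ L → 0 < j → IsHub G a b (p j) →
      (∀ i ≤ j, (IsHub G a b (p i) ↔ Even i)) ∧ ∀ i < j, Even i → G.Adj (p i) (p j) := by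
    intro j
    induction j using Nat.strong_induction_on with
    | _ j ih =>
    intro hjL hj0 hj
    -- `p i` is the hub before `p j`
    obtain ⟨i, hij, hi, hbet⟩ : ∃ i < j, IsHub G a b (p i) ∧
        ∀ t, i < t → t < j → ¬ IsHub G a b (p t) := by
      refine ⟨Nat.findGreatest (fun t => IsHub G a b (p t)) (j - 1), ?_, ?_, fun t h1 h2 => ?_⟩
      · exact lt_of_le_of_lt (Nat.findGreatest_le _) (by omega)
      · exact Nat.findGreatest_spec (P := fun t => IsHub G a b (p t)) (Nat.zero_le _) hub0
      · exact Nat.findGreatest_is_greatest h1 (by omega)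
    have hij2 : i + 2 ≤ j := by
      by_contra h
      obtain rfl : j = i + 1 := by omega
      exact hnot i (by omega) hi hj
    have hpar : ∀ t ≤ i, (IsHub G a b (p t) ↔ Even t) := by
      rcases Nat.eq_zero_or_pos i with rfl | h
      · intro t ht
        obtain rfl : t = 0 := by omega
        simp [hub0]
      · exact (ih i hij (by omega) h hi).1
    have hie : Even i := (hpar i le_rfl).1 hi
    have hcl : ∀ s t, s < t → t ≤ i → Even s → Even t → G.Adj (p s) (p t) :=
      fun s t hst ht hs he =>
        (ih t (by omega) (by omega) (by omega) ((hpar t ht).2 he)).2 s hst hs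
    have hodd : ∀ t ≤ i, ¬ Even t → ¬ IsHub G a b (p t) := fun t ht h h' => h ((hpar t ht).1 h')
    have nonadj0 : ∀ t, i < t → t < j → 0 < i → p 0 ≠ p t ∧ ¬ G.Adj (p 0) (p t) :=
      fun t h1 h2 h3 => ⟨hinj 0 t (by omega) (by omega),
        fun h => hbet t h1 h2 (hch 0 t (by omega) (by omega) h).2⟩
    -- consecutive hubs are adjacent: otherwise the segment between them, closed by the hub two
    -- steps before `p i` or by `a`, gives a building
    have hAij : G.Adj (p i) (p j) := by
      by_contra hA
      have hi0 : 0 < i := by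
        rcases Nat.eq_zero_or_pos i with rfl | h
        · exact absurd (ha j hjL hj0 hj) hA
        · exact h
      have hi2 : 2 ≤ i := by
        rcases hie with ⟨r, hr⟩; omega
      have he2 : Even (i - 2) := by
        rcases hie with ⟨r, hr⟩; exact ⟨r - 1, by omega⟩
      have hA2 : G.Adj (p (i - 2)) (p i) := hcl _ _ (by omega) le_rfl he2 hie
      have hfar : ∀ t, i < t → t < j → p (i - 2) ≠ p t ∧ ¬ G.Adj (p (i - 2)) (p t) :=
        fun t h1 h2 => ⟨hinj _ t (by omega) (by omega),
          fun h => hbet t h1 h2 (hch _ t (by omega) (by omega) h).2⟩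
      by_cases hAj : G.Adj (p (i - 2)) (p j)
      · have hno : ¬ IsHub G a b (p (i - 1)) := hodd _ (by omega) fun h => by
          rcases hie with ⟨r, hr⟩; rcases h with ⟨r', hr'⟩; omega
        have e1 := hadj (i - 1) (by omega)
        have e2 := hadj (i - 2) (by omega)
        rw [show i - 1 + 1 = i by omega] at e1
        rw [show i - 2 + 1 = i - 1 by omega] at e2
        exact hole2 i j (p (i - 2)) (p (i - 1)) hij2 hjL hbet hA hA2 hAj hfar e1 e2.symm
          fun t h1 h2 => ⟨hinj _ t (by omega) (by omega),
            fun h => hno (hch _ t (by omega) (by omega) h).1⟩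
      · have hi2' : 0 < i - 2 := by
          by_contra h
          rw [show i - 2 = 0 by omega] at hAj
          exact hAj (ha j hjL hj0 hj)
        refine hole2 i j (p 0) (p (i - 2)) hij2 hjL hbet hA (ha i (by omega) hi0 hi)
          (ha j hjL hj0 hj) (fun t h1 h2 => nonadj0 t h1 h2 hi0) hA2
          (ha _ (by omega) hi2' ((hpar _ (by omega)).2 he2)).symm fun t h1 h2 => ?_
        rcases h2.lt_or_eq with h2 | rfl
        · exact hfar t h1 h2
        · exact ⟨hinj _ _ (by omega) hjL, hAj⟩
    -- and they are at distance two on the path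
    have hj2 : j = i + 2 := by
      by_contra hne
      rcases Nat.eq_zero_or_pos i with rfl | hi0
      · by_cases hjl : j = L
        · refine hole1 0 j x (by omega) hjL hbet hAij ((hx 0 (by omega)).2 (.inl rfl))
            ((hx j hjL).2 (.inr hjl)) fun t h1 h2 => ⟨(hall t (by omega)).1.symm, fun h => ?_⟩
          have := (hx t (by omega)).1 h
          omega
        · refine hole1 0 j (p L) (by omega) hjL hbet hAij (hb 0 hLpos hub0)
            (hb j (by omega) hj) fun t h1 h2 => ⟨(hinj t L (by omega) le_rfl).symm, fun h => ?_⟩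
          exact hbet t h1 h2 (hch t L (by omega) le_rfl h.symm).1
      · exact hole1 i j (p 0) (by omega) hjL hbet hAij (ha i (by omega) hi0 hi)
          (ha j hjL hj0 hj) fun t h1 h2 => nonadj0 t h1 h2 hi0
    subst hj2
    have hparity : ∀ t ≤ i + 2, (IsHub G a b (p t) ↔ Even t) := by
      intro t ht
      rcases Nat.lt_or_ge i t with h | h
      · rcases Nat.lt_or_ge t (i + 2) with h' | h'
        · obtain rfl : t = i + 1 := by omega
          simp only [hbet _ h h', false_iff, Nat.even_add_one, not_not]
          exact hie
        · obtain rfl : t = i + 2 := by omega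
          simp only [hj, true_iff]
          exact hie.add (by decide)
      · exact hpar t h
    refine ⟨hparity, ?_⟩
    by_contra hcon
    push Not at hcon
    obtain ⟨e, he, hee, hne⟩ := hcon
    -- the last hub `t` that is not adjacent to the new one, and the last hub `t'` before `t` that
    -- is adjacent to it: the new hub takes the role of `x` for a shorter path, from `t'` to `t + 2`
    obtain ⟨t, ht, hte, htn, htmax⟩ : ∃ t < i + 2, Even t ∧ ¬ G.Adj (p t) (p (i + 2)) ∧
        ∀ u, t < u → u < i + 2 → Even u → G.Adj (p u) (p (i + 2)) := by
      let P : ℕ → Prop := fun t => Even t ∧ ¬ G.Adj (p t) (p (i + 2))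
      have hP := Nat.findGreatest_spec (P := P) (n := i + 1) (by omega : e ≤ i + 1) ⟨hee, hne⟩
      refine ⟨Nat.findGreatest P (i + 1), lt_of_le_of_lt (Nat.findGreatest_le _) (by omega),
        hP.1, hP.2, fun u h1 h2 h3 => ?_⟩
      by_contra h
      exact Nat.findGreatest_is_greatest h1 (by omega) ⟨h3, h⟩
    have ht0 : 0 < t := by
      rcases Nat.eq_zero_or_pos t with rfl | h
      · exact absurd (ha _ hjL hj0 hj) htn
      · exact h
    obtain ⟨t', ht', hte', htn', htmax'⟩ : ∃ t' < t, Even t' ∧ G.Adj (p t') (p (i + 2)) ∧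
        ∀ u, t' < u → u < t → Even u → ¬ G.Adj (p u) (p (i + 2)) := by
      let P : ℕ → Prop := fun t => Even t ∧ G.Adj (p t) (p (i + 2))
      have hP := Nat.findGreatest_spec (P := P) (n := t - 1) (Nat.zero_le _)
        ⟨by decide, ha _ hjL hj0 hj⟩
      exact ⟨Nat.findGreatest P (t - 1), lt_of_le_of_lt (Nat.findGreatest_le _) (by omega),
        hP.1, hP.2, fun u h1 h2 h3 h4 => Nat.findGreatest_is_greatest h1 (by omega) ⟨h3, h4⟩⟩
    have hti : t + 2 ≤ i := by
      have : t ≠ i := fun h => htn (h ▸ hAij)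
      rcases hte with ⟨r, hr⟩; rcases hie with ⟨r', hr'⟩; omega
    have htt' : t' + 2 ≤ t := by
      rcases hte with ⟨r, hr⟩; rcases hte' with ⟨r', hr'⟩; omega
    have hte2 : Even (t + 2) := hte.add (by decide)
    have hoddcase : ∀ u, t' < u → u < t + 2 → ¬ Even u →
        ¬ IsHub G (p t') (p (t + 2)) (p u) := by
      intro u h1 h2 h3 h4
      have hu := hodd u (by omega) h3
      rcases h4.1 with h | h
      · exact hinj _ _ h1 (by omega) h.symm
      · rcases h4.2 with h' | h'
        · exact hinj _ _ h2 (by omega) h'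
        · rcases Nat.lt_or_ge u (t' + 2) with h5 | h5
          · exact hu (hch u (t + 2) (by omega) (by omega) h'.symm).1
          · exact hu (hch t' u h5 (by omega) h).2
    have hallow : ∀ u, t' ≤ u → u ≤ t + 2 → IsAllowed G (p (i + 2)) (p t') (p (t + 2)) (p u) := by
      intro u h1 h2
      refine ⟨hinj _ _ (by omega) hjL, fun h => ?_⟩
      rcases h1.eq_or_lt with rfl | h1
      · exact .inl rfl
      rcases h2.eq_or_lt with rfl | h2
      · exact .inr rfl
      exfalso
      by_cases hu : Even u
      · rcases Nat.lt_trichotomy u t with h3 | rfl | h3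
        · exact htmax' u h1 h3 hu h.symm
        · exact htn h.symm
        · rcases hu with ⟨r, hr⟩; rcases hte with ⟨r', hr'⟩; omega
      · exact hodd u (by omega) hu (hch u (i + 2) (by omega) hjL h.symm).1
    have hsteps := Steps.of_path (E := Link G (p (i + 2)) (p t') (p (t + 2))) (p := p)
      (by omega : t' ≤ t + 2) fun u h1 h2 => by
        refine ⟨hadj u (by omega), hallow u h1 (by omega), hallow (u + 1) (by omega) (by omega),
          fun h => ?_⟩
        by_cases hu : Even u
        · have : u + 1 ≠ t + 2 := fun h => by
            rw [← h, Nat.even_add_one] at hte2; exact hte2 hu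
          exact hoddcase (u + 1) (by omega) (by omega) (by simp [Nat.even_add_one, hu]) h.2
        · have : u ≠ t' := fun h => hu (h ▸ hte')
          exact hoddcase u (by omega) h2 hu h.1
    have := hmin _ _ _ _ htn'.symm (htmax (t + 2) (by omega) (by omega) hte2).symm
      (hcl t' (t + 2) (by omega) hti hte' hte2) hsteps
    omega
  have hmL := main L le_rfl hLpos hubL
  have hpar := hmL.1
  obtain ⟨s, hs⟩ := (hpar L le_rfl).1 hubL
  have hnh : ∀ i, 2 * i + 1 ≤ L → ¬ IsHub G a b (p (2 * i + 1)) := fun i hi h => by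
    have := (hpar _ hi).1 h
    simp at this
  have hcl : ∀ i j, i < j → j ≤ s → G.Adj (p (2 * i)) (p (2 * j)) := fun i j hij hj =>
    (main (2 * j) (by omega) (by omega) ((hpar _ (by omega)).2 (even_two_mul j))).2 _ (by omega)
      (even_two_mul i)
  have hs2 : 2 ≤ s := by
    by_contra h
    obtain rfl : s = 1 := by omega
    obtain rfl : L = 2 := by omega
    have h1 := hadj 0 (by omega)
    have h2 := hadj 1 (by omega)
    simp only [Nat.reduceAdd, h0, hL] at h1 h2
    exact hnh 0 (by omega) ⟨.inr h1, .inr h2.symm⟩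
  have hodd_nonadj : ∀ i t, 2 * i + 1 < L → t ≤ L → t ≠ 2 * i → t ≠ 2 * i + 2 →
      ¬ G.Adj (p (2 * i + 1)) (p t) := fun i t hi ht h1 h2 h => by
    rcases Nat.lt_trichotomy t (2 * i + 1) with h3 | rfl | h3
    · exact hnh i (by omega) (hch _ _ (by omega) (by omega) h.symm).2
    · exact G.loopless.irrefl _ h
    · exact hnh i (by omega) (hch _ _ (by omega) (by omega) h).1
  obtain ⟨f, hf⟩ := exists_sun_embedding (G := G) (k := s + 1)
    (fun i => if i < s then p (2 * i + 1) else x) (fun i => p (2 * i))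
    (fun i j hij hj => by
      have hi : i < s := by omega
      by_cases hjs : j < s
      · simp only [hi, hjs, if_true]
        exact ⟨hinj _ _ (by omega) (by omega),
          hodd_nonadj i _ (by omega) (by omega) (by omega) (by omega)⟩
      · simp only [hi, hjs, if_true, if_false]
        refine ⟨(hall _ (by omega)).1, fun h => ?_⟩
        have := (hx _ (by omega)).1 h.symm
        omega)
    (fun i j hij hj => hcl i j hij (by omega))
    (fun i j hi hj => by
      by_cases his : i < s
      · simp only [his, if_true]
        have hmod : (i + 1) % (s + 1) = i + 1 := Nat.mod_eq_of_lt (by omega)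
        rw [hmod]
        refine ⟨?_, ?_⟩
        · rcases Nat.lt_or_ge (2 * i + 1) (2 * j) with h | h
          · exact hinj _ _ h (by omega)
          · exact (hinj _ _ (by omega) (by omega)).symm
        · by_cases h1 : j = i
          · subst h1
            simpa using (hadj (2 * j) (by omega)).symm
          · by_cases h2 : j = i + 1
            · subst h2
              simpa [Nat.mul_add] using hadj (2 * i + 1) (by omega)
            · simpa [h1, h2] using hodd_nonadj i (2 * j) (by omega) (by omega) (by omega) (by omega)
      · obtain rfl : i = s := by omega
        simp only [his, if_false, Nat.mod_self]
        rw [hx _ (by omega)]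
        exact ⟨(hall _ (by omega)).1.symm, by omega⟩)
  exact ⟨s, hs2, by omega, f, fun i => ⟨(hf i).2, (hf i).1⟩⟩

end Core

/-- A building-free graph contains a sun if and only if some triangle has a linking path. -/
theorem containsSun_iff_hasLinkedTriangle {V : Type*} {G : SimpleGraph V} (hG : BuildingFree G) :
    ContainsSun G ↔ HasLinkedTriangle G := by
  classical
  constructor
  · -- `x` is the last tip, and the path around the sun through the other tips is linking
    rintro ⟨k, hk, ⟨f⟩⟩
    obtain ⟨s, rfl⟩ : ∃ s, k = s + 1 := ⟨k - 1, by omega⟩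
    have hdc : ∀ i j (hi : i < s + 1) (hj : j < s + 1),
        G.Adj (f (Sum.inl ⟨i, hi⟩)) (f (Sum.inr ⟨j, hj⟩)) ↔ j = i ∨ j = (i + 1) % (s + 1) := by
      intro i j hi hj
      rw [f.map_adj_iff, sun_adj_inl_inr, Fin.ext_iff]
    have hcc : ∀ i j (hi : i < s + 1) (hj : j < s + 1), i ≠ j →
        G.Adj (f (Sum.inr ⟨i, hi⟩)) (f (Sum.inr ⟨j, hj⟩)) := by
      intro i j hi hj h
      rw [f.map_adj_iff, sun_adj_inr_inr, Ne, Fin.ext_iff]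
      exact h
    set x := f (Sum.inl ⟨s, by omega⟩) with hxd
    set a := f (Sum.inr ⟨0, by omega⟩) with had
    set b := f (Sum.inr ⟨s, by omega⟩) with hbd
    have hxc : ∀ j (hj : j < s + 1), G.Adj x (f (Sum.inr ⟨j, hj⟩)) ↔ j = s ∨ j = 0 := by
      intro j hj
      rw [hxd, hdc, Nat.mod_self]
    have hxa : G.Adj x a := (hxc 0 (by omega)).2 (.inr rfl)
    have hxb : G.Adj x b := (hxc s (by omega)).2 (.inl rfl)
    have hallc : ∀ j (hj : j < s + 1), IsAllowed G x a b (f (Sum.inr ⟨j, hj⟩)) := by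
      intro j hj
      refine ⟨fun h => by simpa using f.injective h, fun h => ?_⟩
      rcases (hxc j hj).1 h with rfl | rfl
      · exact .inr rfl
      · exact .inl rfl
    have halld : ∀ j (hj : j < s + 1), j < s → IsAllowed G x a b (f (Sum.inl ⟨j, hj⟩)) := by
      intro j hj hjs
      refine ⟨fun h => ?_, fun h => ?_⟩
      · have := f.injective h
        simp only [Sum.inl.injEq, Fin.mk.injEq] at this
        omega
      · rw [hxd, f.map_adj_iff] at h
        exact absurd h sun_adj_inl_inl
    have hnohub : ∀ j (hj : j < s + 1), j < s → ¬ IsHub G a b (f (Sum.inl ⟨j, hj⟩)) := by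
      intro j hj hjs h
      have h1 : G.Adj a (f (Sum.inl ⟨j, hj⟩)) := h.1.resolve_left fun h => by
        simpa using f.injective h
      have h2 : G.Adj b (f (Sum.inl ⟨j, hj⟩)) := h.2.resolve_left fun h => by
        simpa using f.injective h
      have h1 := (hdc j 0 hj (by omega)).1 h1.symm
      have h2 := (hdc j s hj (by omega)).1 h2.symm
      rw [Nat.mod_eq_of_lt (by omega)] at h1 h2
      omega
    have hsteps : ∀ j (hj : j < s + 1), Steps (Link G x a b) (2 * j) a (f (Sum.inr ⟨j, hj⟩)) := by
      intro j
      induction j with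
      | zero => intro _; exact .refl _
      | succ j ih =>
        intro hj
        have hj' : j < s + 1 := by omega
        refine ((ih hj').tail (v := f (Sum.inr ⟨j, hj'⟩)) (w := f (Sum.inl ⟨j, hj'⟩))
          ⟨((hdc j j hj' hj').2 (.inl rfl)).symm, hallc _ _, halld _ _ (by omega),
            fun h => hnohub _ _ (by omega) h.2⟩).tail
          ⟨(hdc j (j + 1) hj' hj).2 (.inr (Nat.mod_eq_of_lt (by omega)).symm),
            halld _ _ (by omega), hallc _ _, fun h => hnohub _ _ (by omega) h.1⟩
    exact ⟨x, a, b, hxa, hxb, hcc 0 s (by omega) (by omega) (by omega), _, hsteps s (by omega)⟩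
  · rintro ⟨x, a, b, hxa, hxb, hab, L, hL⟩
    obtain ⟨L, p, ⟨⟨x, a, b⟩, hs⟩, hmin⟩ : ∃ (L : ℕ) (p : ℕ → V), (∃ q : V × V × V,
        G.Adj q.1 q.2.1 ∧ G.Adj q.1 q.2.2 ∧ G.Adj q.2.1 q.2.2 ∧ p 0 = q.2.1 ∧ p L = q.2.2 ∧
          ∀ t < L, Link G q.1 q.2.1 q.2.2 (p t) (p (t + 1))) ∧
        ∀ x' a' b' L', G.Adj x' a' → G.Adj x' b' → G.Adj a' b' →
          Steps (Link G x' a' b') L' a' b' → L ≤ L' := by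
      have hex : ∃ L x a b, G.Adj x a ∧ G.Adj x b ∧ G.Adj a b ∧ Steps (Link G x a b) L a b :=
        ⟨L, x, a, b, hxa, hxb, hab, hL⟩
      obtain ⟨x, a, b, hxa, hxb, hab, hL⟩ := Nat.find_spec hex
      obtain ⟨p, h0, hn, hp⟩ := hL.exists_path
      exact ⟨_, p, ⟨(x, a, b), hxa, hxb, hab, h0, hn, hp⟩, fun x' a' b' L' h1 h2 h3 h4 =>
        Nat.find_min' hex ⟨x', a', b', h1, h2, h3, h4⟩⟩
    obtain ⟨hxa, hxb, hab, h0, hn, hp⟩ := hs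
    obtain ⟨s, hs, -, f, -⟩ := exists_sun_of_shortest hG hxa hxb hab h0 hn hp hmin
    exact ⟨s + 1, by omega, ⟨f⟩⟩

/-! ### Strongly chordal completion -/

theorem sccRound_adj {k : ℕ} {K : SimpleGraph (Fin k)} {i a b : Fin k} :
    (sccRound K i).Adj a b ↔ K.Adj a b ∨ (a ≠ b ∧ i < a ∧ i < b ∧
      ((K.Adj i a ∧ K.Adj i b) ∨
        (K.Adj i b ∧ ∃ j, i < j ∧ K.Adj i j ∧ j < b ∧ K.Adj j a) ∨
        (K.Adj i a ∧ ∃ j, i < j ∧ K.Adj i j ∧ j < a ∧ K.Adj j b))) := by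
  classical
  simp only [sccRound, SimpleGraph.sup_adj, SimpleGraph.fromRel_adj]
  by_cases h : K.Adj a b
  · simp [h]
  · have h' : ¬ K.Adj b a := fun h' => h h'.symm
    simp only [h, h', not_false_eq_true, and_true, false_or]
    grind

/-- Induction over the rounds of the strongly chordal completion. -/
theorem scc_induction {k : ℕ} {G : SimpleGraph (Fin k)} (P : ℕ → SimpleGraph (Fin k) → Prop)
    (h0 : P 0 G) (hs : ∀ (i : Fin k) K, P i K → P (i + 1) (sccRound K i)) : P k (scc G) := by
  have key : ∀ t ≤ k, P t (((List.finRange k).take t).foldl sccRound G) := by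
    intro t
    induction t with
    | zero => intro _; simpa using h0
    | succ t ih =>
      intro ht
      have ht' : t < (List.finRange k).length := by simpa using ht
      rw [List.take_succ_eq_append_getElem ht', List.foldl_append]
      simpa using hs ⟨t, ht⟩ _ (ih (by omega))
  have h := key k le_rfl
  rwa [List.take_of_length_le (by simp)] at h

theorem le_scc {k : ℕ} (G : SimpleGraph (Fin k)) : G ≤ scc G :=
  scc_induction (fun _ K => G ≤ K) le_rfl fun _ _ h =>
    h.trans fun _ _ hab => sccRound_adj.2 (.inl hab)

/-- The vertices below `t` are simple in the order of the positions: the later neighbours of such a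
vertex form a clique, and their neighbourhoods among the later vertices form a chain. -/
def IsStrongElimination {k : ℕ} (t : ℕ) (K : SimpleGraph (Fin k)) : Prop :=
  ∀ i j s : Fin k, i.val < t → i < j → j < s → K.Adj i j → K.Adj i s →
    K.Adj j s ∧ ∀ r, i < r → r ≠ s → K.Adj j r → K.Adj s r

theorem IsStrongElimination.sccRound {k : ℕ} {K : SimpleGraph (Fin k)} {c : Fin k}
    (h : IsStrongElimination c K) : IsStrongElimination (c + 1) (sccRound K c) := by
  intro i j s hi hij hjs hAij hAis
  have old : ∀ {u}, ¬ c < i → ((_root_.sccRound K c).Adj i u ↔ K.Adj i u) := fun {u} hc => by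
    rw [sccRound_adj]; simp [hc]
  have hci : ¬ c < i := fun h => by
    have : c.val < i.val := h
    omega
  rw [old hci] at hAij hAis
  rcases (not_lt.1 hci).lt_or_eq with hic | rfl
  · -- an earlier vertex `i`: the new edges at `j` come with new edges at `s`
    obtain ⟨h1, h2⟩ := h i j s hic hij hjs hAij hAis
    refine ⟨sccRound_adj.2 (.inl h1), fun r hr hrs hjr => ?_⟩
    rw [sccRound_adj] at hjr
    rcases hjr with hjr | ⟨hne, hcj, hcr, hh⟩
    · exact sccRound_adj.2 (.inl (h2 r hr hrs hjr))
    · have hcs : c < s := hcj.trans hjs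
      have trans : K.Adj c j → K.Adj c s := fun hc =>
        (h2 c hic hcs.ne hc.symm).symm
      by_cases hsr : K.Adj s r
      · exact sccRound_adj.2 (.inl hsr)
      refine sccRound_adj.2 (.inr ⟨hrs.symm, hcs, hcr, ?_⟩)
      rcases hh with ⟨h3, h4⟩ | ⟨h3, j', h4, h5, h6, h7⟩ | ⟨h3, j', h4, h5, h6, h7⟩
      · exact .inl ⟨trans h3, h4⟩
      · by_cases hjs' : j' = s
        · exact .inl ⟨hjs' ▸ h5, h3⟩
        · exact .inr (.inl ⟨h3, j', h4, h5, h6, (h2 j' (hic.trans h4) hjs' h7.symm).symm⟩)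
      · exact .inr (.inr ⟨trans h3, j', h4, h5, h6.trans hjs, h7⟩)
  · refine ⟨sccRound_adj.2 (.inr ⟨hjs.ne, hij, hij.trans hjs, .inl ⟨hAij, hAis⟩⟩),
      fun r hr hrs hjr => ?_⟩
    rw [sccRound_adj] at hjr
    refine sccRound_adj.2 (.inr ⟨hrs.symm, hij.trans hjs, hr, ?_⟩)
    rcases hjr with hjr | ⟨hne, -, -, ⟨h3, h4⟩ | ⟨h3, -⟩ | ⟨h3, j', h4, h5, h6, h7⟩⟩
    · exact .inr (.inr ⟨hAis, j, hij, hAij, hjs, hjr⟩)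
    · exact .inl ⟨hAis, h4⟩
    · exact .inl ⟨hAis, h3⟩
    · exact .inr (.inr ⟨hAis, j', h4, h5, h6.trans hjs, h7⟩)

theorem isStrongElimination_scc {k : ℕ} (G : SimpleGraph (Fin k)) :
    IsStrongElimination k (scc G) :=
  scc_induction IsStrongElimination (fun _ _ _ hi => absurd hi (Nat.not_lt_zero _))
    fun _ _ h => h.sccRound

/-- If the hubs come last in the order, then the completion joins a vertex other than a hub only to
vertices with which it was connected along edges that do not join two hubs. -/
theorem scc_connected {k : ℕ} {G : SimpleGraph (Fin k)} {hub : Fin k → Prop}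
    (hhub : ∀ i j, i < j → hub i → hub j) (C : Fin k → Fin k → Prop)
    (symm : ∀ u v, C u v → C v u) (trans : ∀ u v w, C u v → C v w → C u w)
    (hC : ∀ u v, G.Adj u v → ¬ (hub u ∧ hub v) → C u v) :
    ∀ u v, (scc G).Adj u v → ¬ (hub u ∧ hub v) → C u v := by
  refine scc_induction (fun _ K => ∀ u v, K.Adj u v → ¬ (hub u ∧ hub v) → C u v) hC
    fun i K ih => ?_
  -- the only asymmetric case: `r` is joined to `s` along the walk `r, j, i, s`
  have key : ∀ r s, i < r → i < s → K.Adj i s → (∃ j, i < j ∧ K.Adj i j ∧ j < s ∧ K.Adj j r) →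
      ¬ (hub r ∧ hub s) → C r s := by
    rintro r s hir his hs ⟨j, hij, hj, hjs, hjr⟩ hn
    by_cases hi : hub i
    · exact absurd ⟨hhub _ _ hir hi, hhub _ _ his hi⟩ hn
    · have h1 := ih i s hs fun h => hi h.1
      have h2 := ih i j hj fun h => hi h.1
      by_cases hb : hub j ∧ hub r
      · exact absurd ⟨hb.2, hhub _ _ hjs hb.1⟩ hn
      · exact trans _ _ _ (symm _ _ (ih j r hjr hb)) (trans _ _ _ (symm _ _ h2) h1)
  intro u v huv hn
  rcases sccRound_adj.1 huv with h | ⟨-, hiu, hiv, ⟨h1, h2⟩ | ⟨h1, h2⟩ | ⟨h1, h2⟩⟩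
  · exact ih u v h hn
  · by_cases hi : hub i
    · exact absurd ⟨hhub _ _ hiu hi, hhub _ _ hiv hi⟩ hn
    · exact trans _ _ _ (symm _ _ (ih i u h1 fun h => hi h.1)) (ih i v h2 fun h => hi h.1)
  · exact key u v hiu hiv h1 h2 hn
  · exact symm _ _ (key v u hiv hiu h1 h2 fun h => hn ⟨h.2, h.1⟩)

/-- Adjacency after the red edges are added: adjacent, or joined by a later common neighbour. -/
def AdjOrLater {k : ℕ} (K : SimpleGraph (Fin k)) (i j : Fin k) : Prop :=
  K.Adj i j ∨ i ≠ j ∧ ∃ q, i < q ∧ j < q ∧ K.Adj i q ∧ K.Adj j q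

theorem AdjOrLater.symm {k : ℕ} {K : SimpleGraph (Fin k)} {i j : Fin k} (h : AdjOrLater K i j) :
    AdjOrLater K j i :=
  h.imp (fun h => h.symm) fun ⟨hne, q, h1, h2, h3, h4⟩ => ⟨hne.symm, q, h2, h1, h4, h3⟩

/-- The red edges keep the order a perfect elimination scheme. -/
theorem IsStrongElimination.adjOrLater {k : ℕ} {K : SimpleGraph (Fin k)}
    (h : IsStrongElimination k K) {i j l : Fin k} (hij : i < j) (hil : i < l) (hjl : j ≠ l)
    (hj : AdjOrLater K i j) (hl : AdjOrLater K i l) : AdjOrLater K j l := by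
  have clique : ∀ u v, i < u → i < v → u ≠ v → K.Adj i u → K.Adj i v → K.Adj u v := by
    intro u v hu hv hne h1 h2
    rcases lt_or_gt_of_ne hne with h3 | h3
    · exact (h i u v i.isLt hu h3 h1 h2).1
    · exact (h i v u i.isLt hv h3 h2 h1).1.symm
  have mixed : ∀ u v, i < u → i < v → u ≠ v → K.Adj i u →
      (∃ q, i < q ∧ v < q ∧ K.Adj i q ∧ K.Adj v q) → AdjOrLater K u v := by
    rintro u v hu hv hne h1 ⟨q, hiq, hvq, h2, h3⟩
    by_cases huq : u = q
    · subst huq; exact .inl h3.symm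
    · have h4 := clique u q hu hiq huq h1 h2
      rcases lt_or_gt_of_ne huq with h5 | h5
      · exact .inr ⟨hne, q, h5, hvq, h4, h3⟩
      · exact .inl ((h i q u i.isLt hiq h5 h2 h1).2 v hv hne.symm h3.symm)
  have both : ∀ u v q r, i < u → i < v → u ≠ v → u < q → v < r → q < r → K.Adj i q → K.Adj u q →
      K.Adj i r → K.Adj v r → AdjOrLater K u v := by
    intro u v q r hu hv hne huq hvr hqr h1 h2 h3 h4
    exact .inr ⟨hne, r, huq.trans hqr, hvr,
      ((h i q r i.isLt (hu.trans huq) hqr h1 h3).2 u hu (huq.trans hqr).ne h2.symm).symm, h4⟩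
  rcases hj with hj | ⟨-, q, hiq, hjq, h1, h2⟩
  · rcases hl with hl | ⟨-, hl⟩
    · exact .inl (clique j l hij hil hjl hj hl)
    · exact mixed j l hij hil hjl hj hl
  · rcases hl with hl | ⟨-, r, hir, hlr, h3, h4⟩
    · exact (mixed l j hil hij hjl.symm hl ⟨q, hiq, hjq, h1, h2⟩).symm
    · rcases lt_trichotomy q r with h5 | rfl | h5
      · exact both j l q r hij hil hjl hjq hlr h5 h1 h2 h3 h4
      · exact .inr ⟨hjl, q, hjq, hlr, h2, h4⟩
      · exact (both l j r q hil hij hjl.symm hlr hjq h5 h3 h4 h1 h2).symm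

/-- In a strong elimination order in which the vertices outside `A`, `B` and the hubs come first and
the hubs last, a shortest path from `A` to `B` has a single step or passes through a single hub. -/
theorem IsStrongElimination.exists_adjOrLater {k : ℕ} {K : SimpleGraph (Fin k)}
    (h : IsStrongElimination k K) {A B hub : Fin k → Prop}
    (hA : ∀ i, A i → ¬ hub i ∧ ¬ B i) (hB : ∀ i, B i → ¬ hub i)
    (hhub : ∀ i j, i < j → hub i → hub j)
    (hnone : ∀ i j, i < j → (A i ∨ B i ∨ hub i) → (A j ∨ B j ∨ hub j))
    (hsteps : ∃ n u v, A u ∧ B v ∧ Steps (fun i j => K.Adj i j ∧ ¬ (hub i ∧ hub j)) n u v) :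
    ∃ u v, A u ∧ B v ∧ AdjOrLater K u v := by
  obtain ⟨n, p, h0, hn, hp, hmin⟩ := Steps.exists_shortest A B hsteps
  set E : Fin k → Fin k → Prop := fun i j => K.Adj i j ∧ ¬ (hub i ∧ hub j) with hE
  have pre : ∀ t ≤ n, Steps E t (p 0) (p t) := fun t ht => by
    simpa using Steps.of_path (E := E) (p := p) (Nat.zero_le t) fun i _ hi => hp i (by omega)
  have suf : ∀ t ≤ n, Steps E (n - t) (p t) (p n) := fun t ht =>
    Steps.of_path (E := E) (p := p) ht fun i _ hi => hp i hi
  have hcut : ∀ s t, s + 2 ≤ t → t ≤ n → ¬ E (p s) (p t) := fun s t hst ht he => by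
    have := hmin _ _ _ h0 hn (((pre s (by omega)).tail he).trans (suf t ht))
    omega
  have hinj : ∀ s t, s < t → t ≤ n → p s ≠ p t := fun s t hst ht he => by
    have := hmin _ _ _ h0 hn ((pre s (by omega)).trans (he ▸ suf t ht))
    omega
  have hAint : ∀ t, 0 < t → t ≤ n → ¬ A (p t) := fun t h1 h2 h3 => by
    have := hmin _ _ _ h3 hn (suf t h2)
    omega
  have hBint : ∀ t, t < n → ¬ B (p t) := fun t h1 h3 => by
    have := hmin _ _ _ h0 h3 (pre t h1.le)
    omega
  have hn0 : 0 < n := by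
    rcases Nat.eq_zero_or_pos n with rfl | h
    · exact absurd hn (hA _ h0).2
    · exact h
  by_cases hn1 : n = 1
  · subst hn1
    exact ⟨_, _, h0, hn, .inl (hp 0 hn0).1⟩
  by_cases hallhub : ∀ t, 0 < t → t < n → hub (p t)
  · have hn2 : n = 2 := by
      by_contra hne
      exact (hp 1 (by omega)).2 ⟨hallhub 1 (by omega) (by omega), hallhub 2 (by omega) (by omega)⟩
    subst hn2
    have hlt : ∀ u, ¬ hub u → u < p 1 := fun u hu => by
      rcases lt_trichotomy u (p 1) with h | h | h
      · exact h
      · exact absurd (h ▸ hallhub 1 (by omega) (by omega)) hu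
      · exact absurd (hhub _ _ h (hallhub 1 (by omega) (by omega))) hu
    exact ⟨_, _, h0, hn, .inr ⟨hinj 0 2 (by omega) le_rfl, p 1, hlt _ (hA _ h0).1,
      hlt _ (hB _ hn), (hp 0 (by omega)).1, (hp 1 (by omega)).1.symm⟩⟩
  · push Not at hallhub
    obtain ⟨t0, ht0, ht0n, hnh⟩ := hallhub
    -- the first vertex `p t` of the path in the order, which is not in `A`, in `B` or a hub
    obtain ⟨t, ht, htmin⟩ := Finset.exists_min_image (Finset.range (n + 1)) p ⟨0, by simp⟩
    simp only [Finset.mem_range, Nat.lt_succ_iff] at ht htmin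
    have hcl : ¬ (A (p t) ∨ B (p t) ∨ hub (p t)) := fun hc => by
      have : A (p t0) ∨ B (p t0) ∨ hub (p t0) := by
        rcases (htmin t0 ht0n.le).lt_or_eq with h1 | h1
        · exact hnone _ _ h1 hc
        · exact h1 ▸ hc
      rcases this with h1 | h1 | h1
      · exact hAint _ ht0 ht0n.le h1
      · exact hBint _ ht0n h1
      · exact hnh h1
    have ht1 : 0 < t := by
      rcases Nat.eq_zero_or_pos t with rfl | h
      · exact absurd (.inl h0) hcl
      · exact h
    have ht2 : t < n := by
      rcases ht.lt_or_eq with h | rfl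
      · exact h
      · exact absurd (.inr (.inl hn)) hcl
    have hlt : ∀ s ≤ n, s ≠ t → p t < p s := fun s hs hne => by
      refine lt_of_le_of_ne (htmin s hs) ?_
      rcases lt_or_gt_of_ne hne with h1 | h1
      · exact (hinj s t h1 ht).symm
      · exact hinj t s h1 hs
    have e1 := hp (t - 1) (by omega)
    rw [show t - 1 + 1 = t by omega] at e1
    have e2 := hp t ht2
    have c1 : ∀ s t', s + 2 ≤ t' → t' ≤ n → K.Adj (p s) (p t') → hub (p s) ∧ hub (p t') :=
      fun s t' h1 h2 h3 => by_contra fun h4 => hcut s t' h1 h2 ⟨h3, h4⟩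
    have hlr : p (t - 1) ≠ p (t + 1) := hinj _ _ (by omega) (by omega)
    have hl := hlt (t - 1) (by omega) (by omega)
    have hr := hlt (t + 1) (by omega) (by omega)
    exfalso
    rcases lt_or_gt_of_ne hlr with hlt' | hlt'
    · obtain ⟨h1, h2⟩ := h (p t) _ _ (p t).isLt hl hlt' e1.1.symm e2.1
      obtain ⟨h3, h4⟩ := c1 (t - 1) (t + 1) (by omega) (by omega) h1
      have ht3 : 2 ≤ t := by
        by_contra hc
        rw [show t - 1 = 0 by omega] at h3
        exact (hA _ h0).1 h3
      have e3 := hp (t - 2) (by omega)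
      rw [show t - 2 + 1 = t - 1 by omega] at e3
      have h5 := h2 (p (t - 2)) (hlt _ (by omega) (by omega)) (hinj _ _ (by omega) (by omega))
        e3.1.symm
      exact e3.2 ⟨(c1 (t - 2) (t + 1) (by omega) (by omega) h5.symm).1, h3⟩
    · obtain ⟨h1, h2⟩ := h (p t) _ _ (p t).isLt hr hlt' e2.1 e1.1.symm
      obtain ⟨h3, h4⟩ := c1 (t - 1) (t + 1) (by omega) (by omega) h1.symm
      have ht3 : t + 2 ≤ n := by
        by_contra hc
        rw [show t + 1 = n by omega] at h4
        exact hB _ hn h4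
      have e3 := hp (t + 1) (by omega)
      have h5 := h2 (p (t + 2)) (hlt _ (by omega) (by omega))
        (hinj _ _ (by omega) (by omega)).symm e3.1
      exact e3.2 ⟨h4, (c1 (t - 1) (t + 2) (by omega) (by omega) h5).2⟩

/-! ### What tip-of-sunflower and find-sun decide -/

section Tip

variable {V : Type*} {G : SimpleGraph V} {x a b : V} {k r : ℕ} {y : Fin k ↪ V} {z : Fin r ↪ V}

theorem completionAlong_adj_iff {i j : Fin k} :
    (completionAlong G y).Adj (y i) (y j) ↔ (scc (G.comap y)).Adj i j := by
  simp only [completionAlong, SimpleGraph.sup_adj, SimpleGraph.map_adj_apply]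
  exact ⟨fun h => h.elim (fun h => le_scc (G.comap y) h) id, .inr⟩

theorem completionAlong_sup_redEdges_adj_iff {i j : Fin k} :
    (completionAlong G y ⊔ redEdges (completionAlong G y) y).Adj (y i) (y j) ↔
      AdjOrLater (scc (G.comap y)) i j := by
  classical
  simp only [SimpleGraph.sup_adj, redEdges, SimpleGraph.fromRel_adj, AdjOrLater]
  set K := scc (G.comap y) with hK
  rw [completionAlong_adj_iff]
  constructor
  · rintro (h | ⟨hne, ⟨i', j', q, h1, h2, hi, hj, h3, h4, -⟩ |
      ⟨i', j', q, h1, h2, hi, hj, h3, h4, -⟩⟩)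
    · exact .inl h
    · rw [completionAlong_adj_iff] at h3 h4
      obtain rfl := y.injective hi
      obtain rfl := y.injective hj
      exact .inr ⟨h1.ne, q, h1.trans h2, h2, h3, h4.symm⟩
    · rw [completionAlong_adj_iff] at h3 h4
      obtain rfl := y.injective hi
      obtain rfl := y.injective hj
      exact .inr ⟨h1.ne', q, h2, h1.trans h2, h4.symm, h3⟩
  · rintro (h | ⟨hne, q, h1, h2, h3, h4⟩)
    · exact .inl h
    · by_cases hA : K.Adj i j
      · exact .inl hA
      · refine .inr ⟨fun h => hne (y.injective h), ?_⟩
        rcases lt_or_gt_of_ne hne with h | h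
        · refine .inl ⟨i, j, q, h, h2, rfl, rfl, ?_, ?_, ?_⟩ <;> rw [completionAlong_adj_iff]
          · exact h3
          · exact h4.symm
          · exact hA
        · refine .inr ⟨j, i, q, h, h1, rfl, rfl, ?_, ?_, ?_⟩ <;> rw [completionAlong_adj_iff]
          · exact h4
          · exact h3.symm
          · exact fun h => hA h.symm

theorem completionAlong_sup_redEdges_adj_of_notMem {u w : V} (hw : w ∉ Set.range y) :
    (completionAlong G y ⊔ redEdges (completionAlong G y) y).Adj u w ↔ G.Adj u w := by
  simp only [SimpleGraph.sup_adj, redEdges, SimpleGraph.fromRel_adj, completionAlong]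
  constructor
  · rintro ((h | h) | ⟨-, ⟨_, j, _, _, _, _, rfl, _⟩ | ⟨j, _, _, _, _, rfl, _⟩⟩)
    · exact h
    · rw [SimpleGraph.map_adj] at h
      obtain ⟨_, j, _, _, rfl⟩ := h
      exact absurd ⟨j, rfl⟩ hw
    · exact absurd ⟨j, rfl⟩ hw
    · exact absurd ⟨j, rfl⟩ hw
  · exact fun h => .inl (.inl h)

theorem get_elimination_list (y : Fin k → V) (z : Fin r → V)
    (t : Fin (List.ofFn y ++ List.ofFn z ++ [x]).length) :
    (∃ i : Fin k, t.val = i ∧ (List.ofFn y ++ List.ofFn z ++ [x]).get t = y i) ∨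
    (∃ i : Fin r, t.val = k + i ∧ (List.ofFn y ++ List.ofFn z ++ [x]).get t = z i) ∨
    (t.val = k + r ∧ (List.ofFn y ++ List.ofFn z ++ [x]).get t = x) := by
  obtain ⟨t, ht⟩ := t
  have ht' : t < k + r + 1 := by
    simp only [List.length_append, List.length_ofFn, List.length_singleton] at ht
    exact ht
  by_cases h1 : t < k
  · left
    refine ⟨⟨t, h1⟩, rfl, ?_⟩
    simp [h1]
  · by_cases h2 : t < k + r
    · right; left
      refine ⟨⟨t - k, by omega⟩, by simp; omega, ?_⟩
      have h3 : t - k < r := by omega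
      simp [List.getElem_append, h1, h3]
    · right; right
      obtain rfl : t = k + r := by omega
      simp

theorem get_elimination_list_left (y : Fin k → V) (z : Fin r → V) (i : Fin k)
    (h : i.val < (List.ofFn y ++ List.ofFn z ++ [x]).length) :
    (List.ofFn y ++ List.ofFn z ++ [x]).get ⟨i, h⟩ = y i := by
  simp

theorem get_elimination_list_mid (y : Fin k → V) (z : Fin r → V) (i : Fin r)
    (h : k + i.val < (List.ofFn y ++ List.ofFn z ++ [x]).length) :
    (List.ofFn y ++ List.ofFn z ++ [x]).get ⟨k + i, h⟩ = z i := by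
  simp

/-- Whatever the choices are, tip-of-sunflower applied to a vertex `x` whose only neighbours are two
adjacent vertices `a` and `b` decides whether linking edges join `a` to `b`. -/
theorem inThreeSun_iff (hab : G.Adj a b) (hN : G.neighborSet x = {a, b})
    (hy : Set.range y = {v | v ≠ x ∧ ¬ G.Adj x v}) (hz : Set.range z = G.neighborSet x)
    (hmono : ∀ i j, i < j → (G.neighborSet (y i) ∩ G.neighborSet x).ncard ≤
      (G.neighborSet (y j) ∩ G.neighborSet x).ncard) :
    InThreeSun (completionAlong G y) x y z ↔ ∃ L, Steps (Link G x a b) L a b := by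
  classical
  have hxN : ∀ v, G.Adj x v ↔ v = a ∨ v = b := fun v => by
    rw [← SimpleGraph.mem_neighborSet, hN]; rfl
  have hxa : G.Adj x a := (hxN a).2 (.inl rfl)
  have hxb : G.Adj x b := (hxN b).2 (.inr rfl)
  have hyx : ∀ i, y i ≠ x ∧ ¬ G.Adj x (y i) := fun i => by
    have : y i ∈ Set.range y := ⟨i, rfl⟩
    rw [hy] at this
    exact this
  have hya : ∀ i, y i ≠ a := fun i h => (hyx i).2 (h ▸ hxa)
  have hyb : ∀ i, y i ≠ b := fun i h => (hyx i).2 (h ▸ hxb)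
  have hxy : x ∉ Set.range y := fun ⟨i, hi⟩ => (hyx i).1 hi
  have hzy : ∀ w, G.Adj x w → w ∉ Set.range y := fun w hw ⟨i, hi⟩ => (hyx i).2 (hi ▸ hw)
  have hzN : ∀ i, G.Adj x (z i) := fun i => by
    have : z i ∈ Set.range z := ⟨i, rfl⟩
    rw [hz] at this
    exact this
  have hcount : ∀ i, (G.neighborSet (y i) ∩ G.neighborSet x).ncard =
      (if G.Adj (y i) a then 1 else 0) + if G.Adj (y i) b then 1 else 0 := fun i => by
    rw [hN]
    by_cases h1 : G.Adj (y i) a <;> by_cases h2 : G.Adj (y i) b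
    · rw [Set.inter_eq_right.2, Set.ncard_pair hab.ne]
      · simp [h1, h2]
      · rintro v (rfl | rfl) <;> assumption
    · rw [show G.neighborSet (y i) ∩ {a, b} = {a} by
        ext v; simp only [Set.mem_inter_iff, SimpleGraph.mem_neighborSet, Set.mem_insert_iff,
          Set.mem_singleton_iff]; grind]
      simp [h1, h2]
    · rw [show G.neighborSet (y i) ∩ {a, b} = {b} by
        ext v; simp only [Set.mem_inter_iff, SimpleGraph.mem_neighborSet, Set.mem_insert_iff,
          Set.mem_singleton_iff]; grind]
      simp [h1, h2]
    · rw [show G.neighborSet (y i) ∩ {a, b} = ∅ by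
        ext v; simp only [Set.mem_inter_iff, SimpleGraph.mem_neighborSet, Set.mem_insert_iff,
          Set.mem_singleton_iff, Set.mem_empty_iff_false]; grind]
      simp [h1, h2]
  let A : Fin k → Prop := fun i => G.Adj (y i) a ∧ ¬ G.Adj (y i) b
  let B : Fin k → Prop := fun i => G.Adj (y i) b ∧ ¬ G.Adj (y i) a
  let hub : Fin k → Prop := fun i => G.Adj (y i) a ∧ G.Adj (y i) b
  -- as `x` has two neighbours only, the order of `M(x)` puts the hubs last, after `A` and `B`
  have hhub : ∀ i j, i < j → hub i → hub j := fun i j hij hi => by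
    have h := hmono i j hij
    rw [hcount, hcount] at h
    simp only [hi.1, hi.2, if_true] at h
    simp only [hub]
    split_ifs at h <;> first | omega | constructor <;> assumption
  have hnone : ∀ i j, i < j → (A i ∨ B i ∨ hub i) → (A j ∨ B j ∨ hub j) := fun i j hij hi => by
    have h := hmono i j hij
    rw [hcount, hcount] at h
    simp only [A, B, hub] at hi ⊢
    by_cases h1 : G.Adj (y j) a <;> by_cases h2 : G.Adj (y j) b <;> simp only [h1, h2] <;>
      by_cases h3 : G.Adj (y i) a <;> by_cases h4 : G.Adj (y i) b <;> simp_all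
  have hhubiff : ∀ i, IsHub G a b (y i) ↔ hub i := fun i => by
    simp only [IsHub, hya, hyb, false_or, hub, G.adj_comm]
  have hally : ∀ i, IsAllowed G x a b (y i) := fun i =>
    ⟨(hyx i).1, fun h => absurd h (hyx i).2⟩
  have halla : IsAllowed G x a b a := ⟨hxa.ne', fun _ => .inl rfl⟩
  have hallb : IsAllowed G x a b b := ⟨hxb.ne', fun _ => .inr rfl⟩
  set K := scc (G.comap y) with hK
  have hS : IsStrongElimination k K := isStrongElimination_scc _
  -- a violated condition always consists of a neighbour of `a` only and a neighbour of `b` only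
  have hviol : InThreeSun (completionAlong G y) x y z ↔ ∃ u v, A u ∧ B v ∧ AdjOrLater K u v := by
    constructor
    · intro hI
      by_contra hcon
      push Not at hcon
      refine hI fun s t q hst htq h1 h2 => ?_
      have hst' : s.val < t.val := hst
      have htq' : t.val < q.val := htq
      have hq := q.isLt
      simp only [List.length_append, List.length_ofFn, List.length_singleton] at hq
      have hzz : ∀ u v : Fin r, u ≠ v → G.Adj (z u) (z v) := fun u v huv => by
        have hne : z u ≠ z v := fun h => huv (z.injective h)
        rcases (hxN _).1 (hzN u) with h3 | h3 <;> rcases (hxN _).1 (hzN v) with h4 | h4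
        · exact absurd (h3.trans h4.symm) hne
        · rw [h3, h4]; exact hab
        · rw [h3, h4]; exact hab.symm
        · exact absurd (h3.trans h4.symm) hne
      rcases get_elimination_list (x := x) y z s with ⟨i, hi, e1⟩ | ⟨i, hi, e1⟩ | ⟨hi, e1⟩ <;>
        rcases get_elimination_list (x := x) y z t with ⟨j, hj, e2⟩ | ⟨j, hj, e2⟩ | ⟨hj, e2⟩ <;>
        rcases get_elimination_list (x := x) y z q with ⟨l, hl, e3⟩ | ⟨l, hl, e3⟩ | ⟨hl, e3⟩ <;>
        try omega
      all_goals rw [e1, e2] at h1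
      all_goals rw [e1, e3] at h2
      all_goals rw [e2, e3]
      · rw [completionAlong_sup_redEdges_adj_iff] at h1 h2 ⊢
        have hij : i < j := Fin.lt_def.2 (by omega)
        have hjl : j < l := Fin.lt_def.2 (by omega)
        exact hS.adjOrLater hij (hij.trans hjl) hjl.ne h1 h2
      · rw [completionAlong_sup_redEdges_adj_iff] at h1
        rw [completionAlong_sup_redEdges_adj_of_notMem (hzy _ (hzN l))] at h2 ⊢
        have hij : i < j := Fin.lt_def.2 (by omega)
        by_contra hno
        have hm := hmono i j hij
        rw [hcount, hcount] at hm
        rcases (hxN _).1 (hzN l) with h3 | h3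
        · rw [h3] at h2 hno
          simp only [h2, hno, if_true, if_false] at hm
          refine hcon i j ⟨h2, ?_⟩ ⟨?_, hno⟩ h1
          · intro h4; simp only [h4, if_true] at hm; split_ifs at hm <;> omega
          · by_contra h4; simp only [h4, if_false] at hm; split_ifs at hm <;> omega
        · rw [h3] at h2 hno
          simp only [h2, hno, if_true, if_false] at hm
          refine hcon j i ⟨?_, hno⟩ ⟨h2, ?_⟩ h1.symm
          · by_contra h4; simp only [h4, if_false] at hm; split_ifs at hm <;> omega
          · intro h4; simp only [h4, if_true] at hm; split_ifs at hm <;> omega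
      · rw [completionAlong_sup_redEdges_adj_of_notMem hxy] at h2
        exact absurd h2.symm (hyx i).2
      · have hjl : j ≠ l := fun h => by rw [h] at hj; omega
        rw [completionAlong_sup_redEdges_adj_of_notMem (hzy _ (hzN l))]
        exact hzz j l hjl
      · rw [completionAlong_sup_redEdges_adj_of_notMem hxy] at h2
        exact absurd h2.symm (hyx i).2
      · have hjl : j ≠ l := fun h => by rw [h] at hj; omega
        rw [completionAlong_sup_redEdges_adj_of_notMem (hzy _ (hzN l))]
        exact hzz j l hjl
      · rw [completionAlong_sup_redEdges_adj_of_notMem hxy]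
        exact (hzN j).symm
    · rintro ⟨u, v, hu, hv, huv⟩ hPE
      have hne : u ≠ v := fun h => hu.2 (h ▸ hv.1)
      -- the earlier of the two vertices sees the later one and a vertex that the later one misses
      have key : ∀ i j : Fin k, ∀ w, i < j → AdjOrLater K i j → G.Adj x w → G.Adj (y i) w →
          ¬ G.Adj (y j) w → False := by
        intro i j w hij h1 hw h2 h3
        have hwz : w ∈ Set.range z := by rw [hz]; exact hw
        obtain ⟨l, rfl⟩ := hwz
        have hi := i.isLt
        have hj := j.isLt
        have hl := l.isLt
        have hlen : (List.ofFn y ++ List.ofFn z ++ [x]).length = k + r + 1 := by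
          simp only [List.length_append, List.length_ofFn, List.length_singleton]
        have := hPE ⟨i, by omega⟩ ⟨j, by omega⟩ ⟨k + l, by omega⟩ hij
          (Fin.lt_def.2 (show j.val < k + l.val by omega))
        rw [get_elimination_list_left, get_elimination_list_left, get_elimination_list_mid,
          completionAlong_sup_redEdges_adj_iff,
          completionAlong_sup_redEdges_adj_of_notMem (hzy _ hw),
          completionAlong_sup_redEdges_adj_of_notMem (hzy _ hw)] at this
        exact h3 (this h1 h2)
      rcases lt_or_gt_of_ne hne with h | h
      · exact key u v a h huv hxa hu.1 hv.2
      · exact key v u b h huv.symm hxb hv.1 hu.2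
  rw [hviol]
  let E : Fin k → Fin k → Prop := fun i j => G.Adj (y i) (y j) ∧ ¬ (hub i ∧ hub j)
  have hEK : ∀ i j, E i j → K.Adj i j ∧ ¬ (hub i ∧ hub j) := fun i j h =>
    ⟨le_scc (G.comap y) h.1, h.2⟩
  have hEsymm : ∀ i j, E i j → E j i := fun i j h => ⟨h.1.symm, fun h' => h.2 ⟨h'.2, h'.1⟩⟩
  constructor
  · rintro ⟨u, v, hu, hv, huv⟩
    have hC := scc_connected (G := G.comap y) hhub (fun i j => ∃ n, Steps E n i j)
      (fun i j ⟨n, h⟩ => ⟨n, h.symm hEsymm⟩)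
      (fun i j l ⟨n, h⟩ ⟨m, h'⟩ => ⟨n + m, h.trans h'⟩)
      (fun i j h h' => ⟨1, .single ⟨h, h'⟩⟩)
    have huh : ¬ hub u := fun h => hu.2 h.2
    have hvh : ¬ hub v := fun h => hv.2 h.1
    obtain ⟨n, hn⟩ : ∃ n, Steps E n u v := by
      rcases huv with huv | ⟨-, q, -, -, h1, h2⟩
      · exact hC u v huv fun h => huh h.1
      · obtain ⟨n, hn⟩ := hC u q h1 fun h => huh h.1
        obtain ⟨m, hm⟩ := hC v q h2 fun h => hvh h.1
        exact ⟨n + m, hn.trans (hm.symm hEsymm)⟩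
    have h1 : Link G x a b a (y u) := ⟨hu.1.symm, halla, hally u, fun h => huh ((hhubiff u).1 h.2)⟩
    have h2 : Link G x a b (y v) b := ⟨hv.1, hally v, hallb, fun h => hvh ((hhubiff v).1 h.1)⟩
    have h3 : Steps (Link G x a b) n (y u) (y v) := hn.map y fun i j h =>
      ⟨h.1, hally i, hally j, fun h' => h.2 ⟨(hhubiff i).1 h'.1, (hhubiff j).1 h'.2⟩⟩
    exact ⟨_, ((Steps.single h1).trans h3).tail h2⟩
  · rintro ⟨L, hL⟩
    refine hS.exists_adjOrLater (A := A) (B := B) (hub := hub)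
      (fun i h => ⟨fun h' => h.2 h'.2, fun h' => h.2 h'.1⟩) (fun i h h' => h.2 h'.1) hhub hnone ?_
    suffices ∃ n u v, A u ∧ B v ∧ Steps E n u v by
      obtain ⟨n, u, v, hu, hv, hs⟩ := this
      exact ⟨n, u, v, hu, hv, hs.map id hEK⟩
    by_contra hno
    -- the vertices reached before `b` are `a` and those that a vertex of `A` reaches
    have key : ∀ n u w, Steps (Link G x a b) n u w → u = a →
        w = a ∨ ∃ i, w = y i ∧ ∃ n u, A u ∧ Steps E n u i := by
      intro n u w hs
      induction hs with
      | refl v => exact fun h => .inl h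
      | @tail n u v w _ e ih =>
        intro hu
        have hw : w = a ∨ w = b ∨ ∃ j, w = y j := by
          by_cases h1 : G.Adj x w
          · rcases (hxN w).1 h1 with h | h
            · exact .inl h
            · exact .inr (.inl h)
          · have : w ∈ Set.range y := by rw [hy]; exact ⟨e.2.2.1.1, h1⟩
            obtain ⟨j, hj⟩ := this
            exact .inr (.inr ⟨j, hj.symm⟩)
        rcases hw with hw | rfl | ⟨j, rfl⟩
        · exact .inl hw
        · exfalso
          rcases ih hu with rfl | ⟨i, rfl, n, u, hA, hs⟩
          · exact e.2.2.2 ⟨isHub_left hab, isHub_right hab⟩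
          · have hi : ¬ hub i := fun h => e.2.2.2 ⟨(hhubiff i).2 h, isHub_right hab⟩
            exact hno ⟨n, u, i, hA, ⟨e.1, fun h => hi ⟨h, e.1⟩⟩, hs⟩
        · right
          refine ⟨j, rfl, ?_⟩
          rcases ih hu with rfl | ⟨i, rfl, n, u, hA, hs⟩
          · have hj : ¬ hub j := fun h => e.2.2.2 ⟨isHub_left hab, (hhubiff j).2 h⟩
            exact ⟨0, j, ⟨e.1.symm, fun h => hj ⟨e.1.symm, h⟩⟩, .refl _⟩
          · exact ⟨n + 1, u, hA, hs.tail ⟨e.1, fun h =>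
              e.2.2.2 ⟨(hhubiff i).2 h.1, (hhubiff j).2 h.2⟩⟩⟩
    rcases key L a b hL rfl with h | ⟨i, h, -⟩
    · exact hab.ne h.symm
    · exact hyb i h.symm

end Tip

section FindSun

variable {V : Type*} {G : SimpleGraph V}

theorem Link.swap {x a b u v : V} (h : Link G x a b u v) : Link G x b a u v :=
  ⟨h.1, ⟨h.2.1.1, fun h' => (h.2.1.2 h').symm⟩, ⟨h.2.2.1.1, fun h' => (h.2.2.1.2 h').symm⟩,
    fun h' => h.2.2.2 ⟨h'.1.symm, h'.2.symm⟩⟩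

/-- What a call of tip-of-sunflower in find-sun returns. -/
theorem tipOfSunflowerReturns_induce_iff [Finite V] {x a b : V} (hxa : G.Adj x a)
    (hxb : G.Adj x b) (hab : G.Adj a b) (hx : x ∈ keptVertices G x s(a, b)) (t : Bool) :
    TipOfSunflowerReturns (G.induce (keptVertices G x s(a, b))) ⟨x, hx⟩ t ↔
      (t = true ↔ ∃ L, Steps (Link G x a b) L a b) := by
  classical
  set S := keptVertices G x s(a, b) with hS
  have hmem : ∀ v, v ∈ S ↔ (G.Adj x v → v = a ∨ v = b) := fun v => by
    rw [hS, keptVertices, Set.mem_ofPred_eq, Sym2.mem_iff]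
  let a' : S := ⟨a, (hmem a).2 fun _ => .inl rfl⟩
  let b' : S := ⟨b, (hmem b).2 fun _ => .inr rfl⟩
  let x' : S := ⟨x, hx⟩
  have hN : (G.induce S).neighborSet x' = {a', b'} := by
    ext ⟨v, hv⟩
    simp only [SimpleGraph.mem_neighborSet, SimpleGraph.comap_adj, Function.Embedding.subtype_apply,
      Set.mem_insert_iff, Set.mem_singleton_iff, x', a', b', Subtype.mk.injEq]
    exact ⟨(hmem v).1 hv, by rintro (rfl | rfl) <;> assumption⟩
  have hab' : (G.induce S).Adj a' b' := hab
  have hlink : ∀ u v : S, Link (G.induce S) x' a' b' u v ↔ Link G x a b u v := fun u v => by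
    simp only [Link, IsAllowed, IsHub, SimpleGraph.comap_adj, Function.Embedding.subtype_apply,
      Subtype.ext_iff, ne_eq, x', a', b']
  have hsteps : (∃ L, Steps (Link (G.induce S) x' a' b') L a' b') ↔
      ∃ L, Steps (Link G x a b) L a b := by
    constructor
    · rintro ⟨L, hL⟩
      exact ⟨L, hL.map Subtype.val fun u v h => (hlink u v).1 h⟩
    · rintro ⟨L, hL⟩
      have key : ∀ n u w, Steps (Link G x a b) n u w → ∀ hu : u ∈ S,
          ∃ hw : w ∈ S, Steps (Link (G.induce S) x' a' b') n ⟨u, hu⟩ ⟨w, hw⟩ := by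
        intro n u w h
        induction h with
        | refl v => exact fun hv => ⟨hv, .refl _⟩
        | @tail n u v w _ e ih =>
          intro hu
          obtain ⟨hv, hs⟩ := ih hu
          exact ⟨(hmem w).2 e.2.2.1.2, hs.tail ((hlink ⟨v, hv⟩ ⟨w, _⟩).2 e)⟩
      exact ⟨L, (key L a b hL a'.2).2⟩
  rw [← hsteps]
  constructor
  · rintro ⟨k, r, y, z, hy, hz, hmono, ht⟩
    rw [ht, inThreeSun_iff hab' hN hy hz hmono]
  · intro ht
    have enum : ∀ T : Set S, ∃ (k : ℕ) (y : Fin k ↪ S), Set.range y = T := fun T => by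
      obtain ⟨k, ⟨e⟩⟩ := Finite.exists_equiv_fin T
      refine ⟨k, e.symm.toEmbedding.trans (Function.Embedding.subtype _), ?_⟩
      ext v
      exact ⟨by rintro ⟨i, rfl⟩; exact (e.symm i).2, fun hv => ⟨e ⟨v, hv⟩, by simp⟩⟩
    obtain ⟨k, y, hy⟩ := enum {v | v ≠ x' ∧ ¬ (G.induce S).Adj x' v}
    obtain ⟨r, z, hz⟩ := enum ((G.induce S).neighborSet x')
    let c : Fin k → ℕ := fun i =>
      ((G.induce S).neighborSet (y i) ∩ (G.induce S).neighborSet x').ncard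
    have hy' : Set.range ((Tuple.sort c).toEmbedding.trans y) =
        {v | v ≠ x' ∧ ¬ (G.induce S).Adj x' v} := by
      rw [← hy]
      ext v
      exact ⟨fun ⟨i, hi⟩ => ⟨Tuple.sort c i, hi⟩, fun ⟨i, hi⟩ =>
        ⟨(Tuple.sort c).symm i, by simpa using hi⟩⟩
    have hmono : ∀ i j, i < j → c (Tuple.sort c i) ≤ c (Tuple.sort c j) := fun i j hij =>
      Tuple.monotone_sort c hij.le
    exact ⟨k, r, (Tuple.sort c).toEmbedding.trans y, z, hy', hz, hmono, by
      rw [ht, inThreeSun_iff hab' hN hy' hz hmono]⟩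

/-- The answer of find-sun does not depend on the choices made during its execution. -/
theorem findSunReturns_iff [Finite V] (G : SimpleGraph V) (t : Bool) :
    FindSunReturns G t ↔ (t = true ↔ HasLinkedTriangle G) := by
  classical
  have key : ∀ f : V → Sym2 V → Bool, (∀ x a b, G.Adj x a → G.Adj x b → G.Adj a b →
      (f x s(a, b) = true ↔ ∃ L, Steps (Link G x a b) L a b)) →
      ((∃ (x : V) (e : Sym2 V), e ∈ G.edgeSet ∧ (∀ v ∈ e, G.Adj x v) ∧ f x e = true) ↔
        HasLinkedTriangle G) := by
    intro f hf
    constructor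
    · rintro ⟨x, e, he, hx, ht⟩
      induction e with
      | _ a b =>
        have hxa := hx a (Sym2.mem_mk_left a b)
        have hxb := hx b (Sym2.mem_mk_right a b)
        exact ⟨x, a, b, hxa, hxb, he, (hf x a b hxa hxb he).1 ht⟩
    · rintro ⟨x, a, b, hxa, hxb, hab, hL⟩
      refine ⟨x, s(a, b), hab, fun v hv => ?_, (hf x a b hxa hxb hab).2 hL⟩
      rcases Sym2.mem_iff.1 hv with rfl | rfl <;> assumption
  have tip : ∀ f : V → Sym2 V → Bool, (∀ (x : V) (e : Sym2 V), e ∈ G.edgeSet →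
      (∀ v ∈ e, G.Adj x v) → TipOfSunflowerReturns (G.induce (keptVertices G x e))
        ⟨x, fun h => absurd h (G.loopless.irrefl x)⟩ (f x e)) ↔
      ∀ x a b, G.Adj x a → G.Adj x b → G.Adj a b →
        (f x s(a, b) = true ↔ ∃ L, Steps (Link G x a b) L a b) := by
    intro f
    constructor
    · intro h x a b hxa hxb hab
      refine (tipOfSunflowerReturns_induce_iff hxa hxb hab _ _).1 (h x s(a, b) hab fun v hv => ?_)
      rcases Sym2.mem_iff.1 hv with rfl | rfl <;> assumption
    · intro h x e he hx
      induction e with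
      | _ a b =>
        have hxa := hx a (Sym2.mem_mk_left a b)
        have hxb := hx b (Sym2.mem_mk_right a b)
        exact (tipOfSunflowerReturns_induce_iff hxa hxb he _ _).2 (h x a b hxa hxb he)
  constructor
  · rintro ⟨f, hf, ht⟩
    rw [ht, key f ((tip f).1 hf)]
  · intro ht
    -- linking paths from `a` to `b` and from `b` to `a` are the same, reversed
    have hsw : ∀ x a b, (∃ L, Steps (Link G x a b) L a b) → ∃ L, Steps (Link G x b a) L b a := by
      rintro x a b ⟨L, hL⟩
      exact ⟨L, (hL.symm fun u v h => h.symm).map id fun u v h => h.swap⟩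
    let f : V → Sym2 V → Bool := fun x => Sym2.lift
      ⟨fun a b => decide (∃ L, Steps (Link G x a b) L a b), fun a b => by
        simp only [decide_eq_decide]
        exact ⟨hsw x a b, hsw x b a⟩⟩
    have hf : ∀ x a b, G.Adj x a → G.Adj x b → G.Adj a b →
        (f x s(a, b) = true ↔ ∃ L, Steps (Link G x a b) L a b) := fun x a b _ _ _ => by
      simp [f]
    exact ⟨f, (tip f).2 hf, by rw [ht, key f hf]⟩

end FindSun

/-! ### Reasoning about programs -/

namespace Mem

/-- Register `x` receives the value `v`. -/
def setVar (s : Mem) (x v : ℕ) : Mem := { s with var := Function.update s.var x v }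

/-- Position `i` of array `a` receives the value `v`. -/
def setArr (s : Mem) (a i v : ℕ) : Mem :=
  { s with arr := Function.update s.arr a (Function.update (s.arr a) i v) }

@[simp] theorem setVar_arr (s : Mem) (x v : ℕ) : (s.setVar x v).arr = s.arr := rfl

@[simp] theorem setArr_var (s : Mem) (a i v : ℕ) : (s.setArr a i v).var = s.var := rfl

theorem setVar_var (s : Mem) (x v y : ℕ) :
    (s.setVar x v).var y = if y = x then v else s.var y := by
  simp [setVar, Function.update_apply]

theorem setArr_arr (s : Mem) (a i v b : ℕ) :
    (s.setArr a i v).arr b = if b = a then Function.update (s.arr a) i v else s.arr b := by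
  simp [setArr, Function.update_apply]

end Mem

namespace Expr

/-- The value of an expression when words are unbounded. -/
def val (s : Mem) : Expr → ℕ
  | const c => c
  | var x => s.var x
  | get a e => s.arr a (e.val s)
  | add e f => e.val s + f.val s
  | sub e f => e.val s - f.val s
  | mul e f => e.val s * f.val s
  | lt e f => if e.val s < f.val s then 1 else 0
  | eq e f => if e.val s = f.val s then 1 else 0

theorem val_add (s : Mem) (e f : Expr) : (add e f).val s = e.val s + f.val s := rfl

theorem val_lt_le (s : Mem) (e f : Expr) : (lt e f).val s ≤ 1 := by
  rw [val]; split_ifs <;> omega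

theorem val_lt_eq_zero {s : Mem} {e f : Expr} : (lt e f).val s = 0 ↔ ¬ e.val s < f.val s := by
  rw [val]; split_ifs <;> simp_all

/-- No value that occurs in the evaluation of the expression exceeds a word. -/
def Below (W : ℕ) (s : Mem) : Expr → Prop
  | const c => c < W
  | var x => s.var x < W
  | get a e => e.Below W s ∧ s.arr a (e.val s) < W
  | add e f => e.Below W s ∧ f.Below W s ∧ e.val s + f.val s < W
  | sub e f => e.Below W s ∧ f.Below W s
  | mul e f => e.Below W s ∧ f.Below W s ∧ e.val s * f.val s < W
  | lt e f => e.Below W s ∧ f.Below W s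
  | eq e f => e.Below W s ∧ f.Below W s

theorem eval_eq_of_below {W : ℕ} (hW : 1 < W) {s : Mem} {e : Expr} (h : e.Below W s) :
    e.eval W s = some (e.val s) ∧ e.val s < W := by
  induction e with
  | const c => exact ⟨if_pos h, h⟩
  | var x => exact ⟨if_pos h, h⟩
  | get a e ih => simp [eval, val, fits, (ih h.1).1, h.2]
  | add e f ihe ihf => simp [eval, val, fits, (ihe h.1).1, (ihf h.2.1).1, h.2.2]
  | sub e f ihe ihf =>
    have h1 := (ihe h.1).2
    have : e.val s - f.val s < W := by omega
    simp [eval, val, fits, (ihe h.1).1, (ihf h.2).1, this]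
  | mul e f ihe ihf => simp [eval, val, fits, (ihe h.1).1, (ihf h.2.1).1, h.2.2]
  | lt e f ihe ihf =>
    have h0 : 0 < W := by omega
    by_cases hc : e.val s < f.val s <;>
      simp [eval, val, fits, (ihe h.1).1, (ihf h.2).1, hc, hW, h0]
  | eq e f ihe ihf =>
    have h0 : 0 < W := by omega
    by_cases hc : e.val s = f.val s <;>
      simp [eval, val, fits, (ihe h.1).1, (ihf h.2).1, hc, hW, h0]

end Expr

namespace Prog

/-- Whether the program assigns to register `x`. -/
def writesVar (x : ℕ) : Prog → Bool
  | skip => false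
  | assign y _ => x == y
  | store _ _ _ => false
  | seq p q => p.writesVar x || q.writesVar x
  | cond _ p q => p.writesVar x || q.writesVar x
  | loop _ p => p.writesVar x

/-- Whether the program stores into array `a`. -/
def writesArr (a : ℕ) : Prog → Bool
  | skip => false
  | assign _ _ => false
  | store b _ _ => a == b
  | seq p q => p.writesArr a || q.writesArr a
  | cond _ p q => p.writesArr a || q.writesArr a
  | loop _ p => p.writesArr a

/-- The memories `s` and `s'` agree on everything that the program does not write. -/
def Frame (p : Prog) (s s' : Mem) : Prop :=
  (∀ x, p.writesVar x = false → s'.var x = s.var x) ∧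
    ∀ a, p.writesArr a = false → s'.arr a = s.arr a

theorem Frame.trans {p : Prog} {s s' s'' : Mem} (h : p.Frame s s') (h' : p.Frame s' s'') :
    p.Frame s s'' :=
  ⟨fun x hx => (h'.1 x hx).trans (h.1 x hx), fun a ha => (h'.2 a ha).trans (h.2 a ha)⟩

theorem Frame.refl (p : Prog) (s : Mem) : p.Frame s s := ⟨fun _ _ => rfl, fun _ _ => rfl⟩

end Prog

theorem Exec.frame {W : ℕ} {p : Prog} {s s' : Mem} {t : ℕ} (h : Exec W p s s' t) :
    p.Frame s s' := by
  induction h with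
  | skip s => exact .refl _ _
  | assign s x e v hv =>
    refine ⟨fun y hy => Function.update_of_ne ?_ _ _, fun _ _ => rfl⟩
    simpa [Prog.writesVar] using hy
  | store s a i e u v hu hv =>
    refine ⟨fun _ _ => rfl, fun b hb => Function.update_of_ne ?_ _ _⟩
    simpa [Prog.writesArr] using hb
  | seq p q s s' s'' t t' _ _ ihp ihq =>
    simp only [Prog.Frame, Prog.writesVar, Prog.writesArr, Bool.or_eq_false_iff] at *
    exact ⟨fun x hx => (ihq.1 x hx.2).trans (ihp.1 x hx.1),
      fun a ha => (ihq.2 a ha.2).trans (ihp.2 a ha.1)⟩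
  | condTrue e p q s s' v t _ _ _ ih =>
    simp only [Prog.Frame, Prog.writesVar, Prog.writesArr, Bool.or_eq_false_iff] at *
    exact ⟨fun x hx => ih.1 x hx.1, fun a ha => ih.2 a ha.1⟩
  | condFalse e p q s s' t _ _ ih =>
    simp only [Prog.Frame, Prog.writesVar, Prog.writesArr, Bool.or_eq_false_iff] at *
    exact ⟨fun x hx => ih.1 x hx.2, fun a ha => ih.2 a ha.2⟩
  | loopTrue e p s s' s'' v t t' _ _ _ _ ihp ihl =>
    simp only [Prog.Frame, Prog.writesVar, Prog.writesArr] at *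
    exact ⟨fun x hx => (ihl.1 x hx).trans (ihp.1 x hx),
      fun a ha => (ihl.2 a ha).trans (ihp.2 a ha)⟩
  | loopFalse e p s _ => exact ⟨fun _ _ => rfl, fun _ _ => rfl⟩

/-- With word bound `W`, the program `p` started in `s` halts after at most `T` steps in a memory
that satisfies `Q`. -/
def Runs (W : ℕ) (p : Prog) (s : Mem) (T : ℕ) (Q : Mem → Prop) : Prop :=
  ∃ s' t, Exec W p s s' t ∧ t ≤ T ∧ Q s'

namespace Runs

variable {W : ℕ} {p q : Prog} {s : Mem} {T T' : ℕ} {Q R : Mem → Prop}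

theorem mono (h : Runs W p s T Q) (hT : T ≤ T') (hQ : ∀ s', p.Frame s s' → Q s' → R s') :
    Runs W p s T' R := by
  obtain ⟨s', t, he, ht, hq⟩ := h
  exact ⟨s', t, he, ht.trans hT, hQ s' he.frame hq⟩

theorem seq (h : Runs W p s T fun s' => p.Frame s s' → Runs W q s' T' Q) :
    Runs W (.seq p q) s (T + T') Q := by
  obtain ⟨s', t, he, ht, h⟩ := h
  obtain ⟨s'', t', he', ht', hq⟩ := h he.frame
  exact ⟨s'', t + t', .seq _ _ _ _ _ _ _ he he', by omega, hq⟩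

theorem seq_of (h : Runs W p s T R) (h' : ∀ s', p.Frame s s' → R s' → Runs W q s' T' Q) :
    Runs W (.seq p q) s (T + T') Q :=
  seq (h.mono le_rfl fun s' hF hR _ => h' s' hF hR)

theorem skip (hQ : Q s) : Runs W .skip s 1 Q := ⟨s, 1, .skip s, le_rfl, hQ⟩

theorem cond {e : Expr} (hW : 1 < W) (hb : e.Below W s) (h1 : e.val s ≠ 0 → Runs W p s T Q)
    (h2 : e.val s = 0 → Runs W q s T' Q) :
    Runs W (.cond e p q) s (e.cost + 1 + if e.val s ≠ 0 then T else T') Q := by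
  have he := (Expr.eval_eq_of_below hW hb).1
  by_cases h : e.val s = 0
  · obtain ⟨s', t, hx, ht, hq⟩ := h2 h
    exact ⟨s', _, .condFalse _ _ _ _ _ _ (h ▸ he) hx, by simp [h, ht], hq⟩
  · obtain ⟨s', t, hx, ht, hq⟩ := h1 h
    exact ⟨s', _, .condTrue _ _ _ _ _ _ _ he h hx, by simp [h, ht], hq⟩

/-- A loop whose guard holds before the rounds `0, …, N - 1` at most, where `f i` bounds the cost of
round `i`. -/
theorem loop {e : Expr} (hW : 1 < W) (N : ℕ) (f : ℕ → ℕ) (I : ℕ → Mem → Prop) (h0 : I 0 s)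
    (hs : ∀ i s', p.Frame s s' → I i s' → e.Below W s' ∧
      (e.val s' = 0 → Q s') ∧ (e.val s' ≠ 0 → i < N ∧ Runs W p s' (f i) (I (i + 1)))) :
    Runs W (.loop e p) s (∑ i ∈ Finset.range N, (f i + (e.cost + 1)) + (e.cost + 1)) Q := by
  have key : ∀ r i s', i + r = N → p.Frame s s' → I i s' →
      Runs W (.loop e p) s'
        (∑ j ∈ Finset.range r, (f (i + j) + (e.cost + 1)) + (e.cost + 1)) Q := by
    intro r
    induction r with
    | zero =>
      intro i s' hi hF hI
      obtain ⟨h1, h2, h3⟩ := hs i s' hF hI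
      have he := (Expr.eval_eq_of_below hW h1).1
      have h : e.val s' = 0 := by
        by_contra h
        have := (h3 h).1
        omega
      exact ⟨s', _, .loopFalse _ _ _ (h ▸ he), by simp, h2 h⟩
    | succ r ih =>
      intro i s' hi hF hI
      obtain ⟨h1, h2, h3⟩ := hs i s' hF hI
      have he := (Expr.eval_eq_of_below hW h1).1
      by_cases h : e.val s' = 0
      · exact ⟨s', _, .loopFalse _ _ _ (h ▸ he), by simp, h2 h⟩
      · obtain ⟨s1, t1, hx, ht1, hI1⟩ := (h3 h).2
        obtain ⟨s2, t2, hx2, ht2, hQ⟩ := ih (i + 1) s1 (by omega) (hF.trans hx.frame) hI1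
        refine ⟨s2, _, .loopTrue _ _ _ _ _ _ _ _ he h hx hx2, ?_, hQ⟩
        rw [Finset.sum_range_succ']
        have : ∑ j ∈ Finset.range r, (f (i + (j + 1)) + (e.cost + 1)) =
            ∑ j ∈ Finset.range r, (f (i + 1 + j) + (e.cost + 1)) :=
          Finset.sum_congr rfl fun j _ => by rw [show i + (j + 1) = i + 1 + j by omega]
        rw [this]
        simp only [Nat.add_zero]
        omega
  simpa using key N 0 s (by omega) (.refl _ _) h0

/-- A loop with a uniform bound for the cost of a round. -/
theorem loop_const {e : Expr} (hW : 1 < W) (N c : ℕ) (I : ℕ → Mem → Prop) (h0 : I 0 s)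
    (hs : ∀ i s', p.Frame s s' → I i s' → e.Below W s' ∧
      (e.val s' = 0 → Q s') ∧ (e.val s' ≠ 0 → i < N ∧ Runs W p s' c (I (i + 1)))) :
    Runs W (.loop e p) s (N * (c + (e.cost + 1)) + (e.cost + 1)) Q := by
  simpa using loop hW N (fun _ => c) I h0 hs

end Runs

/-! ### Programs without loops -/

namespace Prog

/-- The weakest condition on the initial memory under which a program without loops halts in a
memory that satisfies `Q` and no value that occurs exceeds a word. -/
def wp (W : ℕ) : Prog → Mem → (Mem → Prop) → Prop
  | skip, s, Q => Q s
  | assign x e, s, Q => e.Below W s ∧ Q (s.setVar x (e.val s))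
  | store a i e, s, Q => i.Below W s ∧ e.Below W s ∧ Q (s.setArr a (i.val s) (e.val s))
  | seq p q, s, Q => p.wp W s fun s' => q.wp W s' Q
  | cond e p q, s, Q => e.Below W s ∧ (e.val s ≠ 0 → p.wp W s Q) ∧ (e.val s = 0 → q.wp W s Q)
  | loop _ _, _, _ => False

/-- A bound for the number of steps of a program without loops. The value at a loop is irrelevant, as
`wp` is false there. -/
def cost : Prog → ℕ
  | skip => 1
  | assign _ e => e.cost + 1
  | store _ i e => i.cost + e.cost + 1
  | seq p q => p.cost + q.cost
  | cond e p q => e.cost + 1 + max p.cost q.cost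
  | loop _ _ => 0

end Prog

theorem Runs.of_wp {W : ℕ} (hW : 1 < W) {p : Prog} {s : Mem} {Q : Mem → Prop}
    (h : p.wp W s Q) : Runs W p s p.cost Q := by
  induction p generalizing s Q with
  | skip => exact ⟨s, 1, .skip s, le_rfl, h⟩
  | assign x e =>
    exact ⟨_, _, .assign s x e _ (Expr.eval_eq_of_below hW h.1).1, le_rfl, h.2⟩
  | store a i e =>
    exact ⟨_, _, .store s a i e _ _ (Expr.eval_eq_of_below hW h.1).1
      (Expr.eval_eq_of_below hW h.2.1).1, le_rfl, h.2.2⟩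
  | seq p q ihp ihq => exact Runs.seq ((ihp h).mono le_rfl fun s' _ h' _ => ihq h')
  | cond e p q ihp ihq =>
    refine (Runs.cond hW h.1 (fun h1 => ihp (h.2.1 h1)) (fun h1 => ihq (h.2.2 h1))).mono ?_
      fun _ _ h => h
    simp only [Prog.cost]
    split_ifs <;> omega
  | loop e p => exact h.elim

/-! ### Breadth-first search -/

/-- The state of a breadth-first search along `R` on the vertices below `n`, started at `a`: `D v`
is `0` if `v` has not been reached and one more than its distance from `a` otherwise, `P v` is the
predecessor of `v`, the vertices reached are `Q 0, …, Q (tl - 1)`, those before position `hd` have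
been processed, and for the one at position `hd` the vertices below `v₀` have been tested. -/
structure BfsInv (n a : ℕ) (R : ℕ → ℕ → Prop) (D P Q : ℕ → ℕ) (tl hd v₀ : ℕ) : Prop where
  start : D a = 1
  hd_le : hd ≤ tl
  queue : ∀ i < tl, Q i < n ∧ D (Q i) ≠ 0 ∧ D (Q i) ≤ i + 1
  inj : ∀ i j, i < j → j < tl → Q i ≠ Q j
  mem : ∀ v < n, D v ≠ 0 → ∃ i < tl, Q i = v
  mono : ∀ i j, i ≤ j → j < tl → D (Q i) ≤ D (Q j)
  near : hd < tl → ∀ v < n, D v ≤ D (Q hd) + 1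
  done : ∀ i < hd, ∀ v < n, R (Q i) v → D v ≠ 0 ∧ D v ≤ D (Q i) + 1
  cur : hd < tl → ∀ v < n, v < v₀ → R (Q hd) v → D v ≠ 0 ∧ D v ≤ D (Q hd) + 1
  par : ∀ v < n, D v ≠ 0 → P v < n ∧
    (v = a ∨ v ≠ a ∧ D (P v) ≠ 0 ∧ D v = D (P v) + 1 ∧ R (P v) v)

namespace BfsInv

variable {n a : ℕ} {R : ℕ → ℕ → Prop} {D P Q : ℕ → ℕ} {tl hd v : ℕ}

theorem tl_le (h : BfsInv n a R D P Q tl hd v) : tl ≤ n := by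
  have := Finset.card_le_card_of_injOn (s := Finset.range tl) (t := Finset.range n) Q
    (fun i hi => by simpa using (h.queue i (by simpa using hi)).1)
    (fun i hi j hj hij => by
      simp only [Finset.coe_range, Set.mem_Iio] at hi hj
      rcases lt_trichotomy i j with h' | h' | h'
      · exact absurd hij (h.inj i j h' hj)
      · exact h'
      · exact absurd hij.symm (h.inj j i h' hi))
  simpa using this

theorem dist_le (h : BfsInv n a R D P Q tl hd v) {u : ℕ} (hu : u < n) : D u ≤ n := by
  by_cases h0 : D u = 0
  · omega
  · obtain ⟨i, hi, rfl⟩ := h.mem u hu h0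
    have := (h.queue i hi).2.2
    have := h.tl_le
    omega

theorem init (ha : a < n) (hD : ∀ v < n, D v = if v = a then 1 else 0) (hQ : Q 0 = a)
    (hP : P a = a) : BfsInv n a R D P Q 1 0 0 where
  start := by simp [hD a ha]
  hd_le := by omega
  queue i hi := by
    obtain rfl : i = 0 := by omega
    simp [hQ, hD a ha, ha]
  inj i j hij hj := by omega
  mem v hv h := ⟨0, by omega, by
    rw [hD v hv] at h
    simp only [ne_eq, ite_eq_right_iff, Classical.not_imp] at h
    rw [hQ, h.1]⟩
  mono i j hij hj := by
    obtain rfl : i = j := by omega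
    exact le_rfl
  near _ v hv := by
    rw [hQ, hD v hv, hD a ha]
    split_ifs <;> omega
  done i hi := by omega
  cur _ v _ hv := by omega
  par v hv h := by
    rw [hD v hv] at h
    simp only [ne_eq, ite_eq_right_iff, Classical.not_imp] at h
    rw [h.1, hP]
    exact ⟨ha, .inl rfl⟩

/-- A vertex that has been reached already or is not related to the current one is skipped. -/
theorem skip (h : BfsInv n a R D P Q tl hd v) (h' : D v ≠ 0 ∨ ¬ R (Q hd) v) :
    BfsInv n a R D P Q tl hd (v + 1) where
  __ := h
  cur hd' u hu huv hR := by
    rcases Nat.lt_succ_iff_lt_or_eq.1 huv with h1 | rfl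
    · exact h.cur hd' u hu h1 hR
    · rcases h' with h' | h'
      · exact ⟨h', h.near hd' u hu⟩
      · exact absurd hR h'

/-- A new vertex related to the current one is appended to the queue. -/
theorem push (h : BfsInv n a R D P Q tl hd v) (hhd : hd < tl) (hv : v < n) (h0 : D v = 0)
    (hR : R (Q hd) v) :
    BfsInv n a R (Function.update D v (D (Q hd) + 1)) (Function.update P v (Q hd))
      (Function.update Q tl v) (tl + 1) hd (v + 1) := by
  have hva : v ≠ a := fun h' => by
    have := h.start
    rw [← h', h0] at this
    omega
  have hQv : ∀ i < tl, Q i ≠ v := fun i hi h' => (h.queue i hi).2.1 (h' ▸ h0)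
  have eQ : ∀ i < tl, Function.update Q tl v i = Q i := fun i hi =>
    Function.update_of_ne hi.ne _ _
  have eD : ∀ u, u ≠ v → Function.update D v (D (Q hd) + 1) u = D u := fun u hu =>
    Function.update_of_ne hu _ _
  have eDQ : ∀ i < tl, Function.update D v (D (Q hd) + 1) (Q i) = D (Q i) := fun i hi =>
    eD _ (hQv i hi)
  have le' : ∀ u < n, Function.update D v (D (Q hd) + 1) u ≤ D (Q hd) + 1 := fun u hu => by
    by_cases huv : u = v
    · simp [huv]
    · rw [eD u huv]; exact h.near hhd u hu
  refine ⟨?_, ?_, ?_, ?_, ?_, ?_, ?_, ?_, ?_, ?_⟩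
  · rw [eD a hva.symm]; exact h.start
  · have := h.hd_le; omega
  · intro i hi
    rcases Nat.lt_succ_iff_lt_or_eq.1 hi with h1 | rfl
    · rw [eQ i h1, eDQ i h1]; exact h.queue i h1
    · simp only [Function.update_self]
      have := (h.queue hd hhd).2.2
      exact ⟨hv, by omega, by omega⟩
  · intro i j hij hj
    rw [eQ i (by omega)]
    rcases Nat.lt_succ_iff_lt_or_eq.1 hj with h1 | rfl
    · rw [eQ j h1]; exact h.inj i j hij h1
    · rw [Function.update_self]; exact hQv i hij
  · intro u hu hDu
    by_cases huv : u = v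
    · exact ⟨tl, by omega, by simp [huv]⟩
    · rw [eD u huv] at hDu
      obtain ⟨i, hi, h1⟩ := h.mem u hu hDu
      exact ⟨i, by omega, by rw [eQ i hi, h1]⟩
  · intro i j hij hj
    rcases Nat.lt_succ_iff_lt_or_eq.1 hj with h1 | rfl
    · rw [eQ j h1, eQ i (by omega), eDQ j h1, eDQ i (by omega)]; exact h.mono i j hij h1
    · simp only [Function.update_self]
      rcases hij.lt_or_eq with h1 | rfl
      · rw [eQ i h1]; exact le' _ (h.queue i h1).1
      · simp
  · intro _ u hu
    rw [eQ hd hhd, eDQ hd hhd]; exact le' u hu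
  · intro i hi u hu hRu
    have hit : i < tl := by omega
    rw [eQ i hit] at hRu
    rw [eQ i hit, eDQ i hit]
    have := h.done i hi u hu hRu
    rw [eD u fun h' => this.1 (h' ▸ h0)]
    exact this
  · intro _ u hu huv hRu
    rw [eQ hd hhd] at hRu
    rw [eQ hd hhd, eDQ hd hhd]
    refine ⟨?_, le' u hu⟩
    rcases Nat.lt_succ_iff_lt_or_eq.1 huv with h1 | rfl
    · rw [eD u h1.ne]; exact (h.cur hhd u hu h1 hRu).1
    · simp
  · intro u hu hDu
    by_cases huv : u = v
    · subst huv
      simp only [Function.update_self]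
      rw [eDQ hd hhd]
      exact ⟨(h.queue hd hhd).1, .inr ⟨hva, (h.queue hd hhd).2.1, rfl, hR⟩⟩
    · rw [eD u huv] at hDu ⊢
      rw [Function.update_of_ne huv]
      refine ⟨(h.par u hu hDu).1, ?_⟩
      rcases (h.par u hu hDu).2 with h1 | ⟨h0', h1, h2, h3⟩
      · exact .inl h1
      · refine .inr ⟨h0', ?_⟩
        rw [eD (P u) fun h' => h1 (h' ▸ h0)]
        exact ⟨h1, h2, h3⟩

/-- After all vertices have been tested, the next vertex of the queue becomes the current one. -/
theorem next (h : BfsInv n a R D P Q tl hd n) (hhd : hd < tl) :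
    BfsInv n a R D P Q tl (hd + 1) 0 where
  __ := h
  hd_le := hhd
  near h' v hv := (h.near hhd v hv).trans
    (Nat.add_le_add_right (h.mono hd (hd + 1) (by omega) h') 1)
  done i hi u hu hR := by
    rcases Nat.lt_succ_iff_lt_or_eq.1 hi with h1 | rfl
    · exact h.done i h1 u hu hR
    · exact h.cur hhd u hu hu hR
  cur _ v _ hv := by omega

/-- A finished search has reached every vertex by a shortest walk. -/
theorem reached (h : BfsInv n a R D P Q tl hd v) (hhd : ¬ hd < tl) (ha : a < n)
    (hR : ∀ u v, R u v → v < n) {L u w : ℕ} (hs : Steps R L u w) (hu : u = a) :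
    w < n ∧ D w ≠ 0 ∧ D w ≤ L + 1 := by
  induction hs with
  | refl v => subst hu; exact ⟨ha, by simp [h.start], by simp [h.start]⟩
  | @tail L u v w _ e ih =>
    obtain ⟨h1, h2, h3⟩ := ih hu
    obtain ⟨i, hi, rfl⟩ := h.mem v h1 h2
    have hw := hR _ _ e
    have := h.done i (by omega) w hw e
    exact ⟨hw, this.1, by omega⟩

/-- Following the predecessors from a vertex that has been reached leads back to the start. -/
theorem walk (h : BfsInv n a R D P Q tl hd v) {b : ℕ} (hb : b < n) (hDb : D b ≠ 0) {w : ℕ → ℕ}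
    (h0 : w 0 = b) (hw : ∀ t, t + 1 < D b → w (t + 1) = P (w t)) :
    (∀ t < D b, w t < n ∧ D (w t) = D b - t) ∧ (∀ t, t + 1 < D b → R (w (t + 1)) (w t)) ∧
      w (D b - 1) = a := by
  have key : ∀ t < D b, w t < n ∧ D (w t) = D b - t := by
    intro t
    induction t with
    | zero => intro _; rw [h0]; exact ⟨hb, rfl⟩
    | succ t ih =>
      intro ht
      obtain ⟨h1, h2⟩ := ih (by omega)
      obtain ⟨h3, h4⟩ := h.par (w t) h1 (by omega)
      rw [hw t ht]
      refine ⟨h3, ?_⟩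
      rcases h4 with h4 | ⟨-, -, h5, -⟩
      · rw [h4, h.start] at h2; omega
      · omega
  refine ⟨key, fun t ht => ?_, ?_⟩
  · obtain ⟨h1, h2⟩ := key t (by omega)
    rw [hw t ht]
    rcases (h.par (w t) h1 (by omega)).2 with h4 | ⟨-, -, -, h5⟩
    · rw [h4, h.start] at h2; omega
    · exact h5
  · obtain ⟨h1, h2⟩ := key (D b - 1) (by omega)
    rcases (h.par _ h1 (by omega)).2 with h4 | ⟨-, h5, h6, -⟩
    · exact h4
    · omega

end BfsInv

/-! ### The search for a linking path -/

/-- The entry of the adjacency matrix at the vertices held by two registers. -/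
def adjE (u v : ℕ) : Expr := .get 0 (.add (.mul (.var u) (.var 0)) (.var v))

/-! Register `rN` holds the number of vertices and, in the end, the answer. The triangle under
consideration is `rX`, `rA`, `rB`. The queue of the search is the array `aQueue` between the
positions `rHead` and `rTail`, `rU` is its current vertex and `rV` the vertex that is tested;
`aDist`, `aPred` and `aKind` hold the distances increased by one, the predecessors and the roles of
the vertices. The best path so far has `rBest` vertices, held by `aPath`, and belongs to a triangle
with the tip `rTip`. The tips and clique vertices of a sun go to `aTip` and `aClique`, and `rI` and
`rW` are scratch. -/

local notation "rN" => (0 : ℕ)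
local notation "rA" => (1 : ℕ)
local notation "rB" => (2 : ℕ)
local notation "rX" => (3 : ℕ)
local notation "rV" => (4 : ℕ)
local notation "rHead" => (5 : ℕ)
local notation "rTail" => (6 : ℕ)
local notation "rU" => (7 : ℕ)
local notation "rBest" => (8 : ℕ)
local notation "rTip" => (9 : ℕ)
local notation "rI" => (10 : ℕ)
local notation "rW" => (11 : ℕ)
local notation "aTip" => (1 : ℕ)
local notation "aClique" => (2 : ℕ)
local notation "aQueue" => (3 : ℕ)
local notation "aDist" => (4 : ℕ)
local notation "aPred" => (5 : ℕ)
local notation "aKind" => (6 : ℕ)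
local notation "aPath" => (7 : ℕ)

/-- Appends the vertex `rV` to the queue if it is reached from the vertex `rU` for the first time,
and moves on to the next vertex. -/
def searchStep : Prog :=
  .seq
    (.cond (.eq (.get aDist (.var rV)) (.const 0))
      (.cond (adjE rU rV)
        (.cond (.lt (.const 0) (.mul (.get aKind (.var rU)) (.get aKind (.var rV))))
          (.cond (.lt (.mul (.get aKind (.var rU)) (.get aKind (.var rV))) (.const 4))
            (.seq (.store aDist (.var rV) (.add (.get aDist (.var rU)) (.const 1)))
              (.seq (.store aPred (.var rV) (.var rU))
                (.seq (.store aQueue (.var rTail) (.var rV))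
                  (.assign rTail (.add (.var rTail) (.const 1))))))
            .skip)
          .skip)
        .skip)
      .skip)
    (.assign rV (.add (.var rV) (.const 1)))

theorem index_lt {n u v : ℕ} (hu : u < n) (hv : v < n) : u * n + v < n * n := by
  calc u * n + v < u * n + n := by omega
    _ = (u + 1) * n := by ring
    _ ≤ n * n := Nat.mul_le_mul_right n hu

/-- A step of the search needs a proof for two outcomes only: the vertex `v` is pushed, or nothing
is done. The matrix entries are at most `1` and the kinds at most `2`, so all values fit into words.
-/
theorem searchStep_spec {W n u v : ℕ} (hW : n * n + 4 * n + 16 ≤ W) {s : Mem} (hn : s.var rN = n)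
    (hu : s.var rU = u) (hv : s.var rV = v) (hun : u < n) (hvn : v < n) (ht : s.var rTail ≤ n)
    (hA : ∀ p, s.arr 0 p ≤ 1) (hKu : s.arr aKind u ≤ 2) (hKv : s.arr aKind v ≤ 2)
    (hDu : s.arr aDist u ≤ n) (hDv : s.arr aDist v ≤ n) {Q : Mem → Prop}
    (hpush : s.arr aDist v = 0 → s.arr 0 (u * n + v) ≠ 0 → s.arr aKind u * s.arr aKind v ≠ 0 →
        s.arr aKind u * s.arr aKind v < 4 →
      Q (((((s.setArr aDist v (s.arr aDist u + 1)).setArr aPred v u).setArr aQueue (s.var rTail)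
          v).setVar rTail (s.var rTail + 1)).setVar rV (v + 1)))
    (hskip : s.arr aDist v ≠ 0 ∨ ¬ (s.arr 0 (u * n + v) ≠ 0 ∧ s.arr aKind u * s.arr aKind v ≠ 0 ∧
        s.arr aKind u * s.arr aKind v < 4) → Q (s.setVar rV (v + 1))) :
    searchStep.wp W s Q := by
  have h1 := index_lt hun hvn
  have h2 : s.arr aKind u * s.arr aKind v ≤ 4 := Nat.mul_le_mul hKu hKv
  have h3 := hA (u * n + v)
  have b1 : u < W := by omega
  have b2 : v < W := by omega
  have b3 : n < W := by omega
  have b4 : u * n + v < W := by omega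
  have b5 : u * n < W := by omega
  have b6 : s.arr 0 (u * n + v) < W := by omega
  have b7 : s.arr aKind u * s.arr aKind v < W := by omega
  have b8 : s.arr aDist u < W ∧ s.arr aDist u + 1 < W ∧ s.arr aDist v < W ∧ v + 1 < W ∧
    s.arr aKind u < W ∧ s.arr aKind v < W ∧ s.var rTail < W ∧ s.var rTail + 1 < W ∧ 0 < W ∧
    1 < W ∧ 4 < W := by omega
  simp only [searchStep, adjE, Prog.wp, Expr.Below, Expr.val, hn, hu, hv, Mem.setVar_var,
    Mem.setArr_var, b1, b2, b3, b4, b5, b6, b7, b8, Nat.reduceEqDiff, if_false, true_and, and_true,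
    ite_eq_right_iff, one_ne_zero, imp_false, not_not, ne_eq]
  refine ⟨fun c1 => ⟨fun c2 => ⟨fun c3 => ⟨fun c4 => hpush c1 c2 c3.ne' c4, ?_⟩, ?_⟩, ?_⟩, ?_⟩
  · exact fun c4 => hskip (.inr fun h => c4 h.2.2)
  · exact fun c3 => hskip (.inr fun h => c3 (Nat.pos_of_ne_zero h.2.1))
  · exact fun c2 => hskip (.inr fun h => h.1 c2)
  · exact fun c1 => hskip (.inl c1)

section Search

variable {n : ℕ} {G : SimpleGraph (Fin n)} {a b x : Fin n} {W : ℕ} {s : Mem}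

open Classical in
theorem inputMem_arr_zero (u v : Fin n) :
    (inputMem G).arr 0 (u * n + v) = if G.Adj u v then 1 else 0 := by
  have h : (∃ i j : Fin n, G.Adj i j ∧ u.val * n + v.val = i.val * n + j.val) ↔ G.Adj u v := by
    constructor
    · rintro ⟨i, j, hij, h⟩
      have hn : 0 < n := u.pos
      have h1 := congrArg (· / n) h
      have h2 := congrArg (· % n) h
      simp only [Nat.mul_comm _ n, Nat.mul_add_div hn, Nat.mul_add_mod,
        Nat.div_eq_of_lt v.isLt, Nat.div_eq_of_lt j.isLt, Nat.mod_eq_of_lt v.isLt,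
        Nat.mod_eq_of_lt j.isLt, Nat.add_zero] at h1 h2
      rwa [Fin.ext h1, Fin.ext h2]
    · exact fun h => ⟨u, v, h, rfl⟩
  simp only [inputMem, true_and, h]

theorem inputMem_arr_le (p : ℕ) : (inputMem G).arr 0 p ≤ 1 := by
  simp only [inputMem]
  split_ifs <;> omega

/-- Register `0` holds `n` and array `0` holds the adjacency matrix. -/
def HoldsInput (G : SimpleGraph (Fin n)) (s : Mem) : Prop :=
  s.var rN = n ∧ s.arr 0 = (inputMem G).arr 0

theorem HoldsInput.frame {p : Prog} {s' : Mem} (h : HoldsInput G s) (hF : p.Frame s s')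
    (h1 : p.writesVar rN = false) (h2 : p.writesArr 0 = false) : HoldsInput G s' :=
  ⟨(hF.1 _ h1).trans h.1, (hF.2 _ h2).trans h.2⟩

theorem HoldsInput.adj_ne_zero (h : HoldsInput G s) (u v : Fin n) :
    s.arr 0 (u * n + v) ≠ 0 ↔ G.Adj u v := by
  rw [h.2, inputMem_arr_zero]
  split_ifs <;> simp_all

theorem HoldsInput.arr_le (h : HoldsInput G s) (p : ℕ) : s.arr 0 p ≤ 1 := by
  rw [h.2]; exact inputMem_arr_le p

/-- The registers and the matrix on which the search for the triangle `x, a, b` is based. -/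
def HoldsTriangle (G : SimpleGraph (Fin n)) (x a b : Fin n) (s : Mem) : Prop :=
  HoldsInput G s ∧ s.var rA = a ∧ s.var rB = b ∧ s.var rX = x

theorem HoldsTriangle.frame {p : Prog} {s' : Mem} (h : HoldsTriangle G x a b s)
    (hF : p.Frame s s') (h1 : p.writesVar rN = false) (h2 : p.writesArr 0 = false)
    (h3 : p.writesVar rA = false) (h4 : p.writesVar rB = false) (h5 : p.writesVar rX = false) :
    HoldsTriangle G x a b s' :=
  ⟨h.1.frame hF h1 h2, (hF.1 _ h3).trans h.2.1, (hF.1 _ h4).trans h.2.2.1,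
    (hF.1 _ h5).trans h.2.2.2⟩

open Classical in
/-- The role of a vertex in the search: `0` if it is deleted, `2` if it is a hub, `1` otherwise.
With this encoding two adjacent vertices are linked if and only if the product of their roles is
between `1` and `3`. -/
noncomputable def kind (G : SimpleGraph (Fin n)) (x a b v : Fin n) : ℕ :=
  if IsAllowed G x a b v then if IsHub G a b v then 2 else 1 else 0

theorem kind_le (v : Fin n) : kind G x a b v ≤ 2 := by
  unfold kind; split_ifs <;> omega

theorem link_iff_kind {u v : Fin n} : Link G x a b u v ↔
    G.Adj u v ∧ kind G x a b u * kind G x a b v ≠ 0 ∧ kind G x a b u * kind G x a b v < 4 := by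
  unfold Link kind
  by_cases h1 : IsAllowed G x a b u <;> by_cases h2 : IsAllowed G x a b v <;>
    by_cases h3 : IsHub G a b u <;> by_cases h4 : IsHub G a b v <;> simp [h1, h2, h3, h4]

/-- Forgets the vertex `rV`, determines its kind and moves on to the next vertex. -/
def kindStep : Prog :=
  .seq (.store aDist (.var rV) (.const 0))
    (.seq
      (.cond (.eq (.var rV) (.var rX)) (.store aKind (.var rV) (.const 0))
        (.cond (.eq (.var rV) (.var rA)) (.store aKind (.var rV) (.const 2))
          (.cond (.eq (.var rV) (.var rB)) (.store aKind (.var rV) (.const 2))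
            (.cond (adjE rX rV) (.store aKind (.var rV) (.const 0))
              (.cond (adjE rA rV)
                (.cond (adjE rB rV) (.store aKind (.var rV) (.const 2))
                  (.store aKind (.var rV) (.const 1)))
                (.store aKind (.var rV) (.const 1)))))))
      (.assign rV (.add (.var rV) (.const 1))))

theorem kindStep_wp (hW : n * n + 4 * n + 16 ≤ W) (hs : HoldsTriangle G x a b s)
    (hxa : G.Adj x a) (hxb : G.Adj x b) (hab : G.Adj a b) (v : Fin n) (hv : s.var rV = v)
    {Q : Mem → Prop}
    (hQ : Q (((s.setArr aDist v 0).setArr aKind v (kind G x a b v)).setVar rV (v + 1))) :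
    kindStep.wp W s Q := by
  obtain ⟨hI, hsa, hsb, hsx⟩ := hs
  have hn := hI.1
  have adj : ∀ u : Fin n, (s.arr 0 (u * n + v) = 0 ↔ ¬ G.Adj u v) := fun u => by
    rw [← hI.adj_ne_zero, not_not]
  have bd : ∀ u : Fin n, u.val * n < W ∧ u.val * n + v < W ∧ s.arr 0 (u * n + v) < W ∧
      u.val < W := fun u => by
    have h1 := index_lt u.isLt v.isLt
    have h2 := hI.arr_le (u * n + v)
    have h3 := u.isLt
    omega
  have b1 : n < W ∧ v.val + 1 < W ∧ 0 < W ∧ 1 < W ∧ 2 < W := by have := v.isLt; omega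
  simp only [kindStep, adjE, Prog.wp, Expr.Below, Expr.val, hn, hsa, hsb, hsx, hv,
    Mem.setArr_var, Mem.setArr_arr, bd, b1, if_false, true_and, and_true,
    ite_eq_right_iff, one_ne_zero, imp_false, not_not, ne_eq, OfNat.zero_ne_ofNat, adj,
    ← Fin.ext_iff]
  -- in each branch the value that is stored is the kind of the vertex
  have key : ∀ c, kind G x a b v = c →
      Q (((s.setArr aDist v 0).setArr aKind v c).setVar rV (v + 1)) := fun c hc => hc ▸ hQ
  refine ⟨fun h1 => key _ ?_, fun h1 => ⟨fun h2 => key _ ?_, fun h2 => ⟨fun h3 => key _ ?_,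
    fun h3 => ⟨fun h4 => key _ ?_, fun h4 => ⟨fun h5 => ⟨fun h6 => key _ ?_, fun h6 => key _ ?_⟩,
      fun h5 => key _ ?_⟩⟩⟩⟩⟩
  · simp [kind, IsAllowed, h1]
  · subst h2; simp [kind, IsAllowed, isHub_left hab, h1]
  · subst h3; simp [kind, IsAllowed, isHub_right hab, h1]
  · simp [kind, IsAllowed, h2, h3, h4]
  · simp [kind, IsAllowed, IsHub, h1, h4, h5, h6]
  · simp [kind, IsAllowed, IsHub, h1, h3, h4, h6]
  · simp [kind, IsAllowed, IsHub, h1, h2, h4, h5]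

/-- The relation `Link` on the numbers that represent the vertices. -/
def NatLink (G : SimpleGraph (Fin n)) (x a b : Fin n) (u v : ℕ) : Prop :=
  ∃ i j : Fin n, i.val = u ∧ j.val = v ∧ Link G x a b i j

/-- Breadth-first search along the linking edges of the triangle `x, a, b`, from `a`. -/
def search : Prog :=
  .seq (.assign rV (.const 0))
    (.seq (.loop (.lt (.var rV) (.var rN)) kindStep)
      (.seq
        (.seq (.store aDist (.var rA) (.const 1))
          (.seq (.store aQueue (.const 0) (.var rA))
            (.seq (.store aPred (.var rA) (.var rA))
              (.seq (.assign rHead (.const 0)) (.assign rTail (.const 1))))))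
        (.loop (.lt (.var rHead) (.var rTail))
          (.seq (.seq (.assign rU (.get aQueue (.var rHead))) (.assign rV (.const 0)))
            (.seq (.loop (.lt (.var rV) (.var rN)) searchStep)
              (.assign rHead (.add (.var rHead) (.const 1))))))))

theorem kindLoop_runs (hW : n * n + 4 * n + 16 ≤ W) (hs : HoldsTriangle G x a b s)
    (hxa : G.Adj x a) (hxb : G.Adj x b) (hab : G.Adj a b) (hv : s.var rV = 0) :
    Runs W (.loop (.lt (.var rV) (.var rN)) kindStep) s (n * 100 + 4) fun s' =>
      (∀ v < n, s'.arr aDist v = 0) ∧ ∀ v : Fin n, s'.arr aKind v = kind G x a b v := by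
  refine (Runs.loop_const (by omega) n kindStep.cost
    (fun i s' => s'.var rV = i ∧ i ≤ n ∧ (∀ v < i, s'.arr aDist v = 0) ∧
      ∀ v : Fin n, v.val < i → s'.arr aKind v = kind G x a b v) ?_ ?_).mono
    ?_ fun _ _ h => h
  · exact ⟨hv, Nat.zero_le _, fun v h => by omega, fun v h => by omega⟩
  · rintro i s' hF ⟨h1, h2, h3, h4⟩
    have hs' := hs.frame hF rfl rfl rfl rfl rfl
    have hn : s'.var rN = n := hs'.1.1
    refine ⟨?_, ?_, ?_⟩
    · simp only [Expr.Below, h1, hn]; omega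
    · intro h
      simp only [Expr.val, h1, hn, ite_eq_right_iff, one_ne_zero, imp_false, not_lt] at h
      obtain rfl : i = n := by omega
      exact ⟨h3, fun v => h4 v v.isLt⟩
    · intro h
      simp only [Expr.val, h1, hn, ne_eq, ite_eq_right_iff, one_ne_zero, imp_false, not_not] at h
      refine ⟨h, Runs.of_wp (by omega) (kindStep_wp hW hs' hxa hxb hab ⟨i, h⟩ h1 ?_)⟩
      refine ⟨by simp [Mem.setVar_var], h, fun v hv => ?_, fun v hv => ?_⟩
      · simp only [Mem.setVar_arr, Mem.setArr_arr, Nat.reduceEqDiff, if_false, if_true,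
          Function.update_apply]
        split_ifs with hvi
        · rfl
        · exact h3 v (by omega)
      · simp only [Mem.setVar_arr, Mem.setArr_arr, Nat.reduceEqDiff, if_false, if_true,
          Function.update_apply]
        split_ifs with hvi
        · congr 1; exact (Fin.ext hvi).symm
        · exact h4 v (by omega)
  · have : kindStep.cost ≤ 90 := by decide
    simp only [Expr.cost]
    nlinarith

theorem searchLoop_runs (hW : n * n + 4 * n + 16 ≤ W) (hs : HoldsTriangle G x a b s)
    (hK : ∀ v : Fin n, s.arr aKind v = kind G x a b v) {hd : ℕ} (hv : s.var rV = 0)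
    (hu : s.var rU = s.arr aQueue hd) (hhd : hd < s.var rTail)
    (hb : BfsInv n a (NatLink G x a b) (s.arr aDist) (s.arr aPred) (s.arr aQueue) (s.var rTail)
      hd 0) :
    Runs W (.loop (.lt (.var rV) (.var rN)) searchStep) s (n * 100 + 4) fun s' =>
      hd < s'.var rTail ∧ BfsInv n a (NatLink G x a b) (s'.arr aDist) (s'.arr aPred)
        (s'.arr aQueue) (s'.var rTail) hd n := by
  refine (Runs.loop_const (by omega) n searchStep.cost
    (fun i s' => s'.var rV = i ∧ i ≤ n ∧ s'.var rU = s'.arr aQueue hd ∧ hd < s'.var rTail ∧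
      BfsInv n a (NatLink G x a b) (s'.arr aDist) (s'.arr aPred) (s'.arr aQueue) (s'.var rTail)
        hd i) ?_ ?_).mono ?_ fun _ _ h => h
  · exact ⟨hv, Nat.zero_le _, hu, hhd, hb⟩
  · rintro i s' hF ⟨h1, h2, h3, h4, h5⟩
    have hs' := hs.frame hF rfl rfl rfl rfl rfl
    have hn : s'.var rN = n := hs'.1.1
    have hK' : ∀ v : Fin n, s'.arr aKind v = kind G x a b v := fun v => by
      rw [hF.2 aKind rfl]; exact hK v
    refine ⟨?_, ?_, ?_⟩
    · simp only [Expr.Below, h1, hn]; omega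
    · intro h
      simp only [Expr.val, h1, hn, ite_eq_right_iff, one_ne_zero, imp_false, not_lt] at h
      obtain rfl : i = n := by omega
      exact ⟨h4, h5⟩
    · intro h
      simp only [Expr.val, h1, hn, ne_eq, ite_eq_right_iff, one_ne_zero, imp_false, not_not] at h
      obtain ⟨u, hu⟩ : ∃ u : Fin n, u.val = s'.arr aQueue hd :=
        ⟨⟨s'.arr aQueue hd, (h5.queue hd h4).1⟩, rfl⟩
      obtain ⟨v, rfl⟩ : ∃ v : Fin n, v.val = i := ⟨⟨i, h⟩, rfl⟩
      have hlink : NatLink G x a b (s'.arr aQueue hd) v ↔ s'.arr 0 (u * n + v) ≠ 0 ∧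
          s'.arr aKind u * s'.arr aKind v ≠ 0 ∧ s'.arr aKind u * s'.arr aKind v < 4 := by
        rw [hs'.1.adj_ne_zero, hK', hK', ← link_iff_kind, ← hu]
        exact ⟨fun ⟨i, j, hi, hj, hl⟩ => Fin.ext hi ▸ Fin.ext hj ▸ hl,
          fun hl => ⟨u, v, rfl, rfl, hl⟩⟩
      refine ⟨h, Runs.of_wp (by omega) (searchStep_spec hW hn (h3.trans hu.symm) h1 u.isLt v.isLt
        h5.tl_le hs'.1.arr_le ?_ ?_ (h5.dist_le u.isLt) (h5.dist_le v.isLt) ?_ ?_)⟩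
      · rw [hK']; exact kind_le u
      · rw [hK']; exact kind_le v
      · intro c1 c2 c3 c4
        have hq := h5.push h4 v.isLt c1 (hlink.2 ⟨c2, c3, c4⟩)
        rw [← hu] at hq
        refine ⟨by simp [Mem.setVar_var], h, ?_, ?_, ?_⟩
        · simp only [Mem.setVar_var, Mem.setVar_arr, Mem.setArr_arr, Mem.setArr_var,
            Nat.reduceEqDiff, if_false, if_true, h3]
          exact (Function.update_of_ne h4.ne _ _).symm
        · simp only [Mem.setVar_var, Nat.reduceEqDiff, if_false, if_true]; omega
        · simpa only [Mem.setVar_var, Mem.setVar_arr, Mem.setArr_arr, Mem.setArr_var,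
            Nat.reduceEqDiff, if_false, if_true] using hq
      · intro c
        rw [← hlink] at c
        exact ⟨by simp [Mem.setVar_var], h, h3, h4, h5.skip c⟩
  · have : searchStep.cost ≤ 90 := by decide
    simp only [Expr.cost]
    nlinarith

theorem search_runs (hW : n * n + 4 * n + 16 ≤ W) (hs : HoldsTriangle G x a b s)
    (hxa : G.Adj x a) (hxb : G.Adj x b) (hab : G.Adj a b) :
    Runs W search s (1000 * (n + 1) ^ 2) fun s' => ∃ tl hd, ¬ hd < tl ∧
      BfsInv n a (NatLink G x a b) (s'.arr aDist) (s'.arr aPred) (s'.arr aQueue) tl hd 0 := by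
  have hW1 : 1 < W := by omega
  have han := a.isLt
  refine (Runs.seq (T := 2) (T' := (n * 100 + 4) + (16 + (n * (n * 100 + 100) + 4)))
    (Runs.mono (Runs.of_wp hW1 (Q := fun s' => s'.var rV = 0) ?_) (by decide)
      fun s1 hF1 h1 _ => ?_)).mono ?_ fun _ _ h => h
  · simp [Prog.wp, Expr.Below, Expr.val, Mem.setVar_var]; omega
  have hs1 := hs.frame hF1 rfl rfl rfl rfl rfl
  refine Runs.seq ((kindLoop_runs hW hs1 hxa hxb hab h1).mono le_rfl fun s2 hF2 h2 _ => ?_)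
  have hs2 := hs1.frame hF2 rfl rfl rfl rfl rfl
  refine Runs.seq (Runs.mono (Runs.of_wp hW1 (Q := fun s' => s'.var rHead = 0 ∧
    BfsInv n a (NatLink G x a b) (s'.arr aDist) (s'.arr aPred) (s'.arr aQueue) (s'.var rTail)
        0 0) ?_) (by decide) fun s3 hF3 h3 _ => ?_)
  · simp only [Prog.wp, Expr.Below, Expr.val, Mem.setVar_var, Mem.setArr_var, hs2.2.1,
      Mem.setVar_arr, Mem.setArr_arr, Nat.reduceEqDiff, if_true, if_false]
    refine ⟨by omega, by omega, by omega, by omega, by omega, by omega, by omega, by omega,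
      by simp, BfsInv.init han (fun v hv => ?_) (by simp) (by simp)⟩
    rw [Function.update_apply, h2.1 v hv]
  have hs3 := hs2.frame hF3 rfl rfl rfl rfl rfl
  have hK3 : ∀ v : Fin n, s3.arr aKind v = kind G x a b v := fun v => by
    rw [hF3.2 aKind rfl]; exact h2.2 v
  refine (Runs.loop_const hW1 n (5 + ((n * 100 + 4) + 4)) (fun i s' => s'.var rHead = i ∧
    BfsInv n a (NatLink G x a b) (s'.arr aDist) (s'.arr aPred) (s'.arr aQueue) (s'.var rTail)
        i 0) h3 ?_).mono ?_ fun _ _ h => h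
  · rintro i s4 hF4 ⟨h4, h5⟩
    have hs4 := hs3.frame hF4 rfl rfl rfl rfl rfl
    have hK4 : ∀ v : Fin n, s4.arr aKind v = kind G x a b v := fun v => by
      rw [hF4.2 aKind rfl]; exact hK3 v
    have htl := h5.tl_le
    have hhd := h5.hd_le
    refine ⟨?_, ?_, ?_⟩
    · simp only [Expr.Below, h4]; omega
    · intro h
      simp only [Expr.val, h4, ite_eq_right_iff, one_ne_zero, imp_false] at h
      exact ⟨_, _, h, h5⟩
    · intro h
      simp only [Expr.val, h4, ne_eq, ite_eq_right_iff, one_ne_zero, imp_false, not_not] at h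
      refine ⟨by omega, ?_⟩
      have hq := (h5.queue i h).1
      refine Runs.seq (Runs.mono (Runs.of_wp hW1 (Q := fun s' => s'.var rV = 0 ∧
        s'.var rU = s'.arr aQueue i) ?_) (by decide) fun s5 hF5 h6 _ => ?_)
      · simp only [Prog.wp, Expr.Below, Expr.val, h4, Mem.setVar_var, Nat.reduceEqDiff, if_true,
          if_false, Mem.setVar_arr, and_true]
        omega
      have hs5 := hs4.frame hF5 rfl rfl rfl rfl rfl
      have e1 : s5.var rHead = i := by rw [hF5.1 rHead rfl, h4]
      have e2 : s5.arr aKind = s4.arr aKind := hF5.2 aKind rfl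
      have hb : BfsInv n a (NatLink G x a b) (s5.arr aDist) (s5.arr aPred) (s5.arr aQueue)
          (s5.var rTail) i 0 := by
        rw [hF5.1 rTail rfl, hF5.2 aDist rfl, hF5.2 aPred rfl, hF5.2 aQueue rfl]
        exact h5
      have ht : i < s5.var rTail := by rw [hF5.1 rTail rfl]; exact h
      refine Runs.seq ((searchLoop_runs hW hs5 (fun v => by rw [e2]; exact hK4 v) h6.1 h6.2 ht
        hb).mono le_rfl fun s6 hF6 h7 _ => ?_)
      have e3 : s6.var rHead = i := by rw [hF6.1 rHead rfl, e1]
      refine Runs.mono (Runs.of_wp hW1 ?_) (by decide) fun _ _ h => h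
      simp only [Prog.wp, Expr.Below, Expr.val, e3, Mem.setVar_var, Nat.reduceEqDiff, if_true,
          if_false, Mem.setVar_arr]
      exact ⟨by omega, trivial, h7.2.next h7.1⟩
  · simp only [Expr.cost]
    nlinarith
  · nlinarith

end Search

/-! ### The best linking path over all triangles -/

section Visit

variable {n : ℕ} {G : SimpleGraph (Fin n)} {W : ℕ} {s : Mem}

/-- Either `best` is `0` and no triangle in `S` has a linking path, or `best - 1` is the length of a
linking path, with vertices `path 0, …, path (best - 1)`, of a triangle with the vertex `tip`, and
no triangle in `S` has a shorter one. The path runs from `b` to `a`, because it is found by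
following predecessors from `b`. -/
structure IsBest (G : SimpleGraph (Fin n)) (S : Fin n → Fin n → Fin n → Prop) (best tip : ℕ)
    (path : ℕ → ℕ) : Prop where
  best_le : best ≤ n
  tip_lt : best ≠ 0 → tip < n
  exists_path : best ≠ 0 → ∃ (x a b : Fin n) (p : ℕ → Fin n), G.Adj x a ∧ G.Adj x b ∧ G.Adj a b ∧
    tip = x ∧ p 0 = b ∧ p (best - 1) = a ∧ (∀ t < best - 1, Link G x a b (p t) (p (t + 1))) ∧
    ∀ t < best, path t = p t
  least : ∀ a b x, S a b x → G.Adj x a → G.Adj x b → G.Adj a b →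
    ∀ L, Steps (Link G x a b) L a b → best ≠ 0 ∧ best ≤ L + 1

theorem IsBest.of_imp {S S' : Fin n → Fin n → Fin n → Prop} {best tip : ℕ} {path : ℕ → ℕ}
    (h : IsBest G S best tip path)
    (hS : ∀ a b x, G.Adj x a → G.Adj x b → G.Adj a b → S' a b x → S a b x) :
    IsBest G S' best tip path where
  __ := h
  least a b x h' h1 h2 h3 := h.least a b x (hS a b x h1 h2 h3 h') h1 h2 h3

/-- The memory holds the input and the best linking path among the triangles in `S`. -/
def HoldsBest (G : SimpleGraph (Fin n)) (S : Fin n → Fin n → Fin n → Prop) (s : Mem) : Prop :=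
  HoldsInput G s ∧ IsBest G S (s.var rBest) (s.var rTip) (s.arr aPath)

/-- Copies the linking path from `rB` back to `rA` if it is the first or shorter than the best. -/
def record : Prog :=
  .cond (.lt (.const 0) (.get aDist (.var rB)))
    (.cond (.add (.lt (.var rBest) (.const 1)) (.lt (.get aDist (.var rB)) (.var rBest)))
      (.seq
        (.seq (.assign rBest (.get aDist (.var rB)))
          (.seq (.assign rTip (.var rX)) (.seq (.assign rW (.var rB)) (.assign rI (.const 0)))))
        (.loop (.lt (.var rI) (.var rBest))
          (.seq (.store aPath (.var rI) (.var rW))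
            (.seq (.assign rW (.get aPred (.var rW)))
              (.assign rI (.add (.var rI) (.const 1)))))))
      .skip)
    .skip

theorem record_runs (hW : n * n + 4 * n + 16 ≤ W) {x a b : Fin n} (hs : HoldsTriangle G x a b s)
    (hxa : G.Adj x a) (hxb : G.Adj x b) (hab : G.Adj a b) {S : Fin n → Fin n → Fin n → Prop}
    (hbest : IsBest G S (s.var rBest) (s.var rTip) (s.arr aPath)) {tl hd : ℕ} (hhd : ¬ hd < tl)
    (hb : BfsInv n a (NatLink G x a b) (s.arr aDist) (s.arr aPred) (s.arr aQueue) tl hd 0) :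
    Runs W record s (100 * (n + 1)) fun s' =>
      IsBest G (fun a' b' x' => S a' b' x' ∨ a' = a ∧ b' = b ∧ x' = x) (s'.var rBest)
        (s'.var rTip) (s'.arr aPath) := by
  have hW1 : 1 < W := by omega
  have hDb := hb.dist_le b.isLt
  have hbn := b.isLt
  have hxn := x.isLt
  have hbe := hbest.best_le
  have hsb : s.var rB = b := hs.2.2.1
  -- the distance found is minimal
  have hleast : ∀ L, Steps (Link G x a b) L a b → s.arr aDist b ≠ 0 ∧ s.arr aDist b ≤ L + 1 :=
    fun L hL => (hb.reached hhd a.isLt (fun u v ⟨i, j, _, hj, _⟩ => hj ▸ j.isLt)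
      (hL.map Fin.val fun u v h => ⟨u, v, rfl, rfl, h⟩) rfl).2
  refine (Runs.cond hW1 ?_ (T := 70 * (n + 1)) (T' := 1) (fun h1 => ?_) fun h1 => ?_).mono ?_
    fun _ _ h => h
  · simp only [Expr.Below, Expr.val, hsb]; omega
  · simp only [Expr.val, hsb, ne_eq, ite_eq_right_iff, one_ne_zero, imp_false, not_not] at h1
    refine (Runs.cond hW1 ?_ (T := 50 * (n + 1)) (T' := 1) (fun h2 => ?_) fun h2 => ?_).mono ?_
      fun _ _ h => h
    · refine ⟨?_, ?_, lt_of_le_of_lt (Nat.add_le_add (Expr.val_lt_le _ _ _)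
        (Expr.val_lt_le _ _ _)) (by omega)⟩
      · simp only [Expr.Below]; omega
      · simp only [Expr.Below, Expr.val, hsb]; omega
    · have h2' : s.var rBest = 0 ∨ s.arr aDist b < s.var rBest := by
        rw [Ne, Expr.val_add, Nat.add_eq_zero_iff, Expr.val_lt_eq_zero, Expr.val_lt_eq_zero] at h2
        simp only [Expr.val, hsb] at h2
        omega
      set D := s.arr aDist b with hD
      set w : ℕ → ℕ := fun t => (s.arr aPred)^[t] b with hw
      have hw1 : ∀ t, w (t + 1) = s.arr aPred (w t) := fun t => Function.iterate_succ_apply' _ _ _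
      obtain ⟨k1, k2, k3⟩ := hb.walk b.isLt h1.ne' (w := w) rfl fun t _ => hw1 t
      rw [← hD] at k1 k2 k3
      have hwn : ∀ t ≤ D, w t < n := fun t ht => by
        rcases ht.lt_or_eq with h | rfl
        · exact (k1 t h).1
        · obtain ⟨e1, e2⟩ := k1 (D - 1) (by omega)
          have := (hb.par _ e1 (by omega)).1
          rwa [← hw1, show D - 1 + 1 = D by omega] at this
      refine (Runs.seq (T' := n * 20 + 4) (Runs.mono (Runs.of_wp hW1 (Q := fun s' =>
        s'.var rBest = D ∧ s'.var rTip = x ∧ s'.var rW = w 0 ∧ s'.var rI = 0) ?_)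
        (by decide : _ ≤ 10) fun s1 hF1 hs1 _ => ?_)).mono (by omega) fun _ _ h => h
      · simp only [Prog.wp, Expr.Below, Expr.val, Mem.setVar_var, hsb, hs.2.2.2, Nat.reduceEqDiff,
          if_true, if_false, ← hD, hw, Function.iterate_zero, id, and_true]
        omega
      refine (Runs.loop_const hW1 n 12 (fun i s' => s'.var rI = i ∧ i ≤ D ∧ s'.var rW = w i ∧
        ∀ t < i, s'.arr aPath t = w t) ⟨hs1.2.2.2, Nat.zero_le _, hs1.2.2.1,
        fun t ht => absurd ht (Nat.not_lt_zero t)⟩ ?_).mono ?_ fun _ _ h => h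
      · rintro i s2 hF2 ⟨e1, e2, e3, e4⟩
        have e5 : s2.var rBest = D := (hF2.1 rBest rfl).trans hs1.1
        have e6 : s2.var rTip = x := (hF2.1 rTip rfl).trans hs1.2.1
        have e7 : s2.arr aPred = s.arr aPred := (hF2.2 aPred rfl).trans (hF1.2 aPred rfl)
        refine ⟨?_, ?_, ?_⟩
        · simp only [Expr.Below, e1, e5]; omega
        · intro h
          simp only [Expr.val, e1, e5, ite_eq_right_iff, one_ne_zero, imp_false] at h
          obtain rfl : i = D := by omega
          rw [e5, e6]
          refine ⟨hDb, fun _ => x.isLt, fun _ => ⟨x, a, b, fun t =>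
            if h : w t < n then ⟨w t, h⟩ else b, hxa, hxb, hab, rfl, ?_, ?_, ?_, ?_⟩, ?_⟩
          · simp [hw]
          · beta_reduce
            rw [dif_pos (hwn _ (by omega))]
            exact Fin.ext k3
          · intro t ht
            beta_reduce
            rw [dif_pos (hwn _ (by omega)), dif_pos (hwn _ (by omega))]
            obtain ⟨i, j, hi, hj, hl⟩ := k2 t (by omega)
            have ei : i = ⟨w (t + 1), hwn _ (by omega)⟩ := Fin.ext hi
            have ej : j = ⟨w t, hwn _ (by omega)⟩ := Fin.ext hj
            rw [← ei, ← ej]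
            exact hl.symm
          · intro t ht
            beta_reduce
            rw [dif_pos (hwn _ ht.le)]
            exact e4 t ht
          · rintro a' b' x' (h' | ⟨rfl, rfl, rfl⟩) h3 h4 h5 L hL
            · obtain ⟨h6, h7⟩ := hbest.least a' b' x' h' h3 h4 h5 L hL
              omega
            · exact hleast L hL
        · intro h
          simp only [Expr.val, e1, e5, ne_eq, ite_eq_right_iff, one_ne_zero, imp_false,
            not_not] at h
          have e8 := hwn i e2
          have e9 := hwn (i + 1) h
          refine ⟨by omega, Runs.mono (Runs.of_wp hW1 ?_) (by decide) fun _ _ h => h⟩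
          simp only [Prog.wp, Expr.Below, Expr.val, Mem.setVar_var, Mem.setArr_var, Mem.setVar_arr,
            Mem.setArr_arr, Nat.reduceEqDiff, if_true, if_false, e1, e3, e7, ← hw1]
          refine ⟨by omega, by omega, by omega, by omega, trivial, h, trivial, fun t ht => ?_⟩
          rw [Function.update_apply]
          split_ifs with hti
          · rw [hti]
          · exact e4 t (by omega)
      · simp only [Expr.cost]; omega
    · have h2' : s.var rBest ≠ 0 ∧ s.var rBest ≤ s.arr aDist b := by
        rw [Expr.val_add, Nat.add_eq_zero_iff, Expr.val_lt_eq_zero, Expr.val_lt_eq_zero] at h2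
        simp only [Expr.val, hsb] at h2
        omega
      refine Runs.skip ⟨hbest.best_le, hbest.tip_lt, hbest.exists_path, ?_⟩
      rintro a' b' x' (h' | ⟨rfl, rfl, rfl⟩) h3 h4 h5 L hL
      · exact hbest.least a' b' x' h' h3 h4 h5 L hL
      · have := hleast L hL
        omega
    · simp only [Expr.cost]
      split_ifs <;> omega
  · simp only [Expr.val, hsb, ite_eq_right_iff, one_ne_zero, imp_false, not_lt,
      Nat.le_zero] at h1
    refine Runs.skip ⟨hbest.best_le, hbest.tip_lt, hbest.exists_path, ?_⟩
    rintro a' b' x' (h' | ⟨rfl, rfl, rfl⟩) h3 h4 h5 L hL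
    · exact hbest.least a' b' x' h' h3 h4 h5 L hL
    · exact absurd h1 (hleast L hL).1
  · simp only [Expr.cost]
    split_ifs <;> omega

/-- Visits all vertices `rX` that form a triangle with the edge between `rA` and `rB`. -/
def tipLoop : Prog :=
  .loop (.lt (.var rX) (.var rN))
    (.seq (.cond (adjE rA rX) (.cond (adjE rB rX) (.seq search record) .skip) .skip)
      (.assign rX (.add (.var rX) (.const 1))))

/-- Visits all edges with the end `rA`. -/
def edgeLoop : Prog :=
  .loop (.lt (.var rB) (.var rN))
    (.seq (.cond (adjE rA rB) (.seq (.assign rX (.const 0)) tipLoop) .skip)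
      (.assign rB (.add (.var rB) (.const 1))))

/-- Finds a linking path that is shortest over all triangles. -/
def findPath : Prog :=
  .seq (.assign rA (.const 0))
    (.loop (.lt (.var rA) (.var rN))
      (.seq (.seq (.assign rB (.const 0)) edgeLoop)
        (.assign rA (.add (.var rA) (.const 1)))))

/-- A bound for the steps of the body of `tipLoop`, where `M` is the adjacency matrix. -/
def tipCost (n : ℕ) (M : ℕ → ℕ) (a b x : ℕ) : ℕ :=
  M (a * n + x) * M (b * n + x) * (1100 * (n + 1) ^ 2) + 30

/-- A bound for the steps of `tipLoop`, where `M` is the adjacency matrix. -/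
def tipLoopCost (n : ℕ) (M : ℕ → ℕ) (a b : ℕ) : ℕ :=
  ∑ x ∈ Finset.range n, (tipCost n M a b x + 4) + 4

/-- A bound for the steps of the body of `edgeLoop`, where `M` is the adjacency matrix. -/
def edgeCost (n : ℕ) (M : ℕ → ℕ) (a b : ℕ) : ℕ := M (a * n + b) * (tipLoopCost n M a b + 2) + 20

/-- A bound for the steps of `edgeLoop`, where `M` is the adjacency matrix. -/
def edgeLoopCost (n : ℕ) (M : ℕ → ℕ) (a : ℕ) : ℕ :=
  ∑ b ∈ Finset.range n, (edgeCost n M a b + 4) + 4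

/-- A bound for the steps of `findPath`, where `M` is the adjacency matrix. -/
def findPathCost (n : ℕ) (M : ℕ → ℕ) : ℕ :=
  ∑ a ∈ Finset.range n, (edgeLoopCost n M a + 10 + 4) + 6

theorem tipLoop_runs (hW : n * n + 4 * n + 16 ≤ W) {a b : Fin n} (hab : G.Adj a b)
    (hs : HoldsBest G (fun a' b' _ => a' < a ∨ a' = a ∧ b' < b) s) (hsa : s.var rA = a)
    (hsb : s.var rB = b) (hsx : s.var rX = 0) :
    Runs W tipLoop s (tipLoopCost n ((inputMem G).arr 0) a b)
      (HoldsBest G fun a' b' _ => a' < a ∨ a' = a ∧ b' ≤ b) := by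
  have hW1 : 1 < W := by omega
  refine (Runs.loop hW1 n (tipCost n ((inputMem G).arr 0) a b) (fun i s' => s'.var rX = i ∧ i ≤ n ∧
    IsBest G (fun a' b' x' => a' < a ∨ a' = a ∧ (b' < b ∨ b' = b ∧ x'.val < i))
      (s'.var rBest) (s'.var rTip) (s'.arr aPath)) ⟨hsx, Nat.zero_le _, hs.2.of_imp ?_⟩
    ?_).mono ?_ fun _ _ h => h
  · rintro a' b' x' - - - (h | ⟨h, h' | h'⟩)
    · exact .inl h
    · exact .inr ⟨h, h'⟩
    · exact absurd h'.2 (Nat.not_lt_zero _)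
  · rintro i s' hF ⟨h1, h2, h3⟩
    have hI := hs.1.frame hF rfl rfl
    have hn := hI.1
    have ea : s'.var rA = a := (hF.1 rA rfl).trans hsa
    have eb : s'.var rB = b := (hF.1 rB rfl).trans hsb
    refine ⟨?_, ?_, ?_⟩
    · simp only [Expr.Below, h1, hn]; omega
    · intro h
      simp only [Expr.val, h1, hn, ite_eq_right_iff, one_ne_zero, imp_false] at h
      obtain rfl : i = n := by omega
      refine ⟨hI, h3.of_imp ?_⟩
      rintro a' b' x' - - - (h | ⟨h, h'⟩)
      · exact .inl h
      · exact .inr ⟨h, h'.lt_or_eq.imp_right fun h => ⟨h, x'.isLt⟩⟩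
    · intro h
      simp only [Expr.val, h1, hn, ne_eq, ite_eq_right_iff, one_ne_zero, imp_false, not_not] at h
      refine ⟨h, ?_⟩
      obtain ⟨x, rfl⟩ : ∃ x : Fin n, x.val = i := ⟨⟨i, h⟩, rfl⟩
      have below : ∀ (u : Fin n) (r : ℕ), s'.var r = u → (adjE r rX).Below W s' ∧
          (adjE r rX).val s' = s'.arr 0 (u * n + x) := fun u r hr => by
        have e1 := index_lt u.isLt x.isLt
        have e2 := hI.arr_le (u * n + x)
        have e3 := u.isLt
        simp only [adjE, Expr.Below, Expr.val, hr, hn, h1, and_true]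
        omega
      have hM := hI.2
      obtain ⟨b1, v1⟩ := below a rA ea
      obtain ⟨b2, v2⟩ := below b rB eb
      -- if the current vertex forms no triangle with the edge, nothing is to be done
      have skip : ¬ (G.Adj x a ∧ G.Adj x b) → IsBest G (fun a' b' x' => a' < a ∨ a' = a ∧
          (b' < b ∨ b' = b ∧ x'.val < x + 1)) (s'.var rBest) (s'.var rTip) (s'.arr aPath) := by
        intro hc
        refine h3.of_imp ?_
        rintro a' b' x' h4 h5 - (h | ⟨h, h' | ⟨h', h6⟩⟩)
        · exact .inl h
        · exact .inr ⟨h, .inl h'⟩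
        · rcases Nat.lt_succ_iff_lt_or_eq.1 h6 with h6 | h6
          · exact .inr ⟨h, .inr ⟨h', h6⟩⟩
          · rw [h, Fin.ext h6] at h4
            rw [h', Fin.ext h6] at h5
            exact absurd ⟨h4, h5⟩ hc
      refine (Runs.seq_of (T' := 4) (R := fun s'' => s''.var rX = x ∧
        IsBest G (fun a' b' x' => a' < a ∨ a' = a ∧ (b' < b ∨ b' = b ∧ x'.val < x + 1))
          (s''.var rBest) (s''.var rTip) (s''.arr aPath))
        (Runs.cond hW1 b1 (T' := 1) (fun c1 => Runs.cond hW1 b2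
          (T := 1000 * (n + 1) ^ 2 + 100 * (n + 1)) (T' := 1) (fun c2 => ?_)
          fun c2 => ?_) fun c1 => ?_) ?_).mono ?_ fun _ _ h => h
      · rw [v1, hI.adj_ne_zero] at c1
        rw [v2, hI.adj_ne_zero] at c2
        have ht : HoldsTriangle G x a b s' := ⟨hI, ea, eb, h1⟩
        refine Runs.seq ((search_runs hW ht c1.symm c2.symm hab).mono le_rfl
          fun s1 hF1 ⟨tl, hd, hhd, hb⟩ _ => ?_)
        have ht1 := ht.frame hF1 rfl rfl rfl rfl rfl
        have h3' : IsBest G (fun a' b' x' => a' < a ∨ a' = a ∧ (b' < b ∨ b' = b ∧ x'.val < x))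
            (s1.var rBest) (s1.var rTip) (s1.arr aPath) := by
          rw [hF1.1 rBest rfl, hF1.1 rTip rfl, hF1.2 aPath rfl]; exact h3
        refine (record_runs hW ht1 c1.symm c2.symm hab h3' hhd hb).mono le_rfl fun s2 hF2 h4 =>
          ⟨(hF2.1 rX rfl).trans ht1.2.2.2, h4.of_imp ?_⟩
        rintro a' b' x' - - - (h | ⟨h, h' | ⟨h', h6⟩⟩)
        · exact .inl (.inl h)
        · exact .inl (.inr ⟨h, .inl h'⟩)
        · rcases Nat.lt_succ_iff_lt_or_eq.1 h6 with h6 | h6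
          · exact .inl (.inr ⟨h, .inr ⟨h', h6⟩⟩)
          · exact .inr ⟨h, h', Fin.ext h6⟩
      · refine Runs.skip ⟨h1, skip fun hc => ?_⟩
        rw [v2] at c2
        exact (hI.adj_ne_zero b x).2 hc.2.symm c2
      · refine Runs.skip ⟨h1, skip fun hc => ?_⟩
        rw [v1] at c1
        exact (hI.adj_ne_zero a x).2 hc.1.symm c1
      · rintro s1 hF1 ⟨h4, h5⟩
        refine Runs.mono (Runs.of_wp hW1 ?_) (by decide) fun _ _ h => h
        simp only [Prog.wp, Expr.Below, Expr.val, h4, Mem.setVar_var, Nat.reduceEqDiff, if_true,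
          if_false, Mem.setVar_arr]
        exact ⟨by omega, trivial, h, h5⟩
      · have e1 : ((inputMem G).arr 0) (a * n + x) = 0 ∨ ((inputMem G).arr 0) (a * n + x) = 1 := by
          have := inputMem_arr_le (G := G) (a * n + x); omega
        have e2 : ((inputMem G).arr 0) (b * n + x) = 0 ∨ ((inputMem G).arr 0) (b * n + x) = 1 := by
          have := inputMem_arr_le (G := G) (b * n + x); omega
        rw [v1, v2, hM]
        simp only [tipCost, adjE, Expr.cost]
        rcases e1 with e1 | e1 <;> rcases e2 with e2 | e2 <;> rw [e1, e2] <;> simp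
        all_goals nlinarith
  · simp only [tipLoopCost, Expr.cost]; exact le_rfl

theorem edgeLoop_runs (hW : n * n + 4 * n + 16 ≤ W) {a : Fin n}
    (hs : HoldsBest G (fun a' _ _ => a' < a) s) (hsa : s.var rA = a) (hsb : s.var rB = 0) :
    Runs W edgeLoop s (edgeLoopCost n ((inputMem G).arr 0) a)
      (HoldsBest G fun a' _ _ => a' ≤ a) := by
  have hW1 : 1 < W := by omega
  refine (Runs.loop hW1 n (edgeCost n ((inputMem G).arr 0) a) (fun i s' => s'.var rB = i ∧ i ≤ n ∧
    IsBest G (fun a' b' _ => a' < a ∨ a' = a ∧ b'.val < i)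
      (s'.var rBest) (s'.var rTip) (s'.arr aPath)) ⟨hsb, Nat.zero_le _, hs.2.of_imp ?_⟩
    ?_).mono ?_ fun _ _ h => h
  · rintro a' b' x' - - - (h | ⟨h, h'⟩)
    · exact h
    · exact absurd h' (Nat.not_lt_zero _)
  · rintro i s' hF ⟨h1, h2, h3⟩
    have hI := hs.1.frame hF rfl rfl
    have hn := hI.1
    have ea : s'.var rA = a := (hF.1 rA rfl).trans hsa
    refine ⟨?_, ?_, ?_⟩
    · simp only [Expr.Below, h1, hn]; omega
    · intro h
      simp only [Expr.val, h1, hn, ite_eq_right_iff, one_ne_zero, imp_false] at h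
      obtain rfl : i = n := by omega
      refine ⟨hI, h3.of_imp ?_⟩
      intro a' b' x' _ _ _ h
      exact h.lt_or_eq.imp_right fun h => ⟨h, b'.isLt⟩
    · intro h
      simp only [Expr.val, h1, hn, ne_eq, ite_eq_right_iff, one_ne_zero, imp_false, not_not] at h
      refine ⟨h, ?_⟩
      obtain ⟨b, rfl⟩ : ∃ b : Fin n, b.val = i := ⟨⟨i, h⟩, rfl⟩
      have hM := hI.2
      have b1 : (adjE rA rB).Below W s' ∧ (adjE rA rB).val s' = s'.arr 0 (a * n + b) := by
        have e1 := index_lt a.isLt b.isLt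
        have e2 := hI.arr_le (a * n + b)
        have e3 := a.isLt
        simp only [adjE, Expr.Below, Expr.val, ea, hn, h1, and_true]
        omega
      refine (Runs.seq_of (T' := 4) (R := fun s'' => s''.var rB = b ∧
        IsBest G (fun a' b' _ => a' < a ∨ a' = a ∧ b'.val < b + 1) (s''.var rBest) (s''.var rTip)
          (s''.arr aPath))
        (Runs.cond hW1 b1.1 (T := 2 + tipLoopCost n ((inputMem G).arr 0) a b) (T' := 1)
          (fun c1 => ?_) fun c1 => ?_) ?_).mono ?_ fun _ _ h => h
      · rw [b1.2, hI.adj_ne_zero] at c1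
        refine Runs.seq (Runs.mono (Runs.of_wp hW1 (Q := fun s'' => s''.var rX = 0) ?_) (by decide)
          fun s1 hF1 h4 _ => ?_)
        · simp only [Prog.wp, Expr.Below, Expr.val, Mem.setVar_var, if_true, and_true]; omega
        have h3' : HoldsBest G (fun a' b' _ => a' < a ∨ a' = a ∧ b' < b) s1 :=
          ⟨hI.frame hF1 rfl rfl, by
            rw [hF1.1 rBest rfl, hF1.1 rTip rfl, hF1.2 aPath rfl]; exact h3⟩
        have eb : s1.var rB = b := (hF1.1 rB rfl).trans h1
        refine (tipLoop_runs hW c1 h3' ((hF1.1 rA rfl).trans ea) eb h4).mono le_rfl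
          fun s2 hF2 h5 => ⟨(hF2.1 rB rfl).trans eb, h5.2.of_imp ?_⟩
        rintro a' b' x' - - - (h | ⟨h, h'⟩)
        · exact .inl h
        · exact .inr ⟨h, Fin.le_def.2 (Nat.lt_succ_iff.1 h')⟩
      · refine Runs.skip ⟨h1, h3.of_imp ?_⟩
        rintro a' b' x' - - h4 (h | ⟨h, h'⟩)
        · exact .inl h
        · rcases Nat.lt_succ_iff_lt_or_eq.1 h' with h' | h'
          · exact .inr ⟨h, h'⟩
          · rw [h, Fin.ext h'] at h4
            rw [b1.2] at c1
            exact absurd c1 ((hI.adj_ne_zero a b).2 h4)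
      · rintro s1 hF1 ⟨h4, h5⟩
        refine Runs.mono (Runs.of_wp hW1 ?_) (by decide) fun _ _ h => h
        simp only [Prog.wp, Expr.Below, Expr.val, h4, Mem.setVar_var, Nat.reduceEqDiff, if_true,
          if_false, Mem.setVar_arr]
        exact ⟨by omega, trivial, h, h5⟩
      · have e1 : ((inputMem G).arr 0) (a * n + b) = 0 ∨ ((inputMem G).arr 0) (a * n + b) = 1 := by
          have := inputMem_arr_le (G := G) (a * n + b); omega
        rw [b1.2, hM]
        simp only [edgeCost, adjE, Expr.cost]
        rcases e1 with e1 | e1 <;> rw [e1] <;> simp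
        all_goals omega
  · simp only [edgeLoopCost, Expr.cost]; exact le_rfl

theorem findPath_runs (hW : n * n + 4 * n + 16 ≤ W) :
    Runs W findPath (inputMem G) (findPathCost n ((inputMem G).arr 0))
      (HoldsBest G fun _ _ _ => True) := by
  have hW1 : 1 < W := by omega
  have hI0 : HoldsInput G (inputMem G) := ⟨rfl, rfl⟩
  refine (Runs.seq
    (T' := ∑ a ∈ Finset.range n, (edgeLoopCost n ((inputMem G).arr 0) a + 10 + 4) + 4)
    (Runs.mono (Runs.of_wp hW1 (Q := fun s' => s'.var rA = 0) ?_) (by decide : _ ≤ 2)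
      fun s1 hF1 h1 _ => ?_)).mono (by rw [findPathCost]; omega) fun _ _ h => h
  · simp only [Prog.wp, Expr.Below, Expr.val, Mem.setVar_var, if_true, and_true]; omega
  have hI1 := hI0.frame hF1 rfl rfl
  have hbest : IsBest G (fun a' _ _ => a'.val < 0) (s1.var rBest) (s1.var rTip) (s1.arr aPath) := by
    have e : s1.var rBest = 0 := hF1.1 rBest rfl
    rw [e]
    exact ⟨Nat.zero_le _, fun h => absurd rfl h, fun h => absurd rfl h,
      fun a b x h => absurd h (Nat.not_lt_zero _)⟩
  refine (Runs.loop hW1 n (fun a => edgeLoopCost n ((inputMem G).arr 0) a + 10)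
    (fun i s' => s'.var rA = i ∧ i ≤ n ∧ IsBest G (fun a' _ _ => a'.val < i)
      (s'.var rBest) (s'.var rTip) (s'.arr aPath)) ⟨h1, Nat.zero_le _, hbest⟩ ?_).mono ?_
    fun _ _ h => h
  · rintro i s' hF ⟨h1, h2, h3⟩
    have hI := hI1.frame hF rfl rfl
    have hn := hI.1
    refine ⟨?_, ?_, ?_⟩
    · simp only [Expr.Below, h1, hn]; omega
    · intro h
      simp only [Expr.val, h1, hn, ite_eq_right_iff, one_ne_zero, imp_false] at h
      obtain rfl : i = n := by omega
      exact ⟨hI, h3.of_imp fun a' _ _ _ _ _ _ => a'.isLt⟩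
    · intro h
      simp only [Expr.val, h1, hn, ne_eq, ite_eq_right_iff, one_ne_zero, imp_false, not_not] at h
      refine ⟨h, ?_⟩
      obtain ⟨a, rfl⟩ : ∃ a : Fin n, a.val = i := ⟨⟨i, h⟩, rfl⟩
      refine (Runs.seq (T := 2 + edgeLoopCost n ((inputMem G).arr 0) a) (T' := 4)
        (Runs.seq (Runs.mono (Runs.of_wp hW1 (Q := fun s'' => s''.var rB = 0) ?_) (by decide)
          fun s1 hF1 h4 _ => ?_))).mono (by omega) fun _ _ h => h
      · simp only [Prog.wp, Expr.Below, Expr.val, Mem.setVar_var, if_true, and_true]; omega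
      have h3' : HoldsBest G (fun a' _ _ => a' < a) s1 :=
        ⟨hI.frame hF1 rfl rfl, by
          rw [hF1.1 rBest rfl, hF1.1 rTip rfl, hF1.2 aPath rfl]; exact h3⟩
      have ea : s1.var rA = a := (hF1.1 rA rfl).trans h1
      refine (edgeLoop_runs hW h3' ea h4).mono le_rfl fun s2 hF2 h5 _ => ?_
      have ea : s2.var rA = a := (hF2.1 rA rfl).trans ea
      refine Runs.mono (Runs.of_wp hW1 ?_) (by decide) fun _ _ h => h
      simp only [Prog.wp, Expr.Below, Expr.val, ea, Mem.setVar_var, Nat.reduceEqDiff, if_true,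
          if_false, Mem.setVar_arr]
      exact ⟨by omega, trivial, h, h5.2.of_imp fun a' _ _ _ _ _ h' => Fin.le_def.2 (by omega)⟩
  · simp only [Expr.cost]; exact le_rfl

end Visit

/-! ### The output -/

section Emit

variable {n : ℕ} {G : SimpleGraph (Fin n)} {W : ℕ} {s : Mem}

/-- Outputs the sun that the best linking path spans, if there is one. -/
def emitSun : Prog :=
  .cond (.lt (.const 0) (.var rBest))
    (.seq (.assign rI (.const 0))
      (.seq
        (.loop (.lt (.add (.mul (.const 2) (.var rI)) (.const 1)) (.var rBest))
          (.seq (.store aTip (.var rI) (.get aPath (.add (.mul (.const 2) (.var rI)) (.const 1))))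
            (.seq (.store aClique (.var rI) (.get aPath (.mul (.const 2) (.var rI))))
              (.assign rI (.add (.var rI) (.const 1))))))
        (.seq (.store aTip (.var rI) (.var rTip))
          (.seq (.store aClique (.var rI) (.get aPath (.mul (.const 2) (.var rI))))
            (.assign 0 (.add (.var rI) (.const 1)))))))
    (.assign 0 (.const 0))

theorem emitSun_runs (hW : n * n + 4 * n + 16 ≤ W) (hG : BuildingFree G)
    (hs : HoldsBest G (fun _ _ _ => True) s) :
    Runs W emitSun s (60 * n + 100) (HoldsSun G) := by
  have hW1 : 1 < W := by omega
  obtain ⟨hI, hbest⟩ := hs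
  have hbe := hbest.best_le
  refine (Runs.cond hW1 ?_ (T := 60 * n + 90) (T' := 2) (fun h1 => ?_) fun h1 => ?_).mono ?_
    fun _ _ h => h
  · simp only [Expr.Below]; omega
  · rw [Ne, Expr.val_lt_eq_zero, not_not] at h1
    simp only [Expr.val] at h1
    obtain ⟨x, a, b, p, hxa, hxb, hab, ht, hp0, hpL, hp, hpath⟩ := hbest.exists_path h1.ne'
    -- the path runs from `b` to `a`
    obtain ⟨r, hr2, hr, f, hf⟩ := exists_sun_of_shortest hG hxb hxa hab.symm hp0 hpL
      (fun t ht => (hp t ht).swap) fun x' a' b' L' h3 h4 h5 h6 => by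
        have := (hbest.least a' b' x' trivial h3 h4 h5 L' h6).2
        omega
    have hbr : s.var rBest = 2 * r + 1 := by omega
    have hpn : ∀ t < s.var rBest, s.arr aPath t < n := fun t ht => by
      rw [hpath t ht]; exact (p t).isLt
    refine (Runs.seq (T := 2) (T' := r * 40 + 8 + 30) (Runs.mono (Runs.of_wp hW1
      (Q := fun s' => s'.var rI = 0) ?_) (by decide) fun s1 hF1 e1 _ => ?_)).mono (by omega)
      fun _ _ h => h
    · simp only [Prog.wp, Expr.Below, Expr.val, Mem.setVar_var, if_true, and_true]; omega
    refine Runs.seq_of (R := fun s' => s'.var rI = r ∧ ∀ j < r,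
      s'.arr aTip j = s.arr aPath (2 * j + 1) ∧ s'.arr aClique j = s.arr aPath (2 * j))
      ((Runs.loop_const hW1 r 32 (fun i s' => s'.var rI = i ∧ i ≤ r ∧ ∀ j < i,
        s'.arr aTip j = s.arr aPath (2 * j + 1) ∧ s'.arr aClique j = s.arr aPath (2 * j))
        ⟨e1, Nat.zero_le _, fun j hj => absurd hj (Nat.not_lt_zero j)⟩ ?_).mono ?_
        fun _ _ h => h) ?_
    · rintro i s2 hF2 ⟨e2, e3, e4⟩
      have e5 : s2.var rBest = 2 * r + 1 := ((hF2.1 rBest rfl).trans (hF1.1 rBest rfl)).trans hbr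
      have e6 : s2.arr aPath = s.arr aPath := (hF2.2 aPath rfl).trans (hF1.2 aPath rfl)
      refine ⟨?_, ?_, ?_⟩
      · simp only [Expr.Below, Expr.val, e2, e5]; omega
      · intro h
        simp only [Expr.val, e2, e5, ite_eq_right_iff, one_ne_zero, imp_false] at h
        obtain rfl : i = r := by omega
        exact ⟨e2, e4⟩
      · intro h
        simp only [Expr.val, e2, e5, ne_eq, ite_eq_right_iff, one_ne_zero, imp_false,
          not_not] at h
        have e7 := hpn (2 * i) (by omega)
        have e8 := hpn (2 * i + 1) (by omega)
        refine ⟨by omega, Runs.mono (Runs.of_wp hW1 ?_) (by decide) fun _ _ h => h⟩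
        simp only [Prog.wp, Expr.Below, Expr.val, Mem.setVar_var, Mem.setArr_var, Mem.setVar_arr,
          Mem.setArr_arr, Nat.reduceEqDiff, if_true, if_false, e2, e6]
        refine ⟨by omega, by omega, by omega, by omega, by omega, trivial, by omega,
          fun j hj => ?_⟩
        rw [Function.update_apply, Function.update_apply]
        split_ifs with hji
        · subst hji; exact ⟨rfl, rfl⟩
        · exact e4 j (by omega)
    · simp only [Expr.cost]; omega
    · rintro s2 hF2 ⟨e2, e4⟩
      have e5 : s2.var rTip = x := ((hF2.1 rTip rfl).trans (hF1.1 rTip rfl)).trans ht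
      have e6 : s2.arr aPath = s.arr aPath := (hF2.2 aPath rfl).trans (hF1.2 aPath rfl)
      have e7 := hpn (2 * r) (by omega)
      have hxn := x.isLt
      refine Runs.mono (Runs.of_wp hW1 ?_) (by decide) fun _ _ h => h
      simp only [Prog.wp, Expr.Below, Expr.val, Mem.setArr_var, Mem.setArr_arr, Nat.reduceEqDiff,
        if_false, e2, e5, e6]
      refine ⟨by omega, by omega, by omega, by omega, by omega, fun _ => ⟨r + 1, by omega, ?_, f,
        fun i => ?_⟩, fun hn => absurd ⟨r + 1, by omega, ⟨f⟩⟩ hn⟩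
      · simp [Mem.setVar_var]
      · simp only [Mem.setVar_arr, Mem.setArr_arr, Nat.reduceEqDiff, if_true, if_false,
          Function.update_apply]
        have hi := i.isLt
        rw [(hf i).1, (hf i).2]
        by_cases hir : i.val = r
        · have : ¬ i.val < r := by omega
          simp only [hir, if_true, lt_irrefl, if_false]
          exact ⟨trivial, hpath _ (by omega)⟩
        · have : i.val < r := by omega
          simp only [hir, this, if_true, if_false]
          rw [(e4 i this).1, (e4 i this).2]
          exact ⟨hpath _ (by omega), hpath _ (by omega)⟩
  · rw [Expr.val_lt_eq_zero] at h1
    simp only [Expr.val] at h1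
    refine Runs.mono (Runs.of_wp hW1 (Q := HoldsSun G) ?_) (by decide) fun _ _ h => h
    simp only [Prog.wp, Expr.Below, Expr.val]
    refine ⟨by omega, fun hc => ?_, fun _ => by simp [Mem.setVar_var]⟩
    obtain ⟨x, a, b, hxa, hxb, hab, L, hL⟩ := (containsSun_iff_hasLinkedTriangle hG).1 hc
    exact absurd (Nat.pos_of_ne_zero (hbest.least a b x trivial hxa hxb hab L hL).1) h1
  · simp only [Expr.cost]; split_ifs <;> omega

/-- Outputs whether there is a linking path. -/
def emitAnswer : Prog := .assign 0 (.lt (.const 0) (.var rBest))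

theorem emitAnswer_runs (hW : n * n + 4 * n + 16 ≤ W)
    (hs : HoldsBest G (fun _ _ _ => True) s) :
    Runs W emitAnswer s (60 * n + 100) (HoldsFindSunAnswer G) := by
  have hW1 : 1 < W := by omega
  obtain ⟨hI, hbest⟩ := hs
  have hbe := hbest.best_le
  refine Runs.mono (Runs.of_wp hW1 (Q := HoldsFindSunAnswer G) ?_)
    (show _ ≤ 60 * n + 100 by have : emitAnswer.cost ≤ 100 := by decide
                              omega) fun _ _ h => h
  refine ⟨by simp only [Expr.Below]; omega, decide (0 < s.var rBest),
    (findSunReturns_iff G _).2 ?_, ?_⟩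
  · rw [decide_eq_true_iff]
    constructor
    · intro h
      obtain ⟨x, a, b, p, hxa, hxb, hab, -, hp0, hpL, hp, -⟩ := hbest.exists_path h.ne'
      have := Steps.of_path (E := Link G x a b) (p := p) (Nat.zero_le _) fun t _ ht => hp t ht
      rw [hp0, hpL] at this
      exact ⟨x, a, b, hxa, hxb, hab, _, this.symm fun _ _ h => h.symm⟩
    · rintro ⟨x, a, b, hxa, hxb, hab, L, hL⟩
      exact Nat.pos_of_ne_zero (hbest.least a b x trivial hxa hxb hab L hL).1
  · by_cases h : 0 < s.var rBest <;> simp [Mem.setVar_var, Expr.val, h]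

end Emit

/-! ### The running time -/

section Time

variable {n : ℕ} {G : SimpleGraph (Fin n)}

/-- The number of ordered triangles is at most the number of ordered edges to the power `3 / 2`: by
the Cauchy–Schwarz inequality, since adjacent vertices `a` and `b` have at most `√(d a * d b)`
common neighbours. -/
theorem sq_sum_triangles_le {ι : Type*} [Fintype ι] (M : ι → ι → ℕ) (hM : ∀ a b, M a b ≤ 1) :
    (∑ a, ∑ b, M a b * ∑ x, M a x * M b x) ^ 2 ≤ (∑ a, ∑ b, M a b) ^ 3 := by
  set d : ι → ℕ := fun a => ∑ b, M a b with hd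
  have hc : ∀ a b, (∑ x, M a x * M b x) ^ 2 ≤ d a * d b := fun a b => by
    have h1 : ∑ x, M a x * M b x ≤ d a := Finset.sum_le_sum fun x _ => by
      simpa using Nat.mul_le_mul_left (M a x) (hM b x)
    have h2 : ∑ x, M a x * M b x ≤ d b := Finset.sum_le_sum fun x _ => by
      simpa using Nat.mul_le_mul_right (M b x) (hM a x)
    rw [sq]
    exact Nat.mul_le_mul h1 h2
  have hsq : ∀ a b, M a b ^ 2 = M a b := fun a b => by
    have := hM a b
    interval_cases M a b <;> rfl
  calc (∑ a, ∑ b, M a b * ∑ x, M a x * M b x) ^ 2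
      = (∑ q : ι × ι, M q.1 q.2 * ∑ x, M q.1 x * M q.2 x) ^ 2 := by
        rw [Fintype.sum_prod_type]
    _ ≤ (∑ q : ι × ι, M q.1 q.2 ^ 2) * ∑ q : ι × ι, (∑ x, M q.1 x * M q.2 x) ^ 2 :=
        Finset.sum_mul_sq_le_sq_mul_sq _ _ _
    _ ≤ (∑ q : ι × ι, M q.1 q.2) * ∑ q : ι × ι, d q.1 * d q.2 := by
        refine Nat.mul_le_mul (le_of_eq (Finset.sum_congr rfl fun q _ => hsq _ _))
          (Finset.sum_le_sum fun q _ => hc _ _)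
    _ = (∑ a, ∑ b, M a b) ^ 3 := by
        rw [Fintype.sum_prod_type, Fintype.sum_prod_type, ← Finset.sum_mul_sum]
        ring

/-- A search is paid for by a triangle, and everything else by an edge or an entry of the matrix. -/
theorem findPathCost_eq (M : ℕ → ℕ) :
    findPathCost n M = 1100 * (n + 1) ^ 2 *
        (∑ a : Fin n, ∑ b : Fin n, M (a * n + b) * ∑ x : Fin n, M (a * n + x) * M (b * n + x)) +
      (34 * n + 6) * (∑ a : Fin n, ∑ b : Fin n, M (a * n + b)) + 24 * n ^ 2 + 18 * n + 6 := by
  have h1 : ∀ a b : ℕ, tipLoopCost n M a b =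
      1100 * (n + 1) ^ 2 * (∑ x : Fin n, M (a * n + x) * M (b * n + x)) + 34 * n + 4 := by
    intro a b
    simp only [tipLoopCost, tipCost, Finset.sum_range, Finset.sum_add_distrib, Finset.sum_const,
      Finset.card_range, smul_eq_mul, Finset.mul_sum]
    rw [Finset.sum_congr rfl fun x _ => mul_comm _ (1100 * (n + 1) ^ 2)]
    ring
  have h2 : ∀ a : ℕ, edgeLoopCost n M a = 1100 * (n + 1) ^ 2 *
      (∑ b : Fin n, M (a * n + b) * ∑ x : Fin n, M (a * n + x) * M (b * n + x)) +
      (34 * n + 6) * (∑ b : Fin n, M (a * n + b)) + 24 * n + 4 := fun a => by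
    have h3 : ∀ b : Fin n, edgeCost n M a b = 1100 * (n + 1) ^ 2 *
        (M (a * n + b) * ∑ x : Fin n, M (a * n + x) * M (b * n + x)) +
        (34 * n + 6) * M (a * n + b) + 20 := fun b => by
      rw [edgeCost, h1]; ring
    simp only [edgeLoopCost, Finset.sum_range, h3, Finset.sum_add_distrib, Finset.sum_const,
      Finset.card_univ, Fintype.card_fin, Finset.card_range, smul_eq_mul, ← Finset.mul_sum]
    ring
  simp only [findPathCost, Finset.sum_range, h2, Finset.sum_add_distrib, Finset.sum_const,
    Finset.card_range, smul_eq_mul, ← Finset.mul_sum]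
  ring

/-- With `T ≤ min (2 m n) ((2 m) ^ (3 / 2))` ordered triangles, the search for a best path and the
output are fast enough. -/
theorem time_bound {m t : ℕ} (hm : m = G.edgeSet.ncard)
    (ht : t ≤ findPathCost n ((inputMem G).arr 0) + (60 * n + 100)) :
    (m ≠ 0 → (t : ℝ) ≤ 20000 * min ((m : ℝ) * (n : ℝ) ^ 3)
      ((m : ℝ) ^ (3 / 2 : ℝ) * (n : ℝ) ^ 2)) ∧
    (m = 0 → (t : ℝ) ≤ 20000 * ((n : ℝ) + 1) ^ 2) := by
  classical
  set M : Fin n → Fin n → ℕ := fun a b => (inputMem G).arr 0 (a * n + b) with hMd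
  have hM : ∀ a b, M a b ≤ 1 := fun a b => inputMem_arr_le _
  have hS : ∑ a, ∑ b, M a b = 2 * m := by
    have h1 : ∀ a, ∑ b, M a b = G.degree a := fun a => by
      simp only [hMd, inputMem_arr_zero]
      rw [Finset.sum_boole, ← SimpleGraph.card_neighborFinset_eq_degree]
      simp [SimpleGraph.neighborFinset_eq_filter]
    rw [Finset.sum_congr rfl fun a _ => h1 a, G.sum_degrees_eq_twice_card_edges, hm,
      ← SimpleGraph.coe_edgeFinset, Set.ncard_coe_finset]
  set T := ∑ a, ∑ b, M a b * ∑ x, M a x * M b x with hT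
  have hT1 : T ^ 2 ≤ (2 * m) ^ 3 := hS ▸ sq_sum_triangles_le M hM
  have hT2 : T ≤ 2 * m * n := by
    rw [← hS, Finset.sum_mul]
    refine Finset.sum_le_sum fun a _ => ?_
    rw [Finset.sum_mul]
    refine Finset.sum_le_sum fun b _ => Nat.mul_le_mul_left _ ?_
    calc ∑ x, M a x * M b x ≤ ∑ _x : Fin n, 1 :=
          Finset.sum_le_sum fun x _ => Nat.mul_le_mul (hM a x) (hM b x)
      _ = n := by simp
  have ht' : t ≤ 1100 * (n + 1) ^ 2 * T + (34 * n + 6) * (2 * m) + 24 * n ^ 2 + 78 * n + 106 := by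
    rw [findPathCost_eq] at ht
    change t ≤ 1100 * (n + 1) ^ 2 * T + (34 * n + 6) * (∑ a, ∑ b, M a b) + 24 * n ^ 2 + 18 * n +
      6 + (60 * n + 100) at ht
    rw [hS] at ht
    linarith
  have htR : (t : ℝ) ≤ 1100 * (n + 1) ^ 2 * T + (34 * n + 6) * (2 * m) + 24 * n ^ 2 + 78 * n +
      106 := by exact_mod_cast ht'
  have hT1R : (T : ℝ) ^ 2 ≤ (2 * m) ^ 3 := by exact_mod_cast hT1
  have hT2R : (T : ℝ) ≤ 2 * m * n := by exact_mod_cast hT2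
  have hT0 : (0 : ℝ) ≤ T := Nat.cast_nonneg T
  have hn0 : (0 : ℝ) ≤ n := Nat.cast_nonneg n
  constructor
  · intro hm0
    have hm1 : (1 : ℝ) ≤ m := by exact_mod_cast Nat.one_le_iff_ne_zero.2 hm0
    have hn1 : (1 : ℝ) ≤ n := by
      have : n ≠ 0 := fun h => by
        have h' : (T : ℝ) ≤ 2 * m * n := hT2R
        subst h
        simp at hS
        omega
      exact_mod_cast Nat.one_le_iff_ne_zero.2 this
    set y : ℝ := (m : ℝ) ^ (3 / 2 : ℝ) with hy
    have hy2 : y ^ 2 = (m : ℝ) ^ 3 := by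
      rw [hy, ← Real.rpow_natCast, ← Real.rpow_mul (by linarith), ← Real.rpow_natCast]
      norm_num
    have hmy : (m : ℝ) ≤ y := by
      calc (m : ℝ) = (m : ℝ) ^ (1 : ℝ) := (Real.rpow_one _).symm
        _ ≤ y := Real.rpow_le_rpow_of_exponent_le hm1 (by norm_num)
    have hTy : (T : ℝ) ≤ 3 * y := by
      refine abs_le_of_sq_le_sq' ?_ (by linarith) |>.2
      nlinarith
    have hn2 : ((n : ℝ) + 1) ^ 2 ≤ 4 * n ^ 2 := by nlinarith
    have hmain : ∀ z : ℝ, (T : ℝ) ≤ 3 * z → (m : ℝ) ≤ z → (t : ℝ) ≤ 20000 * (z * (n : ℝ) ^ 2) := by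
      intro z h1 h2
      have hnn : (n : ℝ) ≤ n ^ 2 := by nlinarith
      have hz1 : 1 ≤ z := hm1.trans h2
      have e1 : ((n : ℝ) + 1) ^ 2 * T ≤ 4 * n ^ 2 * (3 * z) :=
        mul_le_mul hn2 h1 hT0 (by positivity)
      have e2 : ((34 : ℝ) * n + 6) * (2 * m) ≤ 40 * n ^ 2 * (2 * z) :=
        mul_le_mul (by nlinarith) (by linarith) (by positivity) (by positivity)
      have e3 : (n : ℝ) ^ 2 ≤ z * n ^ 2 := le_mul_of_one_le_left (by positivity) hz1
      nlinarith
    rw [mul_min_of_nonneg _ _ (by norm_num)]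
    refine le_min ?_ (hmain y hTy hmy)
    have := hmain (m * n) (by nlinarith) (le_mul_of_one_le_right (by linarith) hn1)
    calc (t : ℝ) ≤ 20000 * (m * n * (n : ℝ) ^ 2) := this
      _ = 20000 * (m * (n : ℝ) ^ 3) := by ring
  · intro hm0
    rw [hm0] at hT2R htR
    have : (T : ℝ) = 0 := le_antisymm (by simpa using hT2R) hT0
    rw [this] at htR
    push_cast at htR
    nlinarith

/-- Finding a best linking path and evaluating it takes the claimed time, with words for the numbers
below `(n + 2) ^ 4`. -/
theorem RunsInTime.of_runs {q : Prog} {dom : ∀ {n : ℕ}, SimpleGraph (Fin n) → Prop}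
    {post : ∀ {n : ℕ}, SimpleGraph (Fin n) → Mem → Prop}
    (h : ∀ {n W : ℕ} {G : SimpleGraph (Fin n)} {s : Mem}, n * n + 4 * n + 16 ≤ W → dom G →
      HoldsBest G (fun _ _ _ => True) s → Runs W q s (60 * n + 100) (post G)) :
    RunsInTime (.seq findPath q) dom post := by
  refine ⟨4, 20000, fun n G hG => ?_⟩
  have hW : n * n + 4 * n + 16 ≤ (n + 2) ^ 4 := by
    have : 4 * (n + 2) ^ 2 ≤ (n + 2) ^ 2 * (n + 2) ^ 2 := 
      Nat.mul_le_mul_right _ (Nat.pow_le_pow_left (by omega : 2 ≤ n + 2) 2)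
    calc n * n + 4 * n + 16 ≤ 4 * (n + 2) ^ 2 := by nlinarith
      _ ≤ (n + 2) ^ 2 * (n + 2) ^ 2 := this
      _ = (n + 2) ^ 4 := by ring
  obtain ⟨s, t, he, ht, hpost⟩ := Runs.seq_of (findPath_runs (G := G) hW) fun _ _ hs => h hW hG hs
  exact ⟨s, t, he, hpost, fun m hm => time_bound hm ht⟩

end Time

/-- Find-sun is correct on building-free graphs, whatever choices are made during its execution;
it has an implementation within the stated time; and on building-free graphs a sun can be found
within that time whenever one exists. -/
theorem mainTheorem1 :
    (∀ (V : Type*) [Finite V] (G : SimpleGraph V), BuildingFree G →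
      ∀ b : Bool, FindSunReturns G b ↔ (b = true ↔ ContainsSun G)) ∧
    (∃ p : Prog, RunsInTime p (fun _ => True) HoldsFindSunAnswer) ∧
    (∃ p : Prog, RunsInTime p BuildingFree HoldsSun) := by
  refine ⟨fun V _ G hG b => ?_,
    ⟨_, .of_runs (q := emitAnswer) fun hW _ hs => emitAnswer_runs hW hs⟩,
    ⟨_, .of_runs (q := emitSun) fun hW hG hs => emitSun_runs hW hG hs⟩⟩
  rw [findSunReturns_iff, containsSun_iff_hasLinkedTriangle hG]
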